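/- **Setting.** An *interactive weakly verifiable puzzle* $P$ is given by a poser which tosses finitely many uniform random bits $\pi$ and interacts with a solver in $r$ rounds (in each round it sends a message, a function of $\pi$ and of the replies so far, and receives a reply), and which finally outputs a circuit $\Gamma$. A solver, which never sees $\Gamma$, outputs a string $y$ and succeeds if $\Gamma(y)=1$. For $g:\{0,1\}^k\to\{0,1\}$, the puzzle $P^{(g)}$ consists of $k$ instances of $P$ with independent coins, played one after the other; after the last one the solver outputs $y_1,\dots,y_k$, and succeeds if $g(\Gamma^{(1)}(y_1),\dots,\Gamma^{(k)}(y_k))=1$. Let $\mu_\delta^k$ be the distribution of $k$ independent bits, each equal to $1$ with probability $\delta$. Solvers $C$ for $P^{(g)}$ are interactive Boolean circuits (one circuit for the initial memory, one per message, which updates the memory and computes the reply, and one for the answers), possibly with random input bits; $\mathrm{size}(C)$ is the number of gates. A solver $D$ for a single instance is an oracle circuit (a straight-line sequence of instructions with hardwired constants) which may simulate the poser and use $C$ and $g$ by calls. The calls to $C$ are to its per-message circuits, in copies of $C$ whose state may be duplicated; $\mathrm{size}(D)$ denotes the total number of gates in the (partial) copies of $C$ that $D$ contains, and the number of instructions of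 $D$ is stated separately. $D$ is *non-rewinding* if there are a fixed position $i\in\{1,\dots,k\}$ and fixed poser messages for instances $1,\dots,i-1$ such that in every execution of $D$ all calls to $C$ use these messages in the first $i-1$ instances and the messages of the actual poser in instance $i$ (as far as the call extends), all with the same random bits of $C$. **Theorem.** There are a randomized algorithm $\mathrm{Gen}$ and a constant $c$ such that the following holds for every interactive weakly verifiable puzzle $P$ with $r$ rounds, all integers $k\ge 1$ and $n\ge 0$, every monotone $g:\{0,1\}^k\to\{0,1\}$, all real $0<\varepsilon\le 1$ and $0\le\delta\le 1$, and every solver circuit $C$ for $P^{(g)}$. $\mathrm{Gen}$ receives $k,n,r,\varepsilon,\delta$ (with $\varepsilon,\delta$ given by their binary expansions, and $\lceil 1/\varepsilon\rceil$), may use $C$, $g$ and the poser of $P$ only as oracles, and outputs a solver $D$ for a single instance of $P$, such that: 1. If $\Pr[C \text{ solves } P^{(g)}]\ \ge\ \Pr_{u\leftarrow\mu_\delta^k}[g(u)=1]+\varepsilon$, then with probability at least $1-c\,(n+1)^c\,2^{-n}$ over the randomness of $\mathrm{Gen}$, $$\Pr[D \text{ solves } P]\ \ge\ \delta+\frac{\varepsilon}{6k}.$$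 2. $D$ is always non-rewinding, and $$\mathrm{size}(D)\ \le\ \mathrm{size}(C)\cdot\frac{6k}{\varepsilon}\,\ln\!\Big(\frac{6k}{\varepsilon}\Big);$$ moreover $D$ has at most $c\,(k+1/\varepsilon+n+r)^c$ instructions. 3. $\mathrm{Gen}$ always runs in at most $c\,(k+1/\varepsilon+n+r)^c$ steps, where each call to $C$, $g$ or the poser (starting a copy with fresh coins, one message, or evaluating the answers or $\Gamma$) counts as one step. -/

import Mathlib

namespace WVP

/-! ## Boolean circuits -/

/-- Bit strings of length `n`. -/
abbrev Word (n : ℕ) : Type := Fin n → Bool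

/-- A Boolean circuit with `a` input wires and `b` output wires: a sequence of gates of fan-in two
over the full binary basis.  The wires are numbered, first the inputs, then the gates in their
order; a wire number that does not exist (yet) reads as the constant `false`. -/
structure BoolCircuit (a b : ℕ) where
  gates : List ((Bool → Bool → Bool) × ℕ × ℕ)
  out : Fin b → ℕ

/-- The values of all wires. -/
def BoolCircuit.wires {a b : ℕ} (K : BoolCircuit a b) (x : Word a) : List Bool :=
  K.gates.foldl
    (fun w γ => w ++ [γ.1 (w.getD γ.2.1 false) (w.getD γ.2.2 false)]) (List.ofFn x)

def BoolCircuit.eval {a b : ℕ} (K : BoolCircuit a b) (x : Word a) : Word b :=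
  fun j => (K.wires x).getD (K.out j) false

def BoolCircuit.size {a b : ℕ} (K : BoolCircuit a b) : ℕ := K.gates.length

/-! ## Probabilities -/

/-- The probability of the event `s` under the distribution `p`. -/
noncomputable def prob {α : Type} (p : PMF α) (s : Set α) : ℝ := (p.toOuterMeasure s).toReal

/-- The uniform distribution on bit strings. -/
noncomputable def uniformWord (n : ℕ) : PMF (Word n) := PMF.uniformOfFintype (Word n)

/-- `Pr[g(u) = 1]` for a string `u` of `k` independent bits, each being 1 with probability `δ`. -/
noncomputable def bernoulliProb (k : ℕ) (δ : ℝ) (g : Word k → Bool) : ℝ :=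
  ∑ u : Word k, if g u = true then ∏ j : Fin k, (if u j = true then δ else 1 - δ) else 0

/-! ## Interactive weakly verifiable puzzles -/

/-- An interactive weakly verifiable puzzle, given by its poser.  The poser tosses `coins` coins.
In each of the `rounds` rounds it sends a message, which is a function of its coins and of the
replies received so far, and receives a reply; in the end it outputs a circuit `Γ` that checks
answers.  Lists of messages and lists of replies have the most recent entry first. -/
structure Puzzle where
  coins : ℕ
  rounds : ℕ
  msgLen : ℕ
  repLen : ℕ
  ansLen : ℕ
  poser : Word coins → List (Word repLen) → Word msgLen
  output : Word coins → List (Word repLen) → BoolCircuit ansLen 1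

namespace Puzzle

/-- `Γ(y)` for the circuit `Γ` that the poser outputs. -/
def check (P : Puzzle) (π : Word P.coins) (b : List (Word P.repLen)) (y : Word P.ansLen) : Bool :=
  (P.output π b).eval y 0

/-- The messages of the poser that were answered by the replies `b` (most recent first). -/
def messages (P : Puzzle) (π : Word P.coins) : List (Word P.repLen) → List (Word P.msgLen)
  | [] => []
  | _ :: b => P.poser π b :: P.messages π b

end Puzzle

/-- A (randomized) interactive circuit that plays `k` instances of the puzzle `P` one after the
other, so that it receives `k * P.rounds` messages, and then outputs `k` answers.  There is one
circuit per message; it maps the content of the memory wires and the message to the new content of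
the memory wires and the reply.  The circuit `start` computes the memory from the random bits, and
`out` computes the answers from the memory after the last message. -/
structure SolverCircuit (P : Puzzle) (k : ℕ) where
  coins : ℕ
  mem : ℕ
  start : BoolCircuit coins mem
  step : Fin (k * P.rounds) → BoolCircuit (mem + P.msgLen) (mem + P.repLen)
  out : BoolCircuit mem (k * P.ansLen)

namespace SolverCircuit

variable {P : Puzzle} {k : ℕ}

/-- The number of gates in the circuit for message number `s`. -/
def stepSize (C : SolverCircuit P k) (s : ℕ) : ℕ :=
  if hs : s < k * P.rounds then (C.step ⟨s, hs⟩).size else 0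

/-- The total number of gates. -/
def size (C : SolverCircuit P k) : ℕ :=
  C.start.size + (∑ s : Fin (k * P.rounds), (C.step s).size) + C.out.size

/-- The memory and the last reply of `C`, with random bits `ρ`, after it received the messages in
the list (most recent first). -/
def state (C : SolverCircuit P k) (ρ : Word C.coins) :
    List (Word P.msgLen) → Word C.mem × Word P.repLen
  | [] => (C.start.eval ρ, fun _ => false)
  | x :: h =>
    if hs : h.length < k * P.rounds then
      let z := (C.step ⟨h.length, hs⟩).eval (Fin.append (C.state ρ h).1 x)
      (fun j => z (Fin.castAdd P.repLen j), fun j => z (Fin.natAdd C.mem j))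
    else C.state ρ h

def reply (C : SolverCircuit P k) (ρ : Word C.coins) (h : List (Word P.msgLen)) : Word P.repLen :=
  (C.state ρ h).2

/-- The `k` answers of `C` after the messages `h`. -/
def answers (C : SolverCircuit P k) (ρ : Word C.coins) (h : List (Word P.msgLen)) :
    Fin k → Word P.ansLen :=
  fun j a => C.out.eval (C.state ρ h).1 (finProdFinEquiv (j, a))

/-- `t` rounds of an instance of the puzzle in which the poser has the coins `π`, played by `C`
after it received the messages `h` earlier.  Result: all messages that `C` has received now, and
the replies to this instance of the poser. -/
def play (C : SolverCircuit P k) (ρ : Word C.coins) (π : Word P.coins)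
    (h : List (Word P.msgLen)) : ℕ → List (Word P.msgLen) × List (Word P.repLen)
  | 0 => (h, [])
  | t + 1 =>
    let q := C.play ρ π h t
    let x := P.poser π q.2
    (x :: q.1, C.reply ρ (x :: q.1) :: q.2)

/-- The messages that `C` received during the first `i` instances, if the poser uses the coins
`π j` in instance `j`. -/
def history (C : SolverCircuit P k) (ρ : Word C.coins) (π : Fin k → Word P.coins) :
    ℕ → List (Word P.msgLen)
  | 0 => []
  | i + 1 =>
    if hi : i < k then (C.play ρ (π ⟨i, hi⟩) (C.history ρ π i) P.rounds).1
    else C.history ρ π i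

/-- Which of the `k` sequentially created instances `C` solves. -/
def solved (C : SolverCircuit P k) (ρ : Word C.coins) (π : Fin k → Word P.coins) : Word k :=
  fun i => P.check (π i) (C.play ρ (π i) (C.history ρ π i) P.rounds).2
    (C.answers ρ (C.history ρ π k) i)

/-- The success probability of `C` in the puzzle that consists of `k` sequential instances of `P`
whose checking bits are combined by `g`. -/
noncomputable def successProb (C : SolverCircuit P k) (g : Word k → Bool) : ℝ :=
  prob (PMF.uniformOfFintype (Word C.coins × (Fin k → Word P.coins)))
    {ω | g (C.solved ω.1 ω.2) = true}

end SolverCircuit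

/-! ## Oracle programs

The machine has number registers, a bank of bits (the argument of `g`), registers for messages,
replies and answers, copies of the poser that it simulates, and copies of `C` in the middle of an
execution.  It can use `C` and `g` only by calling them. -/

/-- A simulated copy of the poser: its coins and the replies sent to it (most recent first). -/
structure PoserCopy (P : Puzzle) where
  coins : Word P.coins
  replies : List (Word P.repLen)

/-- A copy of `C`: its random bits and the messages sent to it (most recent first). -/
structure SolverCopy {P : Puzzle} {k : ℕ} (C : SolverCircuit P k) where
  coins : Word C.coins
  hist : List (Word P.msgLen)

/-- The memory of the machine. -/
structure Memory {P : Puzzle} {k : ℕ} (C : SolverCircuit P k) where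
  num : ℕ → ℕ
  bit : ℕ → Bool
  msg : ℕ → Word P.msgLen
  rep : ℕ → Word P.repLen
  ans : ℕ → Word P.ansLen
  outs : ℕ → Fin k → Word P.ansLen
  posers : ℕ → PoserCopy P
  solvers : ℕ → SolverCopy C

/-- Basic operations.  The arguments are numbers of registers (except for the value `v` of
`const`).  Bits and simulated posers are addressed indirectly, by the content of a number
register. -/
inductive Op : Type
  /-- `num d := v` -/
  | const (d v : ℕ)
  /-- `num d := num a` -/
  | copy (d a : ℕ)
  | add (d a b : ℕ)
  /-- truncated subtraction -/
  | sub (d a b : ℕ)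
  /-- `num d := 1` if `num a < num b`, and `0` otherwise -/
  | lt (d a b : ℕ)
  /-- toss a fair coin -/
  | coin (d : ℕ)
  /-- bit number `num i` becomes 1 if `num a ≠ 0`, and 0 otherwise -/
  | setBit (i a : ℕ)
  /-- call `g` on the bits number `0, …, k - 1` -/
  | evalG (d : ℕ)
  /-- poser number `num p` is started with fresh coins -/
  | newP (p : ℕ)
  /-- `msg x` becomes the next message of poser number `num p` -/
  | nextMsg (p x : ℕ)
  /-- send the reply `rep y` to poser number `num p` -/
  | sendP (p y : ℕ)
  /-- check `ans a` with the circuit that poser number `num p` outputs -/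
  | checkP (d p a : ℕ)
  /-- poser number `num d` becomes a copy of poser number `num p` -/
  | copyP (d p : ℕ)
  /-- start a copy of `C` with fresh random bits -/
  | newC (c : ℕ)
  /-- send the message `msg x` to copy `c` of `C`, and store the reply in `rep y` -/
  | stepC (c x y : ℕ)
  /-- let copy `c` of `C` compute its `k` answers -/
  | outC (c o : ℕ)
  /-- duplicate a copy of `C` in its present state -/
  | copyC (d c : ℕ)
  /-- `ans d` becomes answer number `num j` in `outs o` -/
  | select (d o j : ℕ)
  /-- `ans d := ans a` if `num z ≠ 0` -/
  | condAns (z d a : ℕ)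

/-- Sending a message to a copy of `C`; after the last message nothing happens. -/
def SolverCopy.push {P : Puzzle} {k : ℕ} {C : SolverCircuit P k} (q : SolverCopy C)
    (x : Word P.msgLen) : SolverCopy C :=
  if q.hist.length < k * P.rounds then { q with hist := x :: q.hist } else q

namespace Op

variable {P : Puzzle} {k : ℕ} {C : SolverCircuit P k}

/-- The effect of a basic operation on the memory. -/
noncomputable def exec (g : Word k → Bool) (m : Memory C) : Op → PMF (Memory C)
  | const d v => PMF.pure { m with num := Function.update m.num d v }
  | copy d a => PMF.pure { m with num := Function.update m.num d (m.num a) }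
  | add d a b => PMF.pure { m with num := Function.update m.num d (m.num a + m.num b) }
  | sub d a b => PMF.pure { m with num := Function.update m.num d (m.num a - m.num b) }
  | lt d a b => PMF.pure
      { m with num := Function.update m.num d (if m.num a < m.num b then 1 else 0) }
  | coin d => (PMF.uniformOfFintype Bool).map fun β =>
      { m with num := Function.update m.num d (if β = true then 1 else 0) }
  | setBit i a => PMF.pure
      { m with bit := Function.update m.bit (m.num i) (decide (m.num a ≠ 0)) }
  | evalG d => PMF.pure
      { m with num := Function.update m.num d
                (if g (fun j => m.bit j) = true then 1 else 0) }
  | newP p => (uniformWord P.coins).map fun π =>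
      { m with posers := Function.update m.posers (m.num p) ⟨π, []⟩ }
  | nextMsg p x => PMF.pure
      { m with msg := Function.update m.msg x
                (P.poser (m.posers (m.num p)).coins (m.posers (m.num p)).replies) }
  | sendP p y => PMF.pure
      { m with posers := Function.update m.posers (m.num p)
                ⟨(m.posers (m.num p)).coins, m.rep y :: (m.posers (m.num p)).replies⟩ }
  | checkP d p a => PMF.pure
      { m with num := Function.update m.num d
                (if P.check (m.posers (m.num p)).coins (m.posers (m.num p)).replies (m.ans a) = true
                  then 1 else 0) }
  | copyP d p => PMF.pure
      { m with posers := Function.update m.posers (m.num d) (m.posers (m.num p)) }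
  | newC c => (uniformWord C.coins).map fun ρ =>
      { m with solvers := Function.update m.solvers c ⟨ρ, []⟩ }
  | stepC c x y =>
      let q := (m.solvers c).push (m.msg x)
      PMF.pure
        { m with
          solvers := Function.update m.solvers c q
          rep := Function.update m.rep y (C.reply q.coins q.hist) }
  | outC c o => PMF.pure
      { m with outs := Function.update m.outs o
                (C.answers (m.solvers c).coins (m.solvers c).hist) }
  | copyC d c => PMF.pure
      { m with solvers := Function.update m.solvers d (m.solvers c) }
  | select d o j => PMF.pure
      { m with ans := Function.update m.ans d
                (if hj : m.num j < k then m.outs o ⟨m.num j, hj⟩ else fun _ => false) }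
  | condAns z d a => PMF.pure
      { m with ans := Function.update m.ans d (if m.num z ≠ 0 then m.ans a else m.ans d) }

/-- The copy of `C`, if any, that the operation has evaluated on its messages; `m` is the memory
after the operation. -/
def calls (m : Memory C) : Op → List (SolverCopy C)
  | stepC c _ _ => [m.solvers c]
  | outC c _ => [m.solvers c]
  | _ => []

end Op

/-! ## Solvers for a single instance -/

/-- An instruction of a solver for a single instance: a basic operation, or a move in the actual
interaction with the poser: receive the next message in `msg x`, or send the reply `rep y`. -/
inductive Instr : Type
  | op (o : Op)
  | recv (x : ℕ)
  | send (y : ℕ)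

/-- A solver for a single instance of `P`: an oracle circuit with calls to `C` and `g`, in the form
of a straight-line sequence of instructions (no loops, no jumps) together with the hardwired
initial content of the memory.  Its answer is the final content of `ans 0`. -/
structure Solver {P : Puzzle} {k : ℕ} (C : SolverCircuit P k) where
  memory : Memory C
  code : List Instr

/-- A state in the execution of a solver: the memory, the actual poser (which the solver accesses
only through `recv` and `send`), and the record of the calls to `C`. -/
structure SolverState {P : Puzzle} {k : ℕ} (C : SolverCircuit P k) where
  memory : Memory C
  live : PoserCopy P
  calls : List (SolverCopy C)

namespace Instr

variable {P : Puzzle} {k : ℕ} {C : SolverCircuit P k}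

/-- The effect of an instruction.  After the last round, `recv` and `send` do nothing. -/
noncomputable def exec (g : Word k → Bool) (s : SolverState C) : Instr → PMF (SolverState C)
  | op o => (o.exec g s.memory).map fun m =>
      { s with memory := m, calls := s.calls ++ o.calls m }
  | recv x => PMF.pure
      (if s.live.replies.length < P.rounds then
        { s with
          memory := { s.memory with
            msg := Function.update s.memory.msg x (P.poser s.live.coins s.live.replies) } }
      else s)
  | send y => PMF.pure
      (if s.live.replies.length < P.rounds then
        { s with live := ⟨s.live.coins, s.memory.rep y :: s.live.replies⟩ }
      else s)

/-- The number of gates in the part of `C` that an instruction evaluates; `stage c` is the number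
of messages that copy `c` has received. -/
def gates (C : SolverCircuit P k) (stage : ℕ → ℕ) : Instr → ℕ
  | op (Op.newC _) => C.start.size
  | op (Op.stepC c _ _) => C.stepSize (stage c)
  | op (Op.outC _ _) => C.out.size
  | _ => 0

/-- How an instruction changes the numbers of messages that the copies of `C` have received. -/
def nextStage (P : Puzzle) (k : ℕ) (stage : ℕ → ℕ) : Instr → ℕ → ℕ
  | op (Op.newC c) => Function.update stage c 0
  | op (Op.stepC c _ _) =>
      Function.update stage c (if stage c < k * P.rounds then stage c + 1 else stage c)
  | op (Op.copyC d c) => Function.update stage d (stage c)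
  | _ => stage

end Instr

/-- The total number of gates in the (partial) copies of `C` contained in a sequence of
instructions. -/
def codeSize {P : Puzzle} {k : ℕ} (C : SolverCircuit P k) : (ℕ → ℕ) → List Instr → ℕ
  | _, [] => 0
  | stage, i :: l => i.gates C stage + codeSize C (i.nextStage P k stage) l

/-- Execution of a sequence of instructions. -/
noncomputable def runCode {P : Puzzle} {k : ℕ} {C : SolverCircuit P k} (g : Word k → Bool) :
    List Instr → SolverState C → PMF (SolverState C)
  | [], s => PMF.pure s
  | i :: l, s => (i.exec g s).bind (runCode g l)

namespace Solver

variable {P : Puzzle} {k : ℕ} {C : SolverCircuit P k}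

/-- The size of `D`, counted as the total number of gates in the copies of `C` contained in `D`. -/
def size (D : Solver C) : ℕ := codeSize C (fun c => (D.memory.solvers c).hist.length) D.code

/-- The interaction of `D` with a poser that has the coins `π`. -/
noncomputable def run (D : Solver C) (g : Word k → Bool) (π : Word P.coins) :
    PMF (SolverState C) :=
  runCode g D.code ⟨D.memory, ⟨π, []⟩, []⟩

/-- The probability that `D` solves a single instance of the puzzle. -/
noncomputable def successProb (D : Solver C) (g : Word k → Bool) : ℝ :=
  prob ((uniformWord P.coins).bind fun π => D.run g π)
    {s | s.live.replies.length = P.rounds ∧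
      P.check s.live.coins s.live.replies (s.memory.ans 0) = true}

/-- `D` is non-rewinding: there are a fixed position `i` and fixed messages `pre` for the `i`
instances before it, such that in every execution all calls to `C` use the messages `pre` in these
instances and the messages of the actual poser in the instance at position `i`; moreover all calls
in one execution use the same random bits of `C`. -/
def NonRewinding (D : Solver C) (g : Word k → Bool) : Prop :=
  ∃ i < k, ∃ pre : List (Word P.msgLen), pre.length = i * P.rounds ∧
    ∀ (π : Word P.coins), ∀ s ∈ (D.run g π).support,
      (∃ ρ : Word C.coins, ∀ q ∈ s.calls, q.coins = ρ) ∧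
      ∀ q ∈ s.calls, q.hist.reverse.take ((i + 1) * P.rounds) <+:
        pre ++ (P.messages s.live.coins s.live.replies).reverse

end Solver

/-! ## The generating algorithm -/

/-- Programs that produce a solver.  The real parameters `ε` and `δ` are given by their binary
expansions: `eps d t` and `delta d t` store `⌊2 ^ τ * ε⌋` and `⌊2 ^ τ * δ⌋` in `num d`, where `τ` is
the content of `num t`; this takes `1 + τ` steps.  Multiplication and integer division take as many
steps as the operands have binary digits, plus one.  Every other operation, in particular a call to
`C`, to `g` or to the poser, and every test and every iteration of a loop takes one step. -/
inductive Program : Type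
  | skip
  | op (o : Op)
  | mul (d a b : ℕ)
  | div (d a b : ℕ)
  | eps (d t : ℕ)
  | delta (d t : ℕ)
  /-- append an instruction to the code of the solver that is being built -/
  | emit (i : Instr)
  | seq (c₁ c₂ : Program)
  /-- `c₁` if `num a ≠ 0`, and `c₂` otherwise -/
  | ite (a : ℕ) (c₁ c₂ : Program)
  /-- repeat `c` as many times as `num a` says on entry -/
  | loop (a : ℕ) (c : Program)

/-- A state in the execution of a program: the memory, the code emitted so far, and the number of
steps made so far. -/
structure ProgramState {P : Puzzle} {k : ℕ} (C : SolverCircuit P k) where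
  memory : Memory C
  code : List Instr
  time : ℕ

/-- Repeat a random transition `t` times. -/
noncomputable def repeatPMF {α : Type} (f : α → PMF α) : ℕ → α → PMF α
  | 0, a => PMF.pure a
  | t + 1, a => (f a).bind (repeatPMF f t)

namespace Program

variable {P : Puzzle} {k : ℕ} {C : SolverCircuit P k}

noncomputable def exec (g : Word k → Bool) (ε δ : ℝ) :
    Program → ProgramState C → PMF (ProgramState C)
  | skip, s => PMF.pure s
  | op o, s => (o.exec g s.memory).map fun m =>
      { s with memory := m, time := s.time + 1 }
  | mul d a b, s => PMF.pure
      { s with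
        memory := { s.memory with
          num := Function.update s.memory.num d (s.memory.num a * s.memory.num b) }
        time := s.time + 1 + (s.memory.num a).size + (s.memory.num b).size }
  | div d a b, s => PMF.pure
      { s with
        memory := { s.memory with
          num := Function.update s.memory.num d (s.memory.num a / s.memory.num b) }
        time := s.time + 1 + (s.memory.num a).size + (s.memory.num b).size }
  | eps d t, s => PMF.pure
      { s with
        memory := { s.memory with
          num := Function.update s.memory.num d ⌊(2 : ℝ) ^ s.memory.num t * ε⌋₊ }
        time := s.time + 1 + s.memory.num t }
  | delta d t, s => PMF.pure
      { s with
        memory := { s.memory with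
          num := Function.update s.memory.num d ⌊(2 : ℝ) ^ s.memory.num t * δ⌋₊ }
        time := s.time + 1 + s.memory.num t }
  | emit i, s => PMF.pure { s with code := s.code ++ [i], time := s.time + 1 }
  | seq c₁ c₂, s => (exec g ε δ c₁ s).bind (exec g ε δ c₂)
  | ite a c₁ c₂, s =>
      if s.memory.num a ≠ 0 then exec g ε δ c₁ { s with time := s.time + 1 }
      else exec g ε δ c₂ { s with time := s.time + 1 }
  | loop a c, s =>
      repeatPMF (fun s' => exec g ε δ c { s' with time := s'.time + 1 }) (s.memory.num a)
        { s with time := s.time + 1 }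

end Program

/-- The initial memory: `k`, `n`, the number of rounds of the puzzle, and `1 / ε` rounded up are
in the first four number registers, everything else is zero. -/
noncomputable def Memory.initial {P : Puzzle} {k : ℕ} (C : SolverCircuit P k) (ε : ℝ) (n : ℕ) :
    Memory C where
  num := fun j =>
    if j = 0 then k else if j = 1 then n else if j = 2 then P.rounds
    else if j = 3 then ⌈1 / ε⌉₊ else 0
  bit := fun _ => false
  msg := fun _ _ => false
  rep := fun _ _ => false
  ans := fun _ _ => false
  outs := fun _ _ _ => false
  posers := fun _ => ⟨fun _ => false, []⟩
  solvers := fun _ => ⟨fun _ => false, []⟩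

/-- The execution of a program with the parameters `ε`, `δ`, `n` and oracle access to `C`, `g` and
the poser of `P`. -/
noncomputable def Program.run {P : Puzzle} {k : ℕ} (A : Program) (C : SolverCircuit P k)
    (g : Word k → Bool) (ε δ : ℝ) (n : ℕ) : PMF (ProgramState C) :=
  A.exec g ε δ ⟨Memory.initial C ε n, [], 0⟩

/-- The solver that a program has produced: the emitted code, with the final content of the
memory of the program hardwired. -/
def ProgramState.solver {P : Puzzle} {k : ℕ} {C : SolverCircuit P k} (s : ProgramState C) :
    Solver C :=
  ⟨s.memory, s.code⟩

end WVP

/-! Put K = ⌈1/ε⌉ and η = 1/(kK). Fix the random bits of C, the messages of the first e instances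
and assumed bits for them. The surplus is the probability that g accepts these bits followed by the
checking bits that C achieves in the later instances, minus the probability that g accepts them
followed by independent bits of bias δ. For e = 0 its mean over the random bits of C is at least ε ≥
kη; for e = k it is 0. Gen fixes random bits, and then one instance after another together with a
guessed bit, keeping the surplus above (k - e - 3/16)η. It stops at a stage e where a random
continuation rarely has surplus above T = (k - e - 1)η (`Advantage`, `Terminal`; the last stage is
covered by `terminal_last`).

At this stage D plays instance e with the actual poser and simulates the later instances repeatedly.
A simulation is pivotal if g accepts with bit e set to 1 and rejects with bit e set to 0; D outputs
the answer of C for instance e in a pivotal simulation. For coins x of the actual poser let q(x) be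
the probability of a pivotal simulation, s(x) that of a pivotal one with a correct answer, S_β(x)
the surplus after fixing x with bit β, and p the probability that bit e is pivotal for independent
bits. Monotonicity of g gives q = p + S_1 - S_0 (`value_true_eq`), and splitting acceptance at bit e
gives E[S_0 + s] = surplus + δp (`value_eq_average`). With unlimited trials D succeeds with
probability D(x), where s = qD, so that S_0 + s = pD + (S_1 D + S_0 (1 - D)). The bracket is a
convex combination of surpluses, hence at most T outside a rare event. Therefore p(E[D] - δ) is at
least a constant times η, and p ≤ 1 finishes the argument (`le_average`). Stopping after m trials
costs only (1 - q)^m q ≤ 1/(m + 1) (`pow_mul_le`), so 5kK trials suffice.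

Gen cannot compute surpluses. It compares two counters of sampled successes with a threshold, and a
Chernoff bound makes wrong decisions unlikely (`ev_estimate_le`, `reliable_of_params`). A potential
function then bounds the failure of a whole search (`ev_search_le`, `ev_searchResult_le`).

Programs are linked to these experiments by three devices. `Coupled` compares a random program with
an ideal experiment; a `Frame` lists the memory cells that a program provably leaves alone; and
emitted straight-line code is the unrolled form of a program, with the same effect
(`runOps_unroll`). -/

namespace WVP
open scoped ENNReal

/-! ## Expectations -/

/-- The expectation of `f` under `p`. -/
noncomputable def ev {α : Type} (p : PMF α) (f : α → ℝ≥0∞) : ℝ≥0∞ := ∑' a, p a * f a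

/-! ### Probabilistic tools: expectations, almost sure events, couplings, iteration. -/

section Expectation

variable {α β γ : Type}

theorem ev_pure (a : α) (f : α → ℝ≥0∞) : ev (PMF.pure a) f = f a := by
  unfold ev
  rw [tsum_eq_single a]
  · simp
  · intro b hb
    simp [PMF.pure_apply, hb]

theorem ev_bind (p : PMF α) (q : α → PMF β) (f : β → ℝ≥0∞) :
    ev (p.bind q) f = ev p fun a => ev (q a) f := by
  unfold ev
  simp only [PMF.bind_apply, ← ENNReal.tsum_mul_right, ← ENNReal.tsum_mul_left]
  rw [ENNReal.tsum_comm]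
  simp only [mul_assoc]

theorem ev_map (p : PMF α) (φ : α → β) (f : β → ℝ≥0∞) : ev (p.map φ) f = ev p fun a => f (φ a) := by
  rw [← PMF.bind_pure_comp, ev_bind]
  simp [ev_pure]

theorem ev_mono_support {p : PMF α} {f f' : α → ℝ≥0∞} (h : ∀ a ∈ p.support, f a ≤ f' a) :
    ev p f ≤ ev p f' := by
  refine ENNReal.tsum_le_tsum fun a => ?_
  by_cases ha : p a = 0
  · simp [ha]
  · exact mul_le_mul_right (h a ha) _

theorem ev_mono {p : PMF α} {f f' : α → ℝ≥0∞} (h : ∀ a, f a ≤ f' a) : ev p f ≤ ev p f' :=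
  ev_mono_support fun a _ => h a

theorem ev_congr_support {p : PMF α} {f f' : α → ℝ≥0∞} (h : ∀ a ∈ p.support, f a = f' a) :
    ev p f = ev p f' :=
  le_antisymm (ev_mono_support fun a ha => (h a ha).le) (ev_mono_support fun a ha => (h a ha).ge)

theorem ev_const (p : PMF α) (x : ℝ≥0∞) : ev p (fun _ => x) = x := by
  simp [ev, ENNReal.tsum_mul_right, p.tsum_coe]

theorem ev_add (p : PMF α) (f f' : α → ℝ≥0∞) : ev p (fun a => f a + f' a) = ev p f + ev p f' := by
  simp [ev, mul_add, ENNReal.tsum_add]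

theorem ev_mul_right (p : PMF α) (f : α → ℝ≥0∞) (x : ℝ≥0∞) :
    ev p (fun a => f a * x) = ev p f * x := by
  simp [ev, ← mul_assoc, ENNReal.tsum_mul_right]

theorem ev_le_of_le {p : PMF α} {f : α → ℝ≥0∞} {x : ℝ≥0∞} (h : ∀ a ∈ p.support, f a ≤ x) :
    ev p f ≤ x := (ev_mono_support h).trans (ev_const p x).le

theorem ev_uniform (X : Type) [Fintype X] [Nonempty X] (f : X → ℝ≥0∞) :
    ev (PMF.uniformOfFintype X) f = (∑ x, f x) / Fintype.card X := by
  simp [ev, tsum_fintype, PMF.uniformOfFintype_apply, ← Finset.mul_sum, ENNReal.div_eq_inv_mul]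

theorem ev_bool (p : PMF Bool) (f : Bool → ℝ≥0∞) :
    ev p f = p true * f true + p false * f false := by
  simp [ev, tsum_fintype]

open Classical in
/-- The indicator function of a proposition. -/
noncomputable def ind (A : Prop) : ℝ≥0∞ := if A then 1 else 0

theorem ind_le_one (A : Prop) : ind A ≤ 1 := by
  unfold ind; split <;> simp

theorem ind_true {A : Prop} (h : A) : ind A = 1 := by simp [ind, h]

theorem ind_false {A : Prop} (h : ¬A) : ind A = 0 := by simp [ind, h]

theorem ind_mono {A B : Prop} (h : A → B) : ind A ≤ ind B := by
  unfold ind; split <;> simp_all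

theorem ind_le {A : Prop} {x : ℝ≥0∞} (h : A → 1 ≤ x) : ind A ≤ x := by
  unfold ind; split <;> simp_all

theorem ev_ind_le_one (p : PMF α) (A : α → Prop) : ev p (fun a => ind (A a)) ≤ 1 :=
  ev_le_of_le fun _ _ => ind_le_one _

theorem ev_ind_ne_top (p : PMF α) (A : α → Prop) : ev p (fun a => ind (A a)) ≠ ∞ :=
  ne_top_of_le_ne_top ENNReal.one_ne_top (ev_ind_le_one p A)

theorem prob_eq (p : PMF α) (s : Set α) : prob p s = (ev p fun a => ind (a ∈ s)).toReal := by
  classical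
  rw [prob, PMF.toOuterMeasure_apply]
  congr 1
  refine tsum_congr fun a => ?_
  by_cases h : a ∈ s <;> simp [Set.indicator, h, ind]

/-- Real-valued probabilities of predicates. -/
noncomputable def pr (p : PMF α) (A : α → Prop) : ℝ := (ev p fun a => ind (A a)).toReal

theorem pr_nonneg (p : PMF α) (A : α → Prop) : 0 ≤ pr p A := ENNReal.toReal_nonneg

theorem pr_le_one (p : PMF α) (A : α → Prop) : pr p A ≤ 1 :=
  ENNReal.toReal_le_of_le_ofReal zero_le_one (by simpa using ev_ind_le_one p A)

theorem ofReal_pr (p : PMF α) (A : α → Prop) :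
    ENNReal.ofReal (pr p A) = ev p fun a => ind (A a) :=
  ENNReal.ofReal_toReal (ev_ind_ne_top p A)

theorem pr_congr {p : PMF α} {A B : α → Prop} (h : ∀ a ∈ p.support, A a ↔ B a) :
    pr p A = pr p B := by
  unfold pr
  rw [ev_congr_support fun a ha => by rw [propext (h a ha)]]

theorem pr_mono {p : PMF α} {A B : α → Prop} (h : ∀ a ∈ p.support, A a → B a) :
    pr p A ≤ pr p B :=
  ENNReal.toReal_mono (ev_ind_ne_top p B) (ev_mono_support fun a ha => ind_mono (h a ha))

theorem pr_or {p : PMF α} {A B : α → Prop} (h : ∀ a, ¬(A a ∧ B a)) :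
    pr p (fun a => A a ∨ B a) = pr p A + pr p B := by
  unfold pr
  rw [← ENNReal.toReal_add (ev_ind_ne_top p A) (ev_ind_ne_top p B), ← ev_add]
  congr 2
  funext a
  have := h a
  unfold ind
  by_cases hA : A a <;> by_cases hB : B a <;> simp_all

theorem pr_not (p : PMF α) (A : α → Prop) : pr p (fun a => ¬A a) = 1 - pr p A := by
  have h := pr_or (p := p) (A := A) (B := fun a => ¬A a) fun a => by tauto
  have h1 : pr p (fun a => A a ∨ ¬A a) = 1 := by
    unfold pr
    simp [ind_true (em _), ev_const]
  linarith

theorem pr_le_of_ev_le {p : PMF α} {A : α → Prop} {x : ℝ} (hx : 0 ≤ x)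
    (h : ev p (fun a => ind (A a)) ≤ ENNReal.ofReal x) : pr p A ≤ x :=
  ENNReal.toReal_le_of_le_ofReal hx h

theorem pr_pure (a : α) (A : α → Prop) [Decidable (A a)] :
    pr (PMF.pure a) A = if A a then 1 else 0 := by
  unfold pr ind
  rw [ev_pure]
  split <;> simp

theorem pr_map (p : PMF α) (φ : α → β) (A : β → Prop) :
    pr (p.map φ) A = pr p fun a => A (φ a) := by
  unfold pr; rw [ev_map]

theorem pr_bind_uniform (X : Type) [Fintype X] [Nonempty X] (q : X → PMF β) (A : β → Prop) :
    pr ((PMF.uniformOfFintype X).bind q) A = (∑ x, pr (q x) A) / Fintype.card X := by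
  unfold pr
  rw [ev_bind, ev_uniform, ENNReal.toReal_div, ENNReal.toReal_sum]
  · simp
  · intro x _
    exact ev_ind_ne_top _ _

theorem pr_uniform (X : Type) [Fintype X] [Nonempty X] (A : X → Prop) [DecidablePred A] :
    pr (PMF.uniformOfFintype X) A = (∑ x, if A x then (1 : ℝ) else 0) / Fintype.card X := by
  have := pr_bind_uniform X PMF.pure A
  rw [PMF.bind_pure] at this
  rw [this]
  simp only [pr_pure]

/-! ## Almost sure properties and couplings -/

/-- `A` holds almost surely under `p`. -/
def Always (p : PMF α) (A : α → Prop) : Prop := ∀ a ∈ p.support, A a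

theorem Always.mono {p : PMF α} {A B : α → Prop} (h : Always p A) (hAB : ∀ a, A a → B a) :
    Always p B := fun a ha => hAB a (h a ha)

theorem Always.and {p : PMF α} {A B : α → Prop} (h : Always p A) (h' : Always p B) :
    Always p fun a => A a ∧ B a := fun a ha => ⟨h a ha, h' a ha⟩

theorem always_pure {a : α} {A : α → Prop} (h : A a) : Always (PMF.pure a) A := by
  intro b hb
  rw [PMF.mem_support_pure_iff] at hb
  exact hb ▸ h

theorem Always.bind {p : PMF α} {q : α → PMF β} {A : α → Prop} {B : β → Prop} (h : Always p A)
    (h' : ∀ a, A a → Always (q a) B) : Always (p.bind q) B := by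
  intro b hb
  rw [PMF.mem_support_bind_iff] at hb
  obtain ⟨a, ha, hb⟩ := hb
  exact h' a (h a ha) b hb

theorem Always.map {p : PMF α} {φ : α → β} {A : α → Prop} {B : β → Prop} (h : Always p A)
    (h' : ∀ a, A a → B (φ a)) : Always (p.map φ) B := by
  intro b hb
  rw [PMF.mem_support_map_iff] at hb
  obtain ⟨a, ha, rfl⟩ := hb
  exact h' a (h a ha)

theorem always_true (p : PMF α) : Always p fun _ => True := fun _ _ => trivial

theorem always_map {p : PMF α} {φ : α → β} {B : β → Prop} (h' : ∀ a, B (φ a)) :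
    Always (p.map φ) B := (always_true p).map fun a _ => h' a

/-- Under a coupling of `p` and `μ`, the relation `Q` holds almost surely (expressed by the
induced inequality between expectations). -/
def Coupled (p : PMF α) (μ : PMF β) (Q : β → α → Prop) : Prop :=
  ∀ (f : α → ℝ≥0∞) (F : β → ℝ≥0∞), (∀ b a, Q b a → f a ≤ F b) → ev p f ≤ ev μ F

theorem coupled_pure {a : α} {b : β} {Q : β → α → Prop} (h : Q b a) :
    Coupled (PMF.pure a) (PMF.pure b) Q := by
  intro f F hf
  rw [ev_pure, ev_pure]
  exact hf b a h

theorem coupled_refl (p : PMF α) : Coupled p p fun b a => a = b :=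
  fun f F h => ev_mono fun a => h a a rfl

/-- Because a coupling is expressed by inequalities between expectations, composition only
substitutes the inner inequality into the outer one; no joint distribution has to be constructed. -/
theorem Coupled.bind {δ : Type} {p : PMF α} {μ : PMF β} {q : α → PMF γ} {ν : β → PMF δ}
    {Q : β → α → Prop} {Q' : δ → γ → Prop} (h : Coupled p μ Q)
    (h' : ∀ b a, Q b a → Coupled (q a) (ν b) Q') : Coupled (p.bind q) (μ.bind ν) Q' := by
  intro f F hf
  rw [ev_bind, ev_bind]
  exact h _ _ fun b a hba => h' b a hba f F hf

theorem Coupled.mono {p : PMF α} {μ : PMF β} {Q Q' : β → α → Prop} (h : Coupled p μ Q)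
    (hQ : ∀ b a, Q b a → Q' b a) : Coupled p μ Q' :=
  fun f F hf => h f F fun b a hba => hf b a (hQ b a hba)

/-- Replacing the test function by 0 off an almost sure event does not change its expectation. In
this way frame conditions are added to a coupling. -/
theorem Coupled.and_always {p : PMF α} {μ : PMF β} {Q : β → α → Prop} {A : α → Prop}
    (h : Coupled p μ Q) (hA : Always p A) : Coupled p μ fun b a => Q b a ∧ A a := by
  classical
  intro f F hf
  have : ev p f = ev p fun a => if A a then f a else 0 :=
    ev_congr_support fun a ha => by rw [if_pos (hA a ha)]
  rw [this]
  refine h _ _ fun b a hba => ?_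
  split
  · exact hf b a ⟨hba, by assumption⟩
  · exact zero_le

theorem coupled_map_left {p : PMF α} {μ : PMF β} {φ : α → γ} {Q : β → γ → Prop}
    (h : Coupled p μ fun b a => Q b (φ a)) : Coupled (p.map φ) μ Q := by
  intro f F hf
  rw [ev_map]
  exact h _ _ fun b a hba => hf _ _ hba

theorem coupled_map_right {p : PMF α} {μ : PMF β} {φ : β → γ} {Q : γ → α → Prop}
    (h : Coupled p μ fun b a => Q (φ b) a) : Coupled p (μ.map φ) Q := by
  intro f F hf
  rw [ev_map]
  exact h _ _ fun b a hba => hf _ _ hba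

theorem coupled_uniform_map (X : Type) [Fintype X] [Nonempty X] (φ : X → α) :
    Coupled ((PMF.uniformOfFintype X).map φ) (PMF.uniformOfFintype X) fun x a => a = φ x :=
  coupled_map_left ((coupled_refl _).mono fun b a h => by rw [h])

/-- Couplings transport upper bounds of probabilities. -/
theorem Coupled.ev_ind_le {p : PMF α} {μ : PMF β} {Q : β → α → Prop} (h : Coupled p μ Q)
    {A : α → Prop} {B : β → Prop} (hAB : ∀ b a, Q b a → A a → B b) :
    ev p (fun a => ind (A a)) ≤ ev μ fun b => ind (B b) :=
  h _ _ fun b a hba => ind_mono (hAB b a hba)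

/-- The definition of a coupling is one-sided; equality follows by applying it to the event and to
its complement. -/
theorem Coupled.pr_eq {p : PMF α} {μ : PMF β} {Q : β → α → Prop} (h : Coupled p μ Q)
    {A : α → Prop} {B : β → Prop} (hAB : ∀ b a, Q b a → (A a ↔ B b)) : pr p A = pr μ B := by
  have h1 : pr p A ≤ pr μ B :=
    ENNReal.toReal_mono (ev_ind_ne_top _ _) (h.ev_ind_le fun b a hb => (hAB b a hb).1)
  have h2 : pr p (fun a => ¬A a) ≤ pr μ (fun b => ¬B b) :=
    ENNReal.toReal_mono (ev_ind_ne_top _ _)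
      (h.ev_ind_le fun b a hb => (not_congr (hAB b a hb)).1)
  rw [pr_not, pr_not] at h2
  linarith

/-! ## Repetition -/

theorem repeatPMF_succ (f : α → PMF α) (t : ℕ) (a : α) :
    repeatPMF f (t + 1) a = (f a).bind (repeatPMF f t) := rfl

theorem Always.repeat {f : α → PMF α} {I : ℕ → α → Prop} (h : ∀ j a, I j a → Always (f a) (I (j + 1)))
    (t j : ℕ) (a : α) (ha : I j a) : Always (repeatPMF f t a) (I (j + t)) := by
  induction t generalizing j a with
  | zero => exact always_pure ha
  | succ t ih =>
    refine (h j a ha).bind fun a' ha' => ?_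
    have := ih (j + 1) a' ha'
    rwa [show j + 1 + t = j + (t + 1) by omega] at this

theorem Always.repeat_inv {f : α → PMF α} {I : α → Prop} (h : ∀ a, I a → Always (f a) I)
    (t : ℕ) (a : α) (ha : I a) : Always (repeatPMF f t a) I :=
  Always.repeat (I := fun _ => I) (fun _ => h) t 0 a ha

/-- A supermartingale argument: `Φ t` is the potential when `t` iterations are still to come, so the
index decreases along the execution. -/
theorem ev_repeat_le {f : α → PMF α} {I : α → Prop} {Φ : ℕ → α → ℝ≥0∞}
    (hI : ∀ a, I a → Always (f a) I) (h : ∀ t a, I a → ev (f a) (Φ t) ≤ Φ (t + 1) a) (t : ℕ) (a : α)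
    (ha : I a) : ev (repeatPMF f t a) (Φ 0) ≤ Φ t a := by
  induction t generalizing a with
  | zero => exact (ev_pure _ _).le
  | succ t ih =>
    rw [repeatPMF_succ, ev_bind]
    exact (ev_mono_support fun a' ha' => ih a' (hI a ha a' ha')).trans (h t a ha)

end Expectation

end WVP

/-! ### Semantics of programs: effect on the memory, frames, unrolled code, running time. -/

namespace WVP
open scoped ENNReal

section Semantics

variable {P : Puzzle} {k : ℕ} {C : SolverCircuit P k}

theorem repeatPMF_map {α β : Type} {f : α → PMF α} {f' : β → PMF β} {φ : α → β}
    (h : ∀ a, (f a).map φ = f' (φ a)) (t : ℕ) (a : α) :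
    (repeatPMF f t a).map φ = repeatPMF f' t (φ a) := by
  induction t generalizing a with
  | zero => exact PMF.pure_map _ _
  | succ t ih =>
    rw [repeatPMF_succ, PMF.map_bind, repeatPMF_succ, ← h, PMF.bind_map]
    congr 1
    funext a'
    exact ih a'

/-! ## The effect of a program on the memory -/

/-- The number register `d` is set to `v`. -/
def Memory.setNum (m : Memory C) (d v : ℕ) : Memory C :=
  { m with num := Function.update m.num d v }

namespace Program

/-- The effect of a program on the memory. -/
noncomputable def memExec (g : Word k → Bool) (ε δ : ℝ) : Program → Memory C → PMF (Memory C)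
  | skip, m => PMF.pure m
  | op o, m => o.exec g m
  | mul d a b, m => PMF.pure (m.setNum d (m.num a * m.num b))
  | div d a b, m => PMF.pure (m.setNum d (m.num a / m.num b))
  | eps d t, m => PMF.pure (m.setNum d ⌊(2 : ℝ) ^ m.num t * ε⌋₊)
  | delta d t, m => PMF.pure (m.setNum d ⌊(2 : ℝ) ^ m.num t * δ⌋₊)
  | emit _, m => PMF.pure m
  | seq c₁ c₂, m => (memExec g ε δ c₁ m).bind (memExec g ε δ c₂)
  | ite a c₁ c₂, m => if m.num a ≠ 0 then memExec g ε δ c₁ m else memExec g ε δ c₂ m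
  | loop a c, m => repeatPMF (memExec g ε δ c) (m.num a) m

/-- No instruction reads the step counter or the emitted code, so forgetting them commutes with
execution. The probabilistic analysis can therefore use `memExec`, apart from time and code. -/
theorem exec_map_memory (g : Word k → Bool) (ε δ : ℝ) (c : Program) (s : ProgramState C) :
    (c.exec g ε δ s).map ProgramState.memory = c.memExec g ε δ s.memory := by
  induction c generalizing s with
  | skip => exact PMF.pure_map _ _
  | op o =>
    simp only [exec, memExec, PMF.map_comp]
    exact PMF.map_id _
  | mul | div | eps | delta | emit => exact PMF.pure_map _ _
  | seq c₁ c₂ ih₁ ih₂ =>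
    simp only [exec, memExec, PMF.map_bind, ← ih₁, PMF.bind_map]
    congr 1
    funext s'
    exact ih₂ s'
  | ite a c₁ c₂ ih₁ ih₂ =>
    simp only [exec, memExec]
    split
    · exact ih₁ _
    · exact ih₂ _
  | loop a c ih =>
    simp only [exec, memExec]
    exact repeatPMF_map (f := fun s' : ProgramState C =>
      c.exec g ε δ { s' with time := s'.time + 1 }) (fun s' => ih _) _ _

/-- All basic operations in the program satisfy `p`, all destinations of its arithmetic operations
satisfy `q`, and it emits no instructions. -/
def all (p : Op → Bool) (q : ℕ → Bool) : Program → Bool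
  | skip => true
  | op o => p o
  | mul d _ _ => q d
  | div d _ _ => q d
  | eps d _ => q d
  | delta d _ => q d
  | emit _ => false
  | seq c₁ c₂ => c₁.all p q && c₂.all p q
  | ite _ c₁ c₂ => c₁.all p q && c₂.all p q
  | loop _ c => c.all p q

theorem always_memExec_of_all {g : Word k → Bool} {ε δ : ℝ} {p : Op → Bool} {q : ℕ → Bool}
    {I : Memory C → Prop} (hp : ∀ o m, p o = true → I m → Always (o.exec g m) I)
    (hq : ∀ d v m, q d = true → I m → I (m.setNum d v)) {c : Program} (hc : c.all p q = true)
    {m : Memory C} (hm : I m) : Always (c.memExec g ε δ m) I := by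
  induction c generalizing m with
  | skip => exact always_pure hm
  | op o => exact hp o m hc hm
  | mul | div | eps | delta => exact always_pure (hq _ _ _ hc hm)
  | emit => exact always_pure hm
  | seq c₁ c₂ ih₁ ih₂ =>
    simp only [all, Bool.and_eq_true] at hc
    exact (ih₁ hc.1 hm).bind fun m' hm' => ih₂ hc.2 hm'
  | ite a c₁ c₂ ih₁ ih₂ =>
    simp only [all, Bool.and_eq_true] at hc
    unfold memExec
    split
    · exact ih₁ hc.1 hm
    · exact ih₂ hc.2 hm
  | loop a c ih => exact Always.repeat_inv (fun m' hm' => ih hc hm') _ _ hm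

theorem always_code_eq {g : Word k → Bool} {ε δ : ℝ} {p : Op → Bool} {q : ℕ → Bool}
    {c : Program} (hc : c.all p q = true) (s : ProgramState C) :
    Always (c.exec g ε δ s) fun s' => s'.code = s.code := by
  suffices H : ∀ (l : List Instr) (s : ProgramState C), s.code = l →
      Always (c.exec g ε δ s) fun s' => s'.code = l from H s.code s rfl
  intro l
  induction c with
  | skip => exact fun s hs => always_pure hs
  | op o => exact fun s hs => always_map fun _ => hs
  | mul | div | eps | delta => exact fun s hs => always_pure hs
  | emit => simp [all] at hc
  | seq c₁ c₂ ih₁ ih₂ =>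
    simp only [all, Bool.and_eq_true] at hc
    exact fun s hs => (ih₁ hc.1 s hs).bind fun s' hs' => ih₂ hc.2 s' hs'
  | ite a c₁ c₂ ih₁ ih₂ =>
    simp only [all, Bool.and_eq_true] at hc
    intro s hs
    unfold exec
    split
    · exact ih₁ hc.1 _ hs
    · exact ih₂ hc.2 _ hs
  | loop a c ih =>
    intro s hs
    exact Always.repeat_inv (f := fun s' : ProgramState C =>
      c.exec g ε δ { s' with time := s'.time + 1 }) (I := fun s' => s'.code = l)
      (fun s' hs' => ih hc _ hs') _ _ hs

/-- The expectation of a function of the memory and the emitted code, for a program that emits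
nothing. -/
theorem ev_exec {g : Word k → Bool} {ε δ : ℝ} {p : Op → Bool} {q : ℕ → Bool} {c : Program}
    (hc : c.all p q = true) (s : ProgramState C) (F : Memory C → List Instr → ℝ≥0∞) :
    ev (c.exec g ε δ s) (fun s' => F s'.memory s'.code) =
      ev (c.memExec g ε δ s.memory) fun m => F m s.code := by
  rw [← exec_map_memory, ev_map]
  exact ev_congr_support fun s' hs' => by rw [always_code_eq hc s s' hs']

theorem Always.exec_memory {g : Word k → Bool} {ε δ : ℝ} {c : Program} {s : ProgramState C}
    {I : Memory C → Prop} (h : Always (c.memExec g ε δ s.memory) I) :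
    Always (c.exec g ε δ s) fun s' => I s'.memory := by
  intro s' hs'
  refine h _ ?_
  rw [← exec_map_memory, PMF.mem_support_map_iff]
  exact ⟨s', hs', rfl⟩

end Program

/-! ## Frame conditions -/

namespace Op

/-- The number register that is changed by an operation. -/
def numDst : Op → Option ℕ
  | const d _ | copy d _ | add d _ _ | sub d _ _ | lt d _ _ | coin d | evalG d | checkP d _ _ =>
    some d
  | _ => none

/-- The copy of the solver that is changed by an operation. -/
def solverDst : Op → Option ℕ
  | newC c | stepC c _ _ | copyC c _ => some c
  | _ => none

/-- The answer register that is changed by an operation. -/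
def ansDst : Op → Option ℕ
  | select d _ _ | condAns _ d _ => some d
  | _ => none

/-- Does the operation change the bank of bits? -/
def setsBit : Op → Bool
  | setBit _ _ => true
  | _ => false

/-- Does the operation change the simulated posers? -/
def setsPoser : Op → Bool
  | newP _ | sendP _ _ | copyP _ _ => true
  | _ => false

/-- Does the operation change the registers for lists of answers? -/
def setsOuts : Op → Bool
  | outC _ _ => true
  | _ => false

variable {g : Word k → Bool}

theorem always_num {o : Op} {j : ℕ} (h : o.numDst ≠ some j) (m : Memory C) :
    Always (o.exec g m) fun m' => m'.num j = m.num j := by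
  cases o <;> simp only [numDst, ne_eq, Option.some.injEq] at h <;>
    first
    | exact always_pure (by simp [Function.update_of_ne (Ne.symm h)])
    | exact always_map fun _ => by simp [Function.update_of_ne (Ne.symm h)]

theorem always_solvers {o : Op} {j : ℕ} (h : o.solverDst ≠ some j) (m : Memory C) :
    Always (o.exec g m) fun m' => m'.solvers j = m.solvers j := by
  cases o <;> simp only [solverDst, ne_eq, Option.some.injEq] at h <;>
    first
    | exact always_pure (by simp [Function.update_of_ne (Ne.symm h)])
    | exact always_map fun _ => by simp [Function.update_of_ne (Ne.symm h)]

theorem always_ans {o : Op} {j : ℕ} (h : o.ansDst ≠ some j) (m : Memory C) :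
    Always (o.exec g m) fun m' => m'.ans j = m.ans j := by
  cases o <;> simp only [ansDst, ne_eq, Option.some.injEq] at h <;>
    first
    | exact always_pure (by simp [Function.update_of_ne (Ne.symm h)])
    | exact always_map fun _ => by simp [Function.update_of_ne (Ne.symm h)]

theorem always_bit {o : Op} (h : o.setsBit = false) (m : Memory C) :
    Always (o.exec g m) fun m' => m'.bit = m.bit := by
  cases o <;> simp only [setsBit, Bool.true_eq_false] at h <;> unfold exec <;>
    first
    | exact always_pure rfl
    | exact always_map fun _ => rfl

theorem always_posers {o : Op} (h : o.setsPoser = false) (m : Memory C) :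
    Always (o.exec g m) fun m' => m'.posers = m.posers := by
  cases o <;> simp only [setsPoser, Bool.true_eq_false] at h <;> unfold exec <;>
    first
    | exact always_pure rfl
    | exact always_map fun _ => rfl

theorem always_outs {o : Op} (h : o.setsOuts = false) (m : Memory C) :
    Always (o.exec g m) fun m' => m'.outs = m.outs := by
  cases o <;> simp only [setsOuts, Bool.true_eq_false] at h <;> unfold exec <;>
    first
    | exact always_pure rfl
    | exact always_map fun _ => rfl

end Op

/-- A set of memory cells, to be left unchanged. -/
structure Frame where
  num : ℕ → Bool
  solver : ℕ → Bool
  ans : ℕ → Bool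
  bit : Bool
  posers : Bool
  outs : Bool

/-- The memories `m` and `m'` agree on the cells in the frame. -/
structure Frame.Agree (S : Frame) (m m' : Memory C) : Prop where
  num : ∀ j, S.num j = true → m'.num j = m.num j
  solver : ∀ j, S.solver j = true → m'.solvers j = m.solvers j
  ans : ∀ j, S.ans j = true → m'.ans j = m.ans j
  bit : S.bit = true → m'.bit = m.bit
  posers : S.posers = true → m'.posers = m.posers
  outs : S.outs = true → m'.outs = m.outs

theorem Frame.Agree.refl (S : Frame) (m : Memory C) : S.Agree m m :=
  ⟨fun _ _ => rfl, fun _ _ => rfl, fun _ _ => rfl, fun _ => rfl, fun _ => rfl, fun _ => rfl⟩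

theorem Frame.Agree.trans {S : Frame} {m m' m'' : Memory C} (h : S.Agree m m')
    (h' : S.Agree m' m'') : S.Agree m m'' :=
  ⟨fun j hj => (h'.num j hj).trans (h.num j hj), fun j hj => (h'.solver j hj).trans (h.solver j hj),
    fun j hj => (h'.ans j hj).trans (h.ans j hj), fun hj => (h'.bit hj).trans (h.bit hj),
    fun hj => (h'.posers hj).trans (h.posers hj), fun hj => (h'.outs hj).trans (h.outs hj)⟩

/-- The operation does not change the cells in the frame. -/
def Frame.keeps (S : Frame) (o : Op) : Bool :=
  (o.numDst.all fun d => !S.num d) && (o.solverDst.all fun d => !S.solver d) &&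
    (o.ansDst.all fun d => !S.ans d) && !(S.bit && o.setsBit) && !(S.posers && o.setsPoser) &&
    !(S.outs && o.setsOuts)

theorem Frame.always_op (S : Frame) {g : Word k → Bool} {o : Op} (h : S.keeps o = true)
    (m : Memory C) : Always (o.exec g m) (S.Agree m) := by
  simp only [keeps, Bool.and_eq_true, Option.all_eq_true, Bool.not_eq_true',
    Bool.and_eq_false_iff] at h
  obtain ⟨⟨⟨⟨⟨h1, h2⟩, h3⟩, h4⟩, h5⟩, h6⟩ := h
  intro m' hm'
  refine ⟨fun j hj => ?_, fun j hj => ?_, fun j hj => ?_, fun hj => ?_, fun hj => ?_, fun hj => ?_⟩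
  · refine Op.always_num (fun e => ?_) m m' hm'
    simpa [hj] using h1 j e
  · refine Op.always_solvers (fun e => ?_) m m' hm'
    simpa [hj] using h2 j e
  · refine Op.always_ans (fun e => ?_) m m' hm'
    simpa [hj] using h3 j e
  · exact Op.always_bit (by simpa [hj] using h4) m m' hm'
  · exact Op.always_posers (by simpa [hj] using h5) m m' hm'
  · exact Op.always_outs (by simpa [hj] using h6) m m' hm'

/-- The hypothesis is a Boolean computation on the syntax of the program, so that every concrete
frame condition below holds by `rfl`. -/
theorem Frame.always (S : Frame) {g : Word k → Bool} {ε δ : ℝ} {c : Program}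
    (hc : c.all S.keeps (fun d => !S.num d) = true) (m : Memory C) :
    Always (c.memExec g ε δ m) (S.Agree m) := by
  refine Program.always_memExec_of_all (I := S.Agree m)
    (fun o m' ho hm' => (S.always_op ho m').mono fun m'' h => hm'.trans h) (fun d v m' hd hm' => ?_)
    hc (.refl S m)
  refine hm'.trans ⟨fun j hj => ?_, fun _ _ => rfl, fun _ _ => rfl, fun _ => rfl, fun _ => rfl,
    fun _ => rfl⟩
  simp only [Bool.not_eq_true'] at hd
  have : j ≠ d := by
    rintro rfl
    simp [hj] at hd
  simp [Memory.setNum, Function.update_of_ne this]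

/-! ## Straight-line code -/

/-- Execution of a list of basic operations. -/
noncomputable def runOps (g : Word k → Bool) : List Op → Memory C → PMF (Memory C)
  | [], m => PMF.pure m
  | o :: l, m => (o.exec g m).bind (runOps g l)

theorem runOps_append (g : Word k → Bool) (l l' : List Op) (m : Memory C) :
    runOps g (l ++ l') m = (runOps g l m).bind (runOps g l') := by
  induction l generalizing m with
  | nil => simp [runOps]
  | cons o l ih =>
    simp only [List.cons_append, runOps, PMF.bind_bind]
    congr 1
    funext m'
    exact ih m'

theorem runCode_append (g : Word k → Bool) (l l' : List Instr) (s : SolverState C) :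
    runCode g (l ++ l') s = (runCode g l s).bind (runCode g l') := by
  induction l generalizing s with
  | nil => simp [runCode]
  | cons o l ih =>
    simp only [List.cons_append, runCode, PMF.bind_bind]
    congr 1
    funext s'
    exact ih s'

/-- Code without `recv` and `send` acts on the memory only. -/
theorem ev_runCode_ops (g : Word k → Bool) (l : List Op) (s : SolverState C)
    (F : Memory C → PoserCopy P → ℝ≥0∞) :
    ev (runCode g (l.map Instr.op) s) (fun s' => F s'.memory s'.live) =
      ev (runOps g l s.memory) fun m => F m s.live := by
  induction l generalizing s with
  | nil => simp [runCode, runOps, ev_pure]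
  | cons o l ih =>
    simp only [List.map_cons, runCode, runOps, ev_bind, Instr.exec, ev_map]
    congr 1
    funext m
    exact ih _

namespace Program

/-- The basic operations performed by a program without tests, if loops on register `a` are
executed `v a` times. -/
def unroll (v : ℕ → ℕ) : Program → List Op
  | op o => [o]
  | seq c₁ c₂ => c₁.unroll v ++ c₂.unroll v
  | loop a c => (List.replicate (v a) (c.unroll v)).flatten
  | _ => []

/-- The program emits its operations instead of performing them. -/
def emitAll : Program → Program
  | op o => emit (Instr.op o)
  | seq c₁ c₂ => seq c₁.emitAll c₂.emitAll
  | loop a c => loop a c.emitAll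
  | _ => skip

/-- The program consists of basic operations that do not write to the number registers in `S`, and
of loops governed by registers in `S`. -/
def straight (S : ℕ → Bool) : Program → Bool
  | skip => true
  | op o => o.numDst.all fun d => !S d
  | seq c₁ c₂ => c₁.straight S && c₂.straight S
  | loop a c => S a && c.straight S
  | _ => false

/-- A program reads its loop counts at run time, whereas unrolled code has them fixed by `v`. They
agree because the registers in `S` govern all loops and are never written; the second conjunct
carries this fact through the induction. -/
theorem runOps_unroll {g : Word k → Bool} {ε δ : ℝ} {S : ℕ → Bool} {v : ℕ → ℕ} {c : Program}
    (hc : c.straight S = true) (m : Memory C) (hm : ∀ j, S j = true → m.num j = v j) :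
    runOps g (c.unroll v) m = c.memExec g ε δ m ∧
      Always (c.memExec g ε δ m) fun m' => ∀ j, S j = true → m'.num j = v j := by
  induction c generalizing m with
  | skip => exact ⟨rfl, always_pure hm⟩
  | op o =>
    refine ⟨by simp [unroll, runOps, memExec], fun m' hm' j hj => ?_⟩
    rw [← hm j hj]
    refine Op.always_num (fun e => ?_) m m' hm'
    simp only [straight, Option.all_eq_true] at hc
    simpa [hj] using hc j e
  | mul | div | eps | delta | emit | ite => simp [straight] at hc
  | seq c₁ c₂ ih₁ ih₂ =>
    simp only [straight, Bool.and_eq_true] at hc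
    have h1 := ih₁ hc.1 m hm
    refine ⟨?_, h1.2.bind fun m' hm' => (ih₂ hc.2 m' hm').2⟩
    rw [unroll, runOps_append, h1.1, memExec]
    refine PMF.ext fun x => ?_
    simp only [PMF.bind_apply]
    refine tsum_congr fun m' => ?_
    -- The two continuations need to agree only on reachable memories, where the registers in `S`
    -- still have the values `v`; all others have weight zero.
    by_cases h0 : c₁.memExec g ε δ m m' = 0
    · simp [h0]
    · rw [(ih₂ hc.2 m' (h1.2 m' h0)).1]
  | loop a c ih =>
    simp only [straight, Bool.and_eq_true] at hc
    refine ⟨?_, Always.repeat_inv (I := fun m' : Memory C => ∀ j, S j = true → m'.num j = v j)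
      (fun m' hm' => (ih hc.2 m' hm').2) _ _ hm⟩
    rw [memExec, hm a hc.1, unroll]
    generalize v a = t
    induction t generalizing m with
    | zero => simp [runOps, repeatPMF]
    | succ t iht =>
      rw [List.replicate_succ, List.flatten_cons, runOps_append, repeatPMF_succ, (ih hc.2 m hm).1]
      refine PMF.ext fun x => ?_
      simp only [PMF.bind_apply]
      refine tsum_congr fun m' => ?_
      by_cases h0 : c.memExec g ε δ m m' = 0
      · simp [h0]
      · rw [iht m' ((ih hc.2 m hm).2 m' h0)]

/-- Emission leaves the memory alone, so all loop counts in the emitted code are the register values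
at its beginning. -/
theorem always_emitAll {g : Word k → Bool} {ε δ : ℝ} (c : Program) (s : ProgramState C) :
    Always (c.emitAll.exec g ε δ s) fun s' => s'.memory = s.memory ∧
      s'.code = s.code ++ (c.unroll s.memory.num).map Instr.op := by
  induction c generalizing s with
  | op o => exact always_pure ⟨rfl, rfl⟩
  | skip | mul | div | eps | delta | emit | ite => exact always_pure ⟨rfl, by simp [unroll]⟩
  | seq c₁ c₂ ih₁ ih₂ =>
    refine (ih₁ s).bind fun s' hs' => (ih₂ s').mono fun s'' hs'' => ?_
    rw [hs'.1, hs'.2] at hs''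
    simpa [unroll] using hs''
  | loop a c ih =>
    have := Always.repeat (f := fun s' : ProgramState C =>
        c.emitAll.exec g ε δ { s' with time := s'.time + 1 })
      (I := fun t s' => s'.memory = s.memory ∧ s'.code = s.code ++
        ((List.replicate t (c.unroll s.memory.num)).flatten).map Instr.op)
      (fun t s' hs' => (ih { s' with time := s'.time + 1 }).mono fun s'' hs'' => by
        simp only [hs'.1, hs'.2] at hs''
        refine ⟨hs''.1, ?_⟩
        rw [hs''.2, List.replicate_succ']
        simp) (s.memory.num a) 0 { s with time := s.time + 1 } ⟨rfl, by simp⟩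
    simpa [unroll, emitAll, exec] using this

end Program

/-! ## Running times -/

namespace Program

/-- The operation leaves the registers `0, …, 11` unchanged, and changes register 12 only by a
subtraction from register 0. -/
def _root_.WVP.Op.safe : Op → Bool
  | .sub d a _ => decide (12 < d) || (decide (d = 12) && decide (a = 0))
  | o => o.numDst.all fun d => decide (12 < d)

/-- The loops of the program are governed by the registers `0, …, 12`, and these are changed only
by safe operations. -/
def safe : Program → Bool
  | skip => true
  | op o => o.safe
  | emit _ => true
  | seq c₁ c₂ => c₁.safe && c₂.safe
  | ite _ c₁ c₂ => c₁.safe && c₂.safe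
  | loop a c => decide (a ≤ 12) && c.safe
  | _ => false

/-- A bound for the number of steps. -/
def cost (v : ℕ → ℕ) : Program → ℕ
  | skip => 0
  | op _ => 1
  | emit _ => 1
  | seq c₁ c₂ => c₁.cost v + c₂.cost v
  | ite _ c₁ c₂ => 1 + (c₁.cost v + c₂.cost v)
  | loop a c => 1 + v a * (1 + c.cost v)
  | _ => 0

/-- The registers have their values according to `v`. -/
def Bounded (v : ℕ → ℕ) (m : Memory C) : Prop :=
  (∀ j ≤ 11, m.num j = v j) ∧ m.num 12 ≤ v 0

theorem bounded_op {v : ℕ → ℕ} {g : Word k → Bool} {o : Op} (ho : o.safe = true) {m : Memory C}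
    (hm : Bounded v m) : Always (o.exec g m) (Bounded v) := by
  have key : ∀ o : Op, (o.numDst.all fun d => decide (12 < d)) = true →
      Always (o.exec g m) (Bounded v) := by
    intro o ho m' hm'
    simp only [Option.all_eq_true, decide_eq_true_eq] at ho
    have h : ∀ j ≤ 12, m'.num j = m.num j := fun j hj =>
      Op.always_num (fun e => by have := ho j e; omega) m m' hm'
    exact ⟨fun j hj => (h j (by omega)).trans (hm.1 j hj), (h 12 le_rfl).le.trans hm.2⟩
  cases o with
  | sub d a b =>
    by_cases hd : 12 < d
    · exact key _ (by simpa [Op.numDst] using hd)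
    · simp only [Op.safe, hd, decide_false, Bool.false_or, Bool.and_eq_true,
        decide_eq_true_eq] at ho
      obtain ⟨rfl, rfl⟩ := ho
      refine always_pure ⟨fun j hj => ?_, ?_⟩
      · simpa [Function.update_of_ne (show j ≠ 12 by omega)] using hm.1 j hj
      · simpa using (Nat.sub_le _ _).trans (hm.1 0 (by omega)).le
  | _ => exact key _ ho

/-- Register 12 is the only loop register that changes. It is always recomputed by a subtraction
from register 0, so its loops are charged with `v 12 = v 0` iterations. -/
theorem always_time {v : ℕ → ℕ} (hv : v 12 = v 0) {g : Word k → Bool} {ε δ : ℝ} {c : Program}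
    (hc : c.safe = true) {s : ProgramState C} (hs : Bounded v s.memory) :
    Always (c.exec g ε δ s) fun s' => Bounded v s'.memory ∧ s'.time ≤ s.time + c.cost v := by
  induction c generalizing s with
  | skip => exact always_pure ⟨hs, by simp⟩
  | op o => exact (bounded_op hc hs).map fun m hm => ⟨hm, le_rfl⟩
  | mul | div | eps | delta => simp [safe] at hc
  | emit => exact always_pure ⟨hs, le_rfl⟩
  | seq c₁ c₂ ih₁ ih₂ =>
    simp only [safe, Bool.and_eq_true] at hc
    refine (ih₁ hc.1 hs).bind fun s' hs' => (ih₂ hc.2 hs'.1).mono fun s'' hs'' => ⟨hs''.1, ?_⟩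
    have := hs'.2
    have := hs''.2
    simp only [cost]
    omega
  | ite a c₁ c₂ ih₁ ih₂ =>
    simp only [safe, Bool.and_eq_true] at hc
    unfold exec
    simp only [cost]
    split
    · exact (ih₁ hc.1 (by exact hs)).mono fun s' hs' => ⟨hs'.1, by have := hs'.2; simp at this; omega⟩
    · exact (ih₂ hc.2 (by exact hs)).mono fun s' hs' => ⟨hs'.1, by have := hs'.2; simp at this; omega⟩
  | loop a c ih =>
    simp only [safe, Bool.and_eq_true, decide_eq_true_eq] at hc
    have ha : s.memory.num a ≤ v a := by
      rcases hc.1.lt_or_eq with h | rfl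
      · exact (hs.1 a (by omega)).le
      · exact hs.2.trans hv.ge
    have := Always.repeat (f := fun s' : ProgramState C =>
        c.exec g ε δ { s' with time := s'.time + 1 })
      (I := fun t s' => Bounded v s'.memory ∧ s'.time ≤ s.time + 1 + t * (1 + c.cost v))
      (fun t s' hs' => (ih hc.2 (by exact hs'.1)).mono fun s'' hs'' => ⟨hs''.1, by
        have h1 := hs'.2
        have h2 := hs''.2
        simp only at h2
        rw [add_mul]
        omega⟩) (s.memory.num a) 0 { s with time := s.time + 1 } ⟨hs, by simp⟩
    refine this.mono fun s' hs' => ⟨hs'.1, hs'.2.trans ?_⟩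
    simp only [cost, zero_add]
    have := Nat.mul_le_mul_right (1 + c.cost v) ha
    omega

/-- Each emitted instruction costs a step, so a bound on the running time also bounds the number of
instructions of the solver. -/
theorem always_code_length {g : Word k → Bool} {ε δ : ℝ} (c : Program) {s : ProgramState C}
    (hs : s.code.length ≤ s.time) :
    Always (c.exec g ε δ s) fun s' => s'.code.length ≤ s'.time := by
  induction c generalizing s with
  | skip => exact always_pure hs
  | op o => exact always_map fun m => by simp only; omega
  | mul | div | eps | delta => exact always_pure (by simp only; omega)
  | emit => exact always_pure (by simp only [List.length_append, List.length_singleton]; omega)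
  | seq c₁ c₂ ih₁ ih₂ => exact (ih₁ hs).bind fun s' hs' => ih₂ hs'
  | ite a c₁ c₂ ih₁ ih₂ =>
    unfold exec
    split
    · exact ih₁ (by simp only; omega)
    · exact ih₂ (by simp only; omega)
  | loop a c ih =>
    exact Always.repeat_inv (I := fun s' : ProgramState C => s'.code.length ≤ s'.time)
      (fun s' hs' => ih (by simp only; omega)) _ _ (by simp only; omega)

end Program

end Semantics

end WVP

/-! ### Ideal experiments: independent coins, Bernoulli bits, continued executions of the solver. -/

namespace WVP
open scoped ENNReal

/-! ## Sampling the coins of the instances one after the other -/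

section Draw

variable {X : Type} [Fintype X] [Nonempty X]

/-- Resample the coordinates `j, …, j + t - 1` of `π` uniformly. -/
noncomputable def drawFrom : ℕ → ℕ → (ℕ → X) → PMF (ℕ → X)
  | _, 0, π => PMF.pure π
  | j, t + 1, π => (PMF.uniformOfFintype X).bind fun x => drawFrom (j + 1) t (Function.update π j x)

/-- Both sides use the same fresh values, so the original sequence is irrelevant on the resampled
coordinates. This permits the default sequence in the definitions of values and influences. -/
theorem drawFrom_coupled (j t : ℕ) (π π' : ℕ → X) {S : ℕ → Prop} (h : ∀ l, S l → π' l = π l) :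
    Coupled (drawFrom j t π') (drawFrom j t π) fun a b =>
      ∀ l, S l ∨ (j ≤ l ∧ l < j + t) → b l = a l := by
  induction t generalizing j π π' S with
  | zero => exact coupled_pure fun l hl => h l (hl.resolve_right (by omega))
  | succ t ih =>
    refine (coupled_refl _).bind fun x x' hx => ?_
    subst hx
    refine (ih (j + 1) _ _ (S := fun l => S l ∨ l = j) fun l hl => ?_).mono fun a b hab l hl =>
      hab l ?_
    · by_cases hj : l = j
      · subst hj; simp
      · simpa [Function.update_of_ne hj] using h l (hl.resolve_right hj)
    · by_cases hj : l = j
      · exact Or.inl (Or.inr hj)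
      · rcases hl with hl | hl
        · exact Or.inl (Or.inl hl)
        · exact Or.inr (by omega)

theorem drawFrom_always (j t : ℕ) (π : ℕ → X) :
    Always (drawFrom j t π) fun π' => ∀ l < j, π' l = π l := by
  induction t generalizing j π with
  | zero => exact always_pure fun _ _ => rfl
  | succ t ih =>
    refine (always_true _).bind fun x _ => (ih (j + 1) (Function.update π j x)).mono fun a h l hl =>
      ?_
    rw [h l (by omega), Function.update_of_ne (by omega)]

/-- Each iteration of the loop consumes one fresh coordinate, and the invariant may speak about all
coordinates drawn so far. The bound `b` restricts the obligation to indices for which an instance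
still exists. -/
theorem coupled_repeat_draw {α : Type} {f : α → PMF α} {I : ℕ → (ℕ → X) → α → Prop} {b : ℕ}
    (h : ∀ j < b, ∀ π a, I j π a → Coupled (f a) (PMF.uniformOfFintype X)
      fun x a' => I (j + 1) (Function.update π j x) a')
    (t j : ℕ) (hj : j + t ≤ b) (π : ℕ → X) (a : α) (ha : I j π a) :
    Coupled (repeatPMF f t a) (drawFrom j t π) (I (j + t)) := by
  induction t generalizing j π a with
  | zero => exact coupled_pure ha
  | succ t ih =>
    refine (h j (by omega) π a ha).bind fun x a' ha' => ?_
    have := ih (j + 1) (by omega) _ a' ha'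
    rwa [show j + 1 + t = j + (t + 1) by omega] at this

/-- The restriction of a complete sample is uniform. -/
theorem drawFrom_map_uniform (k : ℕ) (π₀ : ℕ → X) :
    (drawFrom 0 k π₀).map (fun π (j : Fin k) => π j) = PMF.uniformOfFintype (Fin k → X) := by
  classical
  -- The `t` resampled coordinates hit prescribed values with probability |X|^(-t): among the
  -- choices for coordinate `j` only the prescribed one contributes.
  have key : ∀ (t j : ℕ) (π π' : ℕ → X),
      ev (drawFrom j t π) (fun a => ind (∀ l, j ≤ l → l < j + t → a l = π' l)) =
        ((Fintype.card X : ℝ≥0∞)⁻¹) ^ t := by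
    intro t
    induction t with
    | zero =>
      intro j π π'
      rw [drawFrom, ev_pure, ind_true (by intros; omega), pow_zero]
    | succ t ih =>
      intro j π π'
      rw [drawFrom, ev_bind, ev_uniform]
      rw [Finset.sum_eq_single (π' j)]
      · rw [pow_succ, ← ih (j + 1) (Function.update π j (π' j)) π', ENNReal.div_eq_inv_mul, mul_comm]
        congr 1
        refine ev_congr_support fun a ha => ?_
        have h := drawFrom_always _ _ _ a ha j (by omega)
        rw [Function.update_self] at h
        congr 1
        refine propext ⟨fun H l hl hl' => H l (by omega) (by omega), fun H l hl hl' => ?_⟩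
        by_cases e : l = j
        · rw [e, h]
        · exact H l (by omega) (by omega)
      · intro x _ hx
        rw [← ev_const (drawFrom (j + 1) t (Function.update π j x)) 0]
        refine ev_congr_support fun a ha => ind_false fun H => hx ?_
        have h := drawFrom_always _ _ _ a ha j (by omega)
        rw [Function.update_self] at h
        rw [← h, H j le_rfl (by omega)]
      · simp
  refine PMF.ext fun x => ?_
  have x₀ : X := Classical.arbitrary X
  have h1 := key k 0 π₀ fun l => if hl : l < k then x ⟨l, hl⟩ else x₀
  have h2 : ev ((drawFrom 0 k π₀).map fun π (j : Fin k) => π j) (fun y => ind (y = x)) =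
      ((drawFrom 0 k π₀).map fun π (j : Fin k) => π j) x := by
    unfold ev
    rw [tsum_eq_single x]
    · simp [ind]
    · intro y hy
      simp [ind, hy]
  rw [← h2, ev_map, PMF.uniformOfFintype_apply]
  have h3 : ∀ a : ℕ → X, ((fun j : Fin k => a j) = x) ↔
      ∀ l, 0 ≤ l → l < 0 + k → a l = if hl : l < k then x ⟨l, hl⟩ else x₀ := by
    intro a
    constructor
    · rintro rfl l - hl
      rw [dif_pos (by omega)]
    · intro H
      funext j
      rw [H j (by omega) (by omega), dif_pos j.2]
  simp only [h3]
  rw [h1]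
  simp [ENNReal.inv_pow]

/-- Coupling of a loop with independent random bits. -/
noncomputable def drawBits (ν : PMF Bool) : ℕ → ℕ → (ℕ → Bool) → PMF (ℕ → Bool)
  | _, 0, b => PMF.pure b
  | j, t + 1, b => ν.bind fun β => drawBits ν (j + 1) t (Function.update b j β)

theorem coupled_repeat_bits {α : Type} {f : α → PMF α} {ν : PMF Bool}
    {I : ℕ → (ℕ → Bool) → α → Prop}
    (h : ∀ j b a, I j b a → Coupled (f a) ν fun β a' => I (j + 1) (Function.update b j β) a')
    (t j : ℕ) (b : ℕ → Bool) (a : α) (ha : I j b a) :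
    Coupled (repeatPMF f t a) (drawBits ν j t b) (I (j + t)) := by
  induction t generalizing j b a with
  | zero => exact coupled_pure ha
  | succ t ih =>
    refine (h j b a ha).bind fun x a' ha' => ?_
    have := ih (j + 1) _ a' ha'
    rwa [show j + 1 + t = j + (t + 1) by omega] at this

/-- A random number with `t` binary digits, appended to those of `u`. -/
noncomputable def randomNumber : ℕ → ℕ → PMF ℕ
  | 0, u => PMF.pure u
  | t + 1, u => (PMF.uniformOfFintype Bool).bind fun β => randomNumber t (u + u + if β then 1 else 0)

/-- With `t` digits to come after the prefix `u` the number is uniform on the integers from u·2^t to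
(u+1)·2^t - 1. The minimum and the truncated subtraction count those below `D`, also when the whole
interval lies on one side of `D`. -/
theorem pr_randomNumber_lt (t u D : ℕ) :
    pr (randomNumber t u) (fun v => v < D) = (min (2 ^ t) (D - u * 2 ^ t) : ℕ) / 2 ^ t := by
  induction t generalizing u with
  | zero =>
    rw [randomNumber, pr_pure]
    split
    · simp [show min 1 (D - u) = 1 by omega]
    · simp [show D - u = 0 by omega]
  | succ t ih =>
    rw [randomNumber, pr_bind_uniform]
    simp only [Fintype.sum_bool, ih, Fintype.card_bool]
    have : min (2 ^ (t + 1)) (D - u * 2 ^ (t + 1)) =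
        min (2 ^ t) (D - (u + u + if true = true then 1 else 0) * 2 ^ t) +
          min (2 ^ t) (D - (u + u + if false = true then 1 else 0) * 2 ^ t) := by
      simp only [if_true, Bool.false_eq_true, if_false, add_mul, add_zero, pow_succ, one_mul, mul_two,
        mul_add]
      omega
    rw [this]
    push_cast
    rw [pow_succ]
    simp only [if_true]
    field_simp

/-- The distribution of a bit that equals 1 with probability `D / 2 ^ t`. -/
noncomputable def roundedBit (t D : ℕ) : PMF Bool := (randomNumber t 0).map fun v => decide (v < D)

theorem pr_roundedBit {t D : ℕ} (h : D ≤ 2 ^ t) :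
    pr (roundedBit t D) (fun β => β = true) = (D : ℝ) / 2 ^ t := by
  rw [roundedBit, pr_map]
  simp only [decide_eq_true_eq, pr_randomNumber_lt]
  rw [show min (2 ^ t) (D - 0 * 2 ^ t) = D by omega]

end Draw

/-! ## Bernoulli bits -/

section Bernoulli

variable {k : ℕ}

/-- `g`, applied to the first bits of a sequence. -/
def onBits (g : Word k → Bool) (b : ℕ → Bool) : Bool := g fun j => b j

/-- The probability that `g` is satisfied by the bits `b`, if the bits number `j, …, j + t - 1` are
replaced by independent bits that are 1 with probability `δ`. -/
noncomputable def bernoulliTail (g : Word k → Bool) (δ : ℝ) : ℕ → ℕ → (ℕ → Bool) → ℝ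
  | _, 0, b => if onBits g b = true then 1 else 0
  | j, t + 1, b => δ * bernoulliTail g δ (j + 1) t (Function.update b j true) +
      (1 - δ) * bernoulliTail g δ (j + 1) t (Function.update b j false)

variable {g : Word k → Bool} {δ : ℝ}

theorem bernoulliTail_mem (h0 : 0 ≤ δ) (h1 : δ ≤ 1) (j t : ℕ) (b : ℕ → Bool) :
    0 ≤ bernoulliTail g δ j t b ∧ bernoulliTail g δ j t b ≤ 1 := by
  induction t generalizing j b with
  | zero => unfold bernoulliTail; split <;> simp
  | succ t ih =>
    have hA := ih (j + 1) (Function.update b j true)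
    have hB := ih (j + 1) (Function.update b j false)
    unfold bernoulliTail
    constructor <;> nlinarith

/-- A hybrid argument: changing the bias of one bit costs at most |δ - δ'|. It bounds the effect of
rounding δ. -/
theorem bernoulliTail_lipschitz {δ' : ℝ} (h0 : 0 ≤ δ) (h1 : δ ≤ 1) (h0' : 0 ≤ δ') (h1' : δ' ≤ 1)
    (j t : ℕ) (b : ℕ → Bool) :
    |bernoulliTail g δ j t b - bernoulliTail g δ' j t b| ≤ t * |δ - δ'| := by
  induction t generalizing j b with
  | zero => simp [bernoulliTail]
  | succ t ih =>
    have hA := abs_le.1 (ih (j + 1) (Function.update b j true))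
    have hB := abs_le.1 (ih (j + 1) (Function.update b j false))
    have hA' := bernoulliTail_mem (g := g) h0' h1' (j + 1) t (Function.update b j true)
    have hB' := bernoulliTail_mem (g := g) h0' h1' (j + 1) t (Function.update b j false)
    unfold bernoulliTail
    set A := bernoulliTail g δ (j + 1) t (Function.update b j true)
    set B := bernoulliTail g δ (j + 1) t (Function.update b j false)
    set A' := bernoulliTail g δ' (j + 1) t (Function.update b j true)
    set B' := bernoulliTail g δ' (j + 1) t (Function.update b j false)
    have e : δ * A + (1 - δ) * B - (δ' * A' + (1 - δ') * B') =
        δ * (A - A') + (1 - δ) * (B - B') + (δ - δ') * (A' - B') := by ring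
    have h3 : |(δ - δ') * (A' - B')| ≤ |δ - δ'| := by
      rw [abs_mul]
      exact mul_le_of_le_one_right (abs_nonneg _) (abs_le.2 ⟨by linarith, by linarith⟩)
    rw [e]
    rw [abs_le] at h3 ⊢
    push_cast
    constructor <;> nlinarith

theorem bernoulliTail_congr {j t : ℕ} (hk : k ≤ j + t) {b b' : ℕ → Bool} (h : ∀ l < j, b l = b' l) :
    bernoulliTail g δ j t b = bernoulliTail g δ j t b' := by
  induction t generalizing j b b' with
  | zero =>
    unfold bernoulliTail onBits
    have : (fun l : Fin k => b l) = fun l : Fin k => b' l := funext fun l => h l (by omega)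
    rw [this]
  | succ t ih =>
    have : ∀ β, bernoulliTail g δ (j + 1) t (Function.update b j β) =
        bernoulliTail g δ (j + 1) t (Function.update b' j β) := fun β =>
      ih (by omega) fun l hl => by
        by_cases e : l = j
        · subst e; simp
        · rw [Function.update_of_ne e, Function.update_of_ne e, h l (by omega)]
    unfold bernoulliTail
    rw [this, this]

theorem bernoulliTail_eq_sum (j t : ℕ) (hk : j + t = k) (b : ℕ → Bool) :
    bernoulliTail g δ j t b = ∑ u : Word t,
      if onBits g (fun l => if hl : j ≤ l ∧ l < j + t then u ⟨l - j, by omega⟩ else b l) = true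
        then ∏ i, (if u i = true then δ else 1 - δ) else 0 := by
  induction t generalizing j b with
  | zero =>
    have : ∀ u : Word 0, (fun l => if hl : j ≤ l ∧ l < j + 0 then u ⟨l - j, by omega⟩ else b l) =
        b := fun u => funext fun l => dif_neg (by omega)
    simp only [this, bernoulliTail, Finset.univ_unique, Finset.sum_singleton, Finset.univ_eq_empty,
      Finset.prod_empty]
  | succ t ih =>
    rw [bernoulliTail, ih (j + 1) (by omega), ih (j + 1) (by omega),
      ← (Fin.consEquiv fun _ => Bool).sum_comp, Fintype.sum_prod_type]
    simp only [Fintype.sum_bool, Finset.mul_sum, Fin.consEquiv_apply]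
    congr 1
    all_goals
      refine Finset.sum_congr rfl fun u _ => ?_
      rw [Fin.prod_univ_succ]
      simp only [Fin.cons_zero, Fin.cons_succ, mul_ite, mul_zero, if_true, Bool.false_eq_true,
        if_false]
      congr 2
      congr 1
      funext l
      by_cases h1 : l = j
      · subst h1
        simp [show ¬(l + 1 ≤ l) by omega]
      · by_cases h2 : j + 1 ≤ l ∧ l < j + 1 + t
        · rw [dif_pos h2, dif_pos (by omega)]
          have : (⟨l - j, by omega⟩ : Fin (t + 1)) = Fin.succ ⟨l - (j + 1), by omega⟩ := by
            ext; simp; omega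
          rw [this, Fin.cons_succ]
        · rw [dif_neg h2, dif_neg (by omega), Function.update_of_ne h1]

theorem bernoulliProb_eq (b : ℕ → Bool) : bernoulliProb k δ g = bernoulliTail g δ 0 k b := by
  rw [bernoulliTail_eq_sum 0 k (by omega), bernoulliProb]
  refine Finset.sum_congr rfl fun u _ => ?_
  have : onBits g (fun l => if hl : 0 ≤ l ∧ l < 0 + k then u ⟨l - 0, by omega⟩ else b l) = g u := by
    unfold onBits
    congr 1
    funext j
    simp
  rw [this]

theorem pr_drawBits {ν : PMF Bool} (hν : pr ν (fun β => β = true) = δ) (j t : ℕ) (b : ℕ → Bool) :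
    pr (drawBits ν j t b) (fun b' => onBits g b' = true) = bernoulliTail g δ j t b := by
  have h1 : (ν true).toReal = δ := by
    rw [← hν]
    unfold pr
    rw [ev_bool]
    simp [ind]
  have h2 : (ν false).toReal = 1 - δ := by
    rw [← hν, ← pr_not]
    unfold pr
    rw [ev_bool]
    simp [ind]
  induction t generalizing j b with
  | zero =>
    rw [drawBits, pr_pure]
    rfl
  | succ t ih =>
    rw [bernoulliTail, ← ih, ← ih, ← h2, ← h1]
    unfold pr
    rw [drawBits, ev_bind, ev_bool, ENNReal.toReal_add, ENNReal.toReal_mul, ENNReal.toReal_mul]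
    · exact ENNReal.mul_ne_top (PMF.apply_ne_top _ _) (ev_ind_ne_top _ _)
    · exact ENNReal.mul_ne_top (PMF.apply_ne_top _ _) (ev_ind_ne_top _ _)

end Bernoulli

/-! ## Continuing an execution -/

namespace SolverCircuit

variable {P : Puzzle} {k : ℕ} (C : SolverCircuit P k)

/-- The messages that `C` received before instance `j`, if these are `h` before instance `e`, and
the poser uses the coins `π i` in instance `i` for `i ≥ e`. -/
def histFrom (ρ : Word C.coins) (e : ℕ) (h : List (Word P.msgLen)) (π : ℕ → Word P.coins) :
    ℕ → List (Word P.msgLen)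
  | 0 => h
  | j + 1 => if j < e then h else (C.play ρ (π j) (histFrom ρ e h π j) P.rounds).1

/-- The replies of `C` in instance `j`. -/
def repliesFrom (ρ : Word C.coins) (e : ℕ) (h : List (Word P.msgLen)) (π : ℕ → Word P.coins)
    (j : ℕ) : List (Word P.repLen) :=
  (C.play ρ (π j) (C.histFrom ρ e h π j) P.rounds).2

/-- Answer number `j` of `C`. -/
def answer (ρ : Word C.coins) (h : List (Word P.msgLen)) (j : ℕ) : Word P.ansLen :=
  if hj : j < k then C.answers ρ h ⟨j, hj⟩ else fun _ => false

/-- The bits `b` for the instances before `e`, and the checking bits for the others. -/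
def bitsFrom (ρ : Word C.coins) (e : ℕ) (h : List (Word P.msgLen)) (b : ℕ → Bool)
    (π : ℕ → Word P.coins) (j : ℕ) : Bool :=
  if j < e then b j else
    P.check (π j) (C.repliesFrom ρ e h π j) (C.answer ρ (C.histFrom ρ e h π k) j)

variable {C} {ρ : Word C.coins} {e : ℕ} {h : List (Word P.msgLen)} {π : ℕ → Word P.coins}

theorem play_length (x : Word P.coins) (t : ℕ) : (C.play ρ x h t).1.length = h.length + t := by
  induction t with
  | zero => rfl
  | succ t ih => simp only [play, List.length_cons, ih]; omega

theorem play_replies_length (x : Word P.coins) (t : ℕ) : (C.play ρ x h t).2.length = t := by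
  induction t with
  | zero => rfl
  | succ t ih => simp only [play, List.length_cons, ih]

theorem histFrom_of_le {j : ℕ} (hj : j ≤ e) : C.histFrom ρ e h π j = h := by
  cases j with
  | zero => rfl
  | succ j => rw [histFrom, if_pos (by omega)]

theorem histFrom_succ {j : ℕ} (hj : e ≤ j) : C.histFrom ρ e h π (j + 1) =
    (C.play ρ (π j) (C.histFrom ρ e h π j) P.rounds).1 := by
  rw [histFrom, if_neg (by omega)]

theorem histFrom_length {j : ℕ} (hj : e ≤ j) (hh : h.length = e * P.rounds) :
    (C.histFrom ρ e h π j).length = j * P.rounds := by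
  induction j with
  | zero => rw [histFrom_of_le (by omega), hh, Nat.le_zero.1 hj]
  | succ j ih =>
    by_cases e1 : e = j + 1
    · rw [histFrom_of_le (by omega), hh, e1]
    · rw [histFrom_succ (by omega), play_length, ih (by omega), add_mul, one_mul]

theorem histFrom_congr {π' : ℕ → Word P.coins} {j : ℕ} (hπ : ∀ l, e ≤ l → l < j → π l = π' l) :
    C.histFrom ρ e h π j = C.histFrom ρ e h π' j := by
  induction j with
  | zero => rfl
  | succ j ih =>
    unfold histFrom
    split
    · rfl
    · rw [ih fun l h1 h2 => hπ l h1 (by omega), hπ j (by omega) (by omega)]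

theorem repliesFrom_congr {π' : ℕ → Word P.coins} {j : ℕ} (hj : e ≤ j)
    (hπ : ∀ l, e ≤ l → l ≤ j → π l = π' l) :
    C.repliesFrom ρ e h π j = C.repliesFrom ρ e h π' j := by
  unfold repliesFrom
  rw [histFrom_congr fun l h1 h2 => hπ l h1 (by omega), hπ j hj le_rfl]

theorem bitsFrom_congr {b b' : ℕ → Bool} {π' : ℕ → Word P.coins} (hb : ∀ l < e, b l = b' l)
    (hπ : ∀ l, e ≤ l → l < k → π l = π' l) {j : ℕ} (hj : j < k) :
    C.bitsFrom ρ e h b π j = C.bitsFrom ρ e h b' π' j := by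
  unfold bitsFrom
  split
  · exact hb j (by assumption)
  · rw [histFrom_congr hπ, repliesFrom_congr (by omega) fun l h1 h2 => hπ l h1 (by omega),
      hπ j (by omega) hj]

theorem onBits_bitsFrom_congr {g : Word k → Bool} {b b' : ℕ → Bool} {π' : ℕ → Word P.coins}
    (hb : ∀ l < e, b l = b' l) (hπ : ∀ l, e ≤ l → l < k → π l = π' l) :
    onBits g (C.bitsFrom ρ e h b π) = onBits g (C.bitsFrom ρ e h b' π') := by
  unfold onBits
  congr 1
  funext j
  exact bitsFrom_congr hb hπ j.2

theorem histFrom_step {j : ℕ} (hj : e + 1 ≤ j) :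
    C.histFrom ρ e h π j = C.histFrom ρ (e + 1) (C.play ρ (π e) h P.rounds).1 π j := by
  induction j with
  | zero => omega
  | succ j ih =>
    by_cases e1 : e = j
    · subst e1
      rw [histFrom_succ le_rfl, histFrom_of_le le_rfl, histFrom_of_le le_rfl]
    · rw [histFrom_succ (by omega), histFrom_succ (by omega), ih (by omega)]

theorem repliesFrom_step {j : ℕ} (hj : e + 1 ≤ j) : C.repliesFrom ρ e h π j =
    C.repliesFrom ρ (e + 1) (C.play ρ (π e) h P.rounds).1 π j := by
  unfold repliesFrom
  rw [histFrom_step hj]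

/-- This moves instance `e` from the simulated part to the fixed part. Its checking bit depends on
the coins of the later instances as well, because all answers are computed after the last instance;
hence the history up to `k` on the right. -/
theorem bitsFrom_step {b : ℕ → Bool} (he : e < k) (j : ℕ) :
    C.bitsFrom ρ e h b π j = C.bitsFrom ρ (e + 1) (C.play ρ (π e) h P.rounds).1
      (Function.update b e (P.check (π e) (C.play ρ (π e) h P.rounds).2
        (C.answer ρ (C.histFrom ρ (e + 1) (C.play ρ (π e) h P.rounds).1 π k) e))) π j := by
  unfold bitsFrom
  rcases lt_trichotomy j e with h1 | h1 | h1
  · rw [if_pos h1, if_pos (by omega), Function.update_of_ne (by omega)]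
  · subst h1
    rw [if_neg (by omega), if_pos (by omega), Function.update_self, ← histFrom_step (by omega),
      repliesFrom, histFrom_of_le le_rfl]
  · rw [if_neg (by omega), if_neg (by omega), ← histFrom_step (by omega),
      ← repliesFrom_step (by omega)]

theorem history_eq (π : ℕ → Word P.coins) (j : ℕ) (hj : j ≤ k) :
    C.history ρ (fun i => π i) j = C.histFrom ρ 0 [] π j := by
  induction j with
  | zero => rfl
  | succ j ih =>
    rw [history, dif_pos (by omega), histFrom_succ (by omega), ih (by omega)]

theorem solved_eq (π : ℕ → Word P.coins) (b : ℕ → Bool) (j : Fin k) :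
    C.solved ρ (fun i => π i) j = C.bitsFrom ρ 0 [] b π j := by
  rw [solved, bitsFrom, if_neg (by omega), repliesFrom, answer, dif_pos j.2, history_eq _ _ le_rfl,
    history_eq _ _ j.2.le]

end SolverCircuit

end WVP

/-! ### The generating program, and its simulations as ideal experiments. -/

namespace WVP
open scoped ENNReal

section

variable {α β γ : Type}

theorem Coupled.bind_left {p : PMF α} {μ : PMF β} {q : α → PMF γ} {Q : β → α → Prop}
    {Q' : β → γ → Prop} (h : Coupled p μ Q) (h' : ∀ b a, Q b a → Always (q a) (Q' b)) :
    Coupled (p.bind q) μ Q' := by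
  intro f F hf
  rw [ev_bind]
  exact h _ _ fun b a hba => ev_le_of_le fun c hc => hf b c (h' b a hba c hc)

theorem Always.bind_coupled {p : PMF α} {μ : PMF β} {q : α → PMF γ} {A : α → Prop}
    {Q : β → γ → Prop} (h : Always p A) (h' : ∀ a, A a → Coupled (q a) μ Q) :
    Coupled (p.bind q) μ Q := by
  intro f F hf
  rw [ev_bind]
  exact ev_le_of_le fun a ha => h' a (h a ha) f F hf

end

/-! ## The generating program

The number registers `0, …, 3` hold `k`, `n`, the number of rounds and `⌈1 / ε⌉`.  Register 4 holds
one, 5 the number of candidates tried per stage, 6 the number of samples per estimate, 7 and 8 the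
number of binary digits of `δ` and the rounded `δ`, 9 holds `k - 1`, 10 the number of trials of the
solver that is built, 11 the decrement of the threshold.  Register 12 holds the number of instances
that remain to be simulated, 13 the present stage, 14 the first instance to be simulated, 15 the
threshold, and 16 says whether the last search was successful.  Register 25 remains zero. -/

namespace Program

/-- Sequential composition of a list of programs. -/
def block : List Program → Program
  | [] => skip
  | c :: l => seq c (block l)

/-- Copy `c` of the solver plays against the poser in register `p`. -/
def playInstance (c p : ℕ) : Program :=
  loop 2 (block [op (.nextMsg p 1), op (.stepC c 1 1), op (.sendP p 1)])

/-- A copy of the solver plays with a fresh poser. -/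
def playFresh : Program := block [op (.newP 17), playInstance 1 17, op (.add 17 17 4)]

/-- The answer for one instance is checked. -/
def checkInstance : Program :=
  block [op (.select 1 0 17), op (.checkP 18 17 1), op (.setBit 17 18), op (.add 17 17 4)]

/-- The remaining instances are played by a duplicate of the copy number `src` of the solver, and
the answers are checked. -/
def simulate (src : ℕ) : Program :=
  block [op (.copyC 1 src), op (.copy 17 14), loop 12 playFresh, op (.outC 1 0), op (.copy 17 14),
    loop 12 checkInstance]

/-- A bit is sampled according to the rounded `δ`. -/
def sampleBit : Program :=
  block [op (.const 21 0), loop 7 (block [op (.coin 22), op (.add 21 21 21), op (.add 21 21 22)]),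
    op (.lt 18 21 8), op (.setBit 17 18), op (.add 17 17 4)]

/-- The remaining bits are sampled according to the rounded `δ`. -/
def sampleBits : Program := block [op (.copy 17 14), loop 12 sampleBit]

/-- A simulation with the candidate; the successes are counted. -/
def countSolved : Program := block [simulate 2, op (.evalG 18), op (.add 19 19 18)]

/-- A simulation with independent bits; the successes are counted. -/
def countBits : Program := block [sampleBits, op (.evalG 18), op (.add 20 20 18)]

/-- Test if the surplus of the candidate seems to be large; register 18 is zero if this is so. -/
def estimate : Program :=
  block [op (.const 19 0), op (.const 20 0), loop 6 (seq countSolved countBits),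
    op (.add 20 20 15), op (.lt 18 19 20)]

/-- Test a candidate that is generated by `sample`, and keep it if it seems to be good. -/
def tryCandidate (sample : Program) : Program :=
  block [sample, estimate, ite 18 skip (seq (op (.copyC 0 2)) (op (.const 16 1)))]

/-- Search for a good candidate. -/
def search (sample : Program) : Program :=
  seq (op (.const 16 0)) (loop 5 (ite 16 skip (tryCandidate sample)))

/-- A copy of the solver with fresh random bits. -/
def sampleStart : Program := op (.newC 2)

/-- The present copy of the solver plays one more instance, and a bit for this instance is
guessed. -/
def sampleInstance : Program :=
  block [op (.copyC 2 0), op (.newP 13), playInstance 2 13, op (.coin 18), op (.setBit 13 18)]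

/-- The parameters are computed. -/
def setup : Program :=
  -- Let z = k⌈1/ε⌉ and N = 1024z(n + 4z), which is left in register 27. A search tries 16z(n + k)
  -- candidates, and an estimate takes 8Nz samples of each kind. The first threshold 8Nk - N
  -- corresponds to the surplus (k - 1/8)/z, the decrement 8N to the surplus 1/z. δ gets 64zk
  -- digits, and the solver makes 5z trials.
  block [op (.const 4 1), mul 26 0 3, op (.add 27 0 1), op (.const 28 16), mul 5 26 27, mul 5 5 28,
    op (.const 28 4), mul 27 28 26, op (.add 27 27 1), mul 27 27 26, op (.const 28 1024),
    mul 27 27 28, op (.const 28 8), mul 11 27 28, mul 6 11 26, mul 15 11 0, op (.sub 15 15 27),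
    op (.const 28 64), mul 7 26 0, mul 7 7 28, delta 8 7, op (.sub 9 0 4), op (.const 28 5),
    mul 10 28 26]

/-- One more instance is fixed if there is a good candidate. -/
def advance : Program :=
  block [op (.add 14 13 4), op (.sub 12 0 14), search sampleInstance,
    ite 16 (seq (op (.add 13 13 4)) (op (.sub 15 15 11))) skip]

/-- The random bits are fixed, and then as many instances as possible. -/
def fixInstances : Program :=
  block [op (.sub 12 0 14), search sampleStart, op (.sub 15 15 11), op (.const 16 1),
    loop 9 (ite 16 advance skip), op (.add 14 13 4), op (.sub 12 0 14)]

/-- One trial of the solver for a single instance. -/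
def trial : Program :=
  block [simulate 0, op (.setBit 13 4), op (.evalG 23), op (.setBit 13 25), op (.evalG 24),
    -- Registers 23 and 24 hold the values of g with the bit of the actual instance set to 1 and to
    -- 0, so the comparison detects a pivotal simulation. Straight-line code cannot stop early; the
    -- last pivotal trial determines the answer.
    op (.lt 18 24 23), op (.select 1 0 13), op (.condAns 18 0 1)]

/-- The code of the solver is emitted. -/
def emission : Program :=
  seq (loop 2 (seq (emit (.recv 0)) (seq (emit (.op (.stepC 0 0 0))) (emit (.send 0)))))
    (loop 10 trial.emitAll)

/-- The generating algorithm. -/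
def generator : Program := seq setup (seq fixInstances emission)

end Program

/-! ## Simulations -/

section Simulation

open Program

variable {P : Puzzle} {k : ℕ} {C : SolverCircuit P k} {g : Word k → Bool} {ε δ : ℝ}

theorem memExec_block_cons (c : Program) (l : List Program) (m : Memory C) :
    (block (c :: l)).memExec g ε δ m = (c.memExec g ε δ m).bind ((block l).memExec g ε δ) := rfl

theorem memExec_block_nil (m : Memory C) : (block []).memExec g ε δ m = PMF.pure m := rfl

theorem memExec_seq (c c' : Program) (m : Memory C) :
    (seq c c').memExec g ε δ m = (c.memExec g ε δ m).bind (c'.memExec g ε δ) := rfl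

theorem memExec_op (o : Op) (m : Memory C) : (op o).memExec g ε δ m = o.exec g m := rfl

theorem memExec_loop (a : ℕ) (c : Program) (m : Memory C) :
    (loop a c).memExec g ε δ m = repeatPMF (c.memExec g ε δ) (m.num a) m := rfl

theorem always_playInstance {c p : ℕ} {ρ : Word C.coins} {h : List (Word P.msgLen)}
    {x : Word P.coins} {m : Memory C} (h2 : m.num 2 = P.rounds) (hc : m.solvers c = ⟨ρ, h⟩)
    (hp : m.posers (m.num p) = ⟨x, []⟩) (hh : h.length + P.rounds ≤ k * P.rounds) :
    Always ((playInstance c p).memExec g ε δ m) fun m' => m'.num = m.num ∧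
      m'.solvers c = ⟨ρ, (C.play ρ x h P.rounds).1⟩ ∧
      m'.posers = Function.update m.posers (m.num p) ⟨x, (C.play ρ x h P.rounds).2⟩ := by
  rw [playInstance, memExec_loop, h2]
  have := Always.repeat (f := fun m : Memory C => (block [op (.nextMsg p 1), op (.stepC c 1 1),
      op (.sendP p 1)]).memExec g ε δ m)
    (I := fun t m' => t ≤ P.rounds → m'.num = m.num ∧ m'.solvers c = ⟨ρ, (C.play ρ x h t).1⟩ ∧
      m'.posers = Function.update m.posers (m.num p) ⟨x, (C.play ρ x h t).2⟩) (fun t m' hm' => by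
      simp only [memExec_block_cons, memExec_op, Op.exec, PMF.pure_bind, memExec_block_nil]
      refine always_pure fun ht => ?_
      obtain ⟨h1, h2, h3⟩ := hm' (by omega)
      have hl : (C.play ρ x h t).1.length < k * P.rounds := by
        rw [SolverCircuit.play_length]; omega
      simp [h1, h2, h3, SolverCopy.push, hl, SolverCircuit.play]) P.rounds 0 m
      (fun _ => ⟨rfl, hc, by rw [SolverCircuit.play, ← hp, Function.update_eq_self]⟩)
  simpa using this

theorem coupled_playFresh {j : ℕ} {ρ : Word C.coins} {h : List (Word P.msgLen)} {m : Memory C}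
    (h2 : m.num 2 = P.rounds) (h4 : m.num 4 = 1) (h17 : m.num 17 = j) (hc : m.solvers 1 = ⟨ρ, h⟩)
    (hh : h.length + P.rounds ≤ k * P.rounds) :
    Coupled (playFresh.memExec g ε δ m) (PMF.uniformOfFintype (Word P.coins)) fun x m' =>
      m'.num 17 = j + 1 ∧ m'.solvers 1 = ⟨ρ, (C.play ρ x h P.rounds).1⟩ ∧
      m'.posers = Function.update m.posers j ⟨x, (C.play ρ x h P.rounds).2⟩ := by
  rw [playFresh, memExec_block_cons, memExec_op, Op.exec]
  refine (coupled_uniform_map _ _).bind_left fun x m' hm' => ?_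
  rw [memExec_block_cons]
  refine (always_playInstance (ρ := ρ) (h := h) (x := x) (by simp [hm', h2]) (by simp [hm', hc])
    (by simp [hm']) hh).bind fun m'' hm'' => ?_
  simp only [memExec_block_cons, memExec_op, Op.exec, PMF.pure_bind, memExec_block_nil]
  refine always_pure ⟨?_, hm''.2.1, ?_⟩
  · simp [hm''.1, hm', h4, h17]
  · simp only [hm''.2.2]
    simp [hm', h17]

/-- The cells that are left unchanged by `playFresh`. -/
def playFrame : Frame where
  num j := decide (j ≠ 17)
  solver c := decide (c ≠ 1)
  ans _ := true
  bit := true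
  posers := false
  outs := true

/-- The cells that are left unchanged by `checkInstance`. -/
def checkFrame : Frame where
  num j := decide (j ≠ 17 ∧ j ≠ 18)
  solver _ := true
  ans c := decide (c ≠ 1)
  bit := false
  posers := true
  outs := true

/-- The cells that are left unchanged by `simulate`. -/
def simulateFrame : Frame where
  num j := decide (j ≠ 17 ∧ j ≠ 18)
  solver c := decide (c ≠ 1)
  ans c := decide (c ≠ 1)
  bit := false
  posers := false
  outs := false

theorem always_playFresh (m : Memory C) :
    Always (playFresh.memExec g ε δ m) (playFrame.Agree m) := Frame.always _ (by rfl) m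

theorem always_checkInstance (m : Memory C) :
    Always (checkInstance.memExec g ε δ m) (checkFrame.Agree m) := Frame.always _ (by rfl) m

theorem always_simulate (src : ℕ) (m : Memory C) :
    Always ((simulate src).memExec g ε δ m) (simulateFrame.Agree m) := Frame.always _ (by rfl) m

/-- The memory is prepared for the simulation of the instances from `e` on. -/
structure Ready (e : ℕ) (m : Memory C) : Prop where
  rounds : m.num 2 = P.rounds
  one : m.num 4 = 1
  first : m.num 14 = e
  remaining : m.num 12 = k - e
  le : e ≤ k

/-- The ideal experiment draws the coins of the instances from `e` on. The first loop plays these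
instances and keeps all posers, since the answers exist only after the last one; the second loop is
deterministic and checks them. The bits before `e` stay in the bank as assumed values. -/
theorem coupled_simulate {src e : ℕ} {ρ : Word C.coins} {h : List (Word P.msgLen)} {m : Memory C}
    (hm : Ready e m) (hc : m.solvers src = ⟨ρ, h⟩) (hh : h.length = e * P.rounds)
    (π₀ : ℕ → Word P.coins) :
    Coupled ((simulate src).memExec g ε δ m) (drawFrom e (k - e) π₀) fun π m' =>
      (∀ j < k, m'.bit j = C.bitsFrom ρ e h m.bit π j) ∧ (∀ j < e, m'.bit j = m.bit j) ∧
      m'.outs 0 = C.answers ρ (C.histFrom ρ e h π k) := by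
  simp only [simulate, memExec_block_cons, memExec_op, Op.exec, PMF.pure_bind]
  rw [memExec_loop]
  set m₁ : Memory C := { m with
    solvers := Function.update m.solvers 1 (m.solvers src)
    num := Function.update m.num 17 (m.num 14) } with hm₁
  have e12 : m₁.num 12 = k - e := by simp [hm₁, hm.remaining]
  have key := coupled_repeat_draw (f := playFresh.memExec (C := C) g ε δ) (b := k)
    (I := fun j π m' => e ≤ j ∧ playFrame.Agree m₁ m' ∧ m'.num 17 = j ∧
      m'.solvers 1 = ⟨ρ, C.histFrom ρ e h π j⟩ ∧
      ∀ l, e ≤ l → l < j → m'.posers l = ⟨π l, C.repliesFrom ρ e h π l⟩)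
    (fun j hj π m' ⟨h0, h1, h17, hs, hp⟩ => by
      refine ((coupled_playFresh (by rw [h1.num 2 rfl]; simp [hm₁, hm.rounds])
        (by rw [h1.num 4 rfl]; simp [hm₁, hm.one]) h17 hs ?_).and_always
        (always_playFresh m')).mono fun x m'' ⟨⟨k1, k2, k3⟩, k4⟩ => ?_
      · rw [SolverCircuit.histFrom_length h0 hh, ← add_one_mul]
        exact Nat.mul_le_mul_right _ (by omega)
      have e1 : ∀ l ≤ j, C.histFrom ρ e h (Function.update π j x) l = C.histFrom ρ e h π l :=
        fun l hl => SolverCircuit.histFrom_congr fun i _ hi => Function.update_of_ne (by omega) _ _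
      refine ⟨by omega, h1.trans k4, k1, ?_, fun l hl hl' => ?_⟩
      · rw [k2, SolverCircuit.histFrom_succ h0, e1 j le_rfl, Function.update_self]
      · rw [k3]
        by_cases e2 : l = j
        · subst e2
          rw [Function.update_self, Function.update_self, SolverCircuit.repliesFrom, e1 l le_rfl,
            Function.update_self]
        · rw [Function.update_of_ne e2, hp l hl (by omega), Function.update_of_ne e2,
            SolverCircuit.repliesFrom, SolverCircuit.repliesFrom, e1 l (by omega),
            Function.update_of_ne e2])
    (k - e) e (by have := hm.le; omega) π₀ m₁
    ⟨le_rfl, .refl _ _, by simp [hm₁, hm.first], by simp [hm₁, hc, SolverCircuit.histFrom_of_le],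
      by omega⟩
  rw [e12]
  refine key.bind_left fun π m₂ ⟨_, h1, h17, hs, hp⟩ => ?_
  rw [show e + (k - e) = k by have := hm.le; omega] at hs hp
  simp only [memExec_block_cons, memExec_op, Op.exec, PMF.pure_bind]
  rw [memExec_loop]
  set m₃ : Memory C := { m₂ with
    outs := Function.update m₂.outs 0 (C.answers (m₂.solvers 1).coins (m₂.solvers 1).hist)
    num := Function.update m₂.num 17 (m₂.num 14) } with hm₃
  have e12' : m₃.num 12 = k - e := by
    simp only [hm₃, ne_eq, Nat.reduceEqDiff, not_false_eq_true,
      Function.update_of_ne]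
    rw [h1.num 12 rfl, e12]
  have key₂ := Always.repeat (f := checkInstance.memExec (C := C) g ε δ)
    (I := fun j m' => e ≤ j ∧ checkFrame.Agree m₃ m' ∧ m'.num 17 = j ∧
      ∀ l, m'.bit l = if e ≤ l ∧ l < j then
        P.check (m₃.posers l).coins (m₃.posers l).replies
          (if hl : l < k then m₃.outs 0 ⟨l, hl⟩ else fun _ => false) else m.bit l)
    (fun j m' ⟨h0, k1, k17, kb⟩ => by
      refine ((?_ : Always (checkInstance.memExec g ε δ m') fun m'' => m''.num 17 = j + 1 ∧
        m''.bit = Function.update m'.bit j (P.check (m'.posers j).coins (m'.posers j).replies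
          (if hl : j < k then m'.outs 0 ⟨j, hl⟩ else fun _ => false))).and
          (always_checkInstance m')).mono fun m'' ⟨⟨l1, l2⟩, l3⟩ =>
            ⟨by omega, k1.trans l3, l1, fun l => ?_⟩
      · simp only [checkInstance, memExec_block_cons, memExec_op, Op.exec, PMF.pure_bind,
          memExec_block_nil]
        refine always_pure ⟨?_, ?_⟩
        · simp [k17, k1.num 4 rfl, hm₃, h1.num 4 rfl, hm₁, hm.one]
        · simp [k17]
      · rw [l2]
        by_cases e2 : l = j
        · subst e2
          rw [Function.update_self, if_pos (by omega), k1.posers rfl, k1.outs rfl]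
        · rw [Function.update_of_ne e2, kb]
          refine if_congr (by omega) rfl rfl)
    (k - e) e m₃ ⟨le_rfl, .refl _ _, by simp [hm₃, h1.num 14 rfl, hm₁, hm.first], fun l => by
      rw [if_neg (by omega)]
      simp [hm₃, h1.bit rfl, hm₁]⟩
  rw [e12']
  refine key₂.bind fun m' ⟨_, k1, k17, kb⟩ => always_pure ⟨fun j hj => ?_, fun j hj => ?_, ?_⟩
  · rw [kb, SolverCircuit.bitsFrom]
    by_cases hj' : j < e
    · rw [if_neg (by omega), if_pos hj']
    · rw [if_pos (by omega), if_neg hj', dif_pos hj, SolverCircuit.answer, dif_pos hj]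
      simp [hm₃, hs, hp j (by omega) hj]
  · rw [kb, if_neg (by omega)]
  · rw [k1.outs rfl]
    simp [hm₃, hs]

/-! ## Estimates -/

/-- The cells that are left unchanged while a random number is generated. -/
def numberFrame : Frame where
  num j := decide (j ≠ 21 ∧ j ≠ 22)
  solver _ := true
  ans _ := true
  bit := true
  posers := true
  outs := true

/-- The cells that are left unchanged by `sampleBit`. -/
def sampleFrame : Frame where
  num j := decide (j ≠ 17 ∧ j ≠ 18 ∧ j ≠ 21 ∧ j ≠ 22)
  solver _ := true
  ans _ := true
  bit := false
  posers := true
  outs := true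

theorem always_sampleBit (m : Memory C) :
    Always (sampleBit.memExec g ε δ m) (sampleFrame.Agree m) := Frame.always _ (by rfl) m

theorem coupled_sampleBit {j : ℕ} {m : Memory C} (h4 : m.num 4 = 1) (h17 : m.num 17 = j) :
    Coupled (sampleBit.memExec g ε δ m) (roundedBit (m.num 7) (m.num 8)) fun β m' =>
      m'.num 17 = j + 1 ∧ m'.bit = Function.update m.bit j β := by
  have key : ∀ (t u : ℕ) (m' : Memory C), m'.num 21 = u →
      Coupled (repeatPMF ((block [op (.coin 22), op (.add 21 21 21), op (.add 21 21 22)]).memExec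
        g ε δ) t m') (randomNumber t u) fun v m'' => m''.num 21 = v := by
    intro t
    induction t with
    | zero => exact fun u m' hu => coupled_pure hu
    | succ t ih =>
      intro u m' hu
      rw [repeatPMF_succ, randomNumber]
      refine Coupled.bind (Q := fun β m'' => m''.num 21 = u + u + if β then 1 else 0) ?_
        fun β m'' h => ih _ m'' h
      rw [memExec_block_cons, memExec_op, Op.exec]
      refine (coupled_uniform_map _ _).bind_left fun β m₁ hm₁ => ?_
      simp only [memExec_block_cons, memExec_op, Op.exec, PMF.pure_bind, memExec_block_nil]
      exact always_pure (by simp [hm₁, hu])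
  have frame : ∀ m' : Memory C, Always ((loop 7 (block [op (.coin 22), op (.add 21 21 21),
      op (.add 21 21 22)])).memExec g ε δ m') (numberFrame.Agree m') :=
    fun m' => Frame.always _ (by rfl) m'
  simp only [sampleBit, memExec_block_cons, memExec_op, Op.exec, PMF.pure_bind]
  set m₁ : Memory C := { m with num := Function.update m.num 21 0 } with hm₁
  -- The ideal outcome is only the bit; the random number behind it is kept as an existential
  -- witness until it is compared with register 8.
  refine Coupled.bind_left (Q := fun β m' => (∃ v, β = decide (v < m.num 8) ∧ m'.num 21 = v) ∧
    numberFrame.Agree m₁ m') ?_ ?_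
  · refine Coupled.and_always ?_ (frame m₁)
    rw [memExec_loop]
    have e7 : m₁.num 7 = m.num 7 := by simp [hm₁]
    rw [e7]
    exact coupled_map_right ((key _ 0 m₁ (by simp [hm₁])).mono fun v m' hm' => ⟨v, rfl, hm'⟩)
  · rintro β m' ⟨⟨v, rfl, hv⟩, ha⟩
    simp only [memExec_block_cons, memExec_op, Op.exec, memExec_block_nil, PMF.pure_bind]
    refine always_pure ⟨?_, ?_⟩
    · simp [ha.num 17 rfl, ha.num 4 rfl, hm₁, h4, h17]
    · simp [ha.num 17 rfl, ha.num 8 rfl, ha.bit rfl, hm₁, h17, hv]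

theorem coupled_sampleBits {e : ℕ} {m : Memory C} (hm : Ready e m) :
    Coupled (sampleBits.memExec g ε δ m) (drawBits (roundedBit (m.num 7) (m.num 8)) e (k - e) m.bit)
      fun b m' => m'.bit = b ∧ ∀ j < e, m'.bit j = m.bit j := by
  simp only [sampleBits, memExec_block_cons, memExec_op, Op.exec, PMF.pure_bind]
  set m₁ : Memory C := { m with num := Function.update m.num 17 (m.num 14) } with hm₁
  rw [memExec_loop]
  have e12 : m₁.num 12 = k - e := by simp [hm₁, hm.remaining]
  have key := coupled_repeat_bits (f := sampleBit.memExec (C := C) g ε δ)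
    (ν := roundedBit (m.num 7) (m.num 8))
    (I := fun j b m' => e ≤ j ∧ sampleFrame.Agree m₁ m' ∧ m'.num 17 = j ∧ m'.bit = b ∧
      ∀ l < e, m'.bit l = m.bit l)
    (fun j b m' ⟨h0, h1, h17, hb, hb'⟩ => by
      have := (coupled_sampleBit (g := g) (ε := ε) (δ := δ) (m := m')
        (by rw [h1.num 4 rfl]; simp [hm₁, hm.one]) h17).and_always (always_sampleBit m')
      rw [h1.num 7 rfl, h1.num 8 rfl] at this
      simp only [hm₁, ne_eq, Nat.reduceEqDiff, not_false_eq_true,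
        Function.update_of_ne] at this
      refine this.mono fun β m'' ⟨⟨k1, k2⟩, k3⟩ => ⟨by omega, h1.trans k3, k1, by rw [k2, hb],
        fun l hl => ?_⟩
      rw [k2, Function.update_of_ne (by omega), hb' l hl])
    (k - e) e m.bit m₁ ⟨le_rfl, .refl _ _, by simp [hm₁, hm.first], rfl, fun _ _ => rfl⟩
  rw [e12]
  exact key.bind_left fun b m' ⟨_, _, _, hb, hb'⟩ => always_pure ⟨hb, hb'⟩

end Simulation

end WVP

/-! ### Surplus, and exponential moments of its estimates. -/

namespace WVP
open scoped ENNReal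

section Estimate

open Program

variable {P : Puzzle} {k : ℕ} {C : SolverCircuit P k} {g : Word k → Bool} {ε δ : ℝ}

/-- The success probability of `C`, if the instances before `e` lead to the messages `h` and have
the checking bits `b`. -/
noncomputable def SolverCircuit.value (C : SolverCircuit P k) (g : Word k → Bool) (ρ : Word C.coins)
    (e : ℕ) (h : List (Word P.msgLen)) (b : ℕ → Bool) : ℝ :=
  pr (drawFrom e (k - e) fun _ _ => false) fun π => onBits g (C.bitsFrom ρ e h b π) = true

/-- The advantage of `C` over independent bits in this situation. -/
noncomputable def SolverCircuit.surplus (C : SolverCircuit P k) (g : Word k → Bool) (δ : ℝ)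
    (ρ : Word C.coins) (e : ℕ) (h : List (Word P.msgLen)) (b : ℕ → Bool) : ℝ :=
  C.value g ρ e h b - bernoulliTail g δ e (k - e) b

theorem value_congr {ρ : Word C.coins} {e : ℕ} {h : List (Word P.msgLen)} {b b' : ℕ → Bool}
    (hb : ∀ l < e, b l = b' l) : C.value g ρ e h b = C.value g ρ e h b' :=
  pr_congr fun π _ => by
    rw [SolverCircuit.onBits_bitsFrom_congr (π' := π) hb fun _ _ _ => rfl]

theorem surplus_congr {ρ : Word C.coins} {e : ℕ} {h : List (Word P.msgLen)} {b b' : ℕ → Bool}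
    (hb : ∀ l < e, b l = b' l) : C.surplus g δ ρ e h b = C.surplus g δ ρ e h b' := by
  rw [SolverCircuit.surplus, value_congr hb, bernoulliTail_congr (by omega) hb,
    SolverCircuit.surplus]

theorem ev_ite {α : Type} (μ : PMF α) (A : α → Prop) [DecidablePred A] (x y : ℝ≥0∞) :
    ev μ (fun a => if A a then x else y) =
      ENNReal.ofReal (pr μ A) * x + ENNReal.ofReal (1 - pr μ A) * y := by
  have : ∀ a, (if A a then x else y) = ind (A a) * x + ind (¬A a) * y := by
    intro a
    unfold ind
    by_cases h : A a <;> simp [h]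
  simp only [this]
  rw [ev_add, ev_mul_right, ev_mul_right, ← pr_not, ofReal_pr, ofReal_pr]

/-- The exponential moment of a Bernoulli variable. -/
theorem ev_exp_le {α : Type} (μ : PMF α) (A : α → Prop) [DecidablePred A] {l : ℝ} (hl : |l| ≤ 1)
    (x : ℝ) : ev μ (fun a => ENNReal.ofReal (Real.exp (x + l * if A a then 1 else 0))) ≤
      ENNReal.ofReal (Real.exp (x + l * pr μ A + l ^ 2)) := by
  have e1 : ∀ a, ENNReal.ofReal (Real.exp (x + l * if A a then 1 else 0)) =
      if A a then ENNReal.ofReal (Real.exp (x + l)) else ENNReal.ofReal (Real.exp x) := by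
    intro a; split <;> simp
  simp only [e1]
  have h0 := pr_nonneg μ A
  have h1 := pr_le_one μ A
  rw [ev_ite, ← ENNReal.ofReal_mul h0, ← ENNReal.ofReal_mul (by linarith),
    ← ENNReal.ofReal_add (by positivity) (mul_nonneg (by linarith) (Real.exp_pos _).le)]
  refine ENNReal.ofReal_le_ofReal ?_
  rw [Real.exp_add, add_assoc, Real.exp_add x]
  -- For |l| ≤ 1 one has e^l ≤ 1 + l + l², hence 1 - p + p e^l ≤ 1 + lp + l² ≤ exp(lp + l²).
  have h2 := abs_le.1 (Real.abs_exp_sub_one_sub_id_le hl)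
  have h3 := Real.add_one_le_exp (l * pr μ A + l ^ 2)
  have h4 : pr μ A * Real.exp l + (1 - pr μ A) ≤ Real.exp (l * pr μ A + l ^ 2) := by
    refine le_trans ?_ h3
    nlinarith [sq_nonneg l]
  nlinarith [Real.exp_pos x]

/-- The cells that are left unchanged by `countSolved`. -/
def solvedFrame : Frame where
  num j := decide (j ≠ 17 ∧ j ≠ 18 ∧ j ≠ 19)
  solver c := decide (c ≠ 1)
  ans c := decide (c ≠ 1)
  bit := false
  posers := false
  outs := false

/-- The cells that are left unchanged by `countBits`. -/
def bitsFrame : Frame where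
  num j := decide (j ≠ 17 ∧ j ≠ 18 ∧ j ≠ 20 ∧ j ≠ 21 ∧ j ≠ 22)
  solver _ := true
  ans _ := true
  bit := false
  posers := true
  outs := true

/-- The cells that are left unchanged by `estimate`. -/
def estimateFrame : Frame where
  num j := decide (j < 17 ∨ 22 < j)
  solver c := decide (c ≠ 1)
  ans c := decide (c ≠ 1)
  bit := false
  posers := false
  outs := false

theorem always_countSolved (m : Memory C) :
    Always (countSolved.memExec g ε δ m) (solvedFrame.Agree m) := Frame.always _ (by rfl) m

theorem always_countBits (m : Memory C) :
    Always (countBits.memExec g ε δ m) (bitsFrame.Agree m) := Frame.always _ (by rfl) m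

theorem always_estimate (m : Memory C) :
    Always (estimate.memExec g ε δ m) (estimateFrame.Agree m) := Frame.always _ (by rfl) m

theorem Ready.of_agree {S : Frame} {e : ℕ} {m m' : Memory C} (hm : Ready e m) (h : S.Agree m m')
    (h2 : S.num 2 = true := by rfl) (h4 : S.num 4 = true := by rfl)
    (h14 : S.num 14 = true := by rfl) (h12 : S.num 12 = true := by rfl) : Ready e m' :=
  ⟨by rw [h.num 2 h2, hm.rounds], by rw [h.num 4 h4, hm.one], by rw [h.num 14 h14, hm.first],
    by rw [h.num 12 h12, hm.remaining], hm.le⟩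

theorem coupled_countSolved {e : ℕ} {ρ : Word C.coins} {h : List (Word P.msgLen)} {m : Memory C}
    (hm : Ready e m) (hc : m.solvers 2 = ⟨ρ, h⟩) (hh : h.length = e * P.rounds) :
    Coupled (countSolved.memExec g ε δ m) (drawFrom e (k - e) fun _ _ => false) fun π m' =>
      (m'.num 19 = m.num 19 + if onBits g (C.bitsFrom ρ e h m.bit π) = true then 1 else 0) ∧
      ∀ j < e, m'.bit j = m.bit j := by
  rw [countSolved, memExec_block_cons]
  refine ((coupled_simulate hm hc hh _).and_always (always_simulate 2 m)).bind_left
    fun π m' ⟨⟨h1, h2, _⟩, h3⟩ => ?_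
  simp only [memExec_block_cons, memExec_op, Op.exec, PMF.pure_bind, memExec_block_nil]
  refine always_pure ⟨?_, h2⟩
  have : (fun j : Fin k => m'.bit j) = fun j : Fin k => C.bitsFrom ρ e h m.bit π j :=
    funext fun j => h1 j j.2
  simp only [ne_eq, Nat.reduceEqDiff, not_false_eq_true, Function.update_of_ne, Function.update_self,
    h3.num 19 rfl, this, onBits]
  congr

theorem coupled_countBits {e : ℕ} {m : Memory C} (hm : Ready e m) :
    Coupled (countBits.memExec g ε δ m) (drawBits (roundedBit (m.num 7) (m.num 8)) e (k - e) m.bit)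
      fun b m' => (m'.num 20 = m.num 20 + if onBits g b = true then 1 else 0) ∧
        ∀ j < e, m'.bit j = m.bit j := by
  rw [countBits, memExec_block_cons]
  refine ((coupled_sampleBits hm).and_always (Frame.always sampleFrame (by rfl) m)).bind_left
    fun b m' ⟨⟨h1, h2⟩, h3⟩ => ?_
  simp only [memExec_block_cons, memExec_op, Op.exec, PMF.pure_bind, memExec_block_nil]
  refine always_pure ⟨?_, h2⟩
  simp [h3.num 20 rfl, h1, onBits]
  congr

/-- The coupling is tested with the indicator of the complement of `A`, which is dominated by 0. -/
theorem always_of_coupled {α β : Type} {p : PMF α} {μ : PMF β} {Q : β → α → Prop} {A : α → Prop}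
    (h : Coupled p μ Q) (hQ : ∀ b a, Q b a → A a) : Always p A := by
  intro a ha
  by_contra hA
  have h1 := h (fun a => ind (¬A a)) (fun _ => 0) fun b a hb => by rw [ind_false (by simpa using hQ b a hb)]
  rw [ev_const] at h1
  have h2 : p a * ind (¬A a) ≤ ev p fun a => ind (¬A a) := ENNReal.le_tsum a
  rw [ind_true hA, mul_one] at h2
  exact ha (le_antisymm (h2.trans h1) zero_le)

/-- The memory is prepared for an estimate, and it differs from `m₀` only in irrelevant cells. -/
structure Estimating (e : ℕ) (m₀ m : Memory C) : Prop where
  agree : estimateFrame.Agree m₀ m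
  bits : ∀ j < e, m.bit j = m₀.bit j

/-- The two counters enter with opposite signs. A simulation with C contributes the exponent l·value
+ l², a sample of independent bits contributes -l·(probability for independent bits) + l²; together
they give l·surplus + 2l². The shift `x` is what remains to be accumulated in the iteration. -/
theorem ev_count_le {e : ℕ} {ρ : Word C.coins} {h : List (Word P.msgLen)} {m₀ : Memory C}
    (hm₀ : Ready e m₀) (hc : m₀.solvers 2 = ⟨ρ, h⟩) (hh : h.length = e * P.rounds) {δ' : ℝ}
    (hD : pr (roundedBit (m₀.num 7) (m₀.num 8)) (fun β => β = true) = δ') {l : ℝ} (hl : |l| ≤ 1)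
    {m : Memory C} (hm : Estimating e m₀ m) (x : ℝ) :
    Always ((seq countSolved countBits).memExec g ε δ m) (Estimating e m₀) ∧
    ev ((seq countSolved countBits).memExec g ε δ m)
      (fun m' => ENNReal.ofReal (Real.exp (l * (m'.num 19 - m'.num 20) + x))) ≤
      ENNReal.ofReal (Real.exp (l * (m.num 19 - m.num 20) +
        (x + (l * C.surplus g δ' ρ e h m₀.bit + 2 * l ^ 2)))) := by
  have hr : Ready e m := hm₀.of_agree hm.agree
  have hc' : m.solvers 2 = ⟨ρ, h⟩ := by rw [hm.agree.solver 2 rfl, hc]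
  have k1 := (coupled_countSolved (g := g) (ε := ε) (δ := δ) hr hc' hh).and_always
    (always_countSolved m)
  have k2 : ∀ m₁ : Memory C, Ready e m₁ → _ := fun m₁ h1 =>
    (coupled_countBits (g := g) (ε := ε) (δ := δ) h1).and_always (always_countBits m₁)
  have weak : ∀ {S : Frame} {m m' : Memory C}, S.Agree m m' →
      (∀ j, estimateFrame.num j = true → S.num j = true) →
      (∀ j, estimateFrame.solver j = true → S.solver j = true) →
      (∀ j, estimateFrame.ans j = true → S.ans j = true) → estimateFrame.Agree m m' :=
    fun h h1 h2 h3 => ⟨fun j hj => h.num j (h1 j hj), fun j hj => h.solver j (h2 j hj),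
      fun j hj => h.ans j (h3 j hj), nofun, nofun, nofun⟩
  have w1 : ∀ {m m' : Memory C}, solvedFrame.Agree m m' → estimateFrame.Agree m m' := fun h =>
    weak h (fun j => by simp only [estimateFrame, solvedFrame, decide_eq_true_eq]; omega)
      (fun j hj => hj) fun j hj => hj
  have w2 : ∀ {m m' : Memory C}, bitsFrame.Agree m m' → estimateFrame.Agree m m' := fun h =>
    weak h (fun j => by simp only [estimateFrame, bitsFrame, decide_eq_true_eq]; omega)
      (fun j hj => rfl) fun j hj => rfl
  rw [memExec_seq]
  refine ⟨(always_of_coupled k1 fun _ m₁ h1 => (⟨w1 h1.2, h1.1.2⟩ : estimateFrame.Agree m m₁ ∧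
    ∀ j < e, m₁.bit j = m.bit j)).bind fun m₁ h1 => always_of_coupled (k2 m₁ (hr.of_agree h1.1))
      fun _ m₂ h2 => ⟨hm.agree.trans (h1.1.trans (w2 h2.2)), fun j hj => ?_⟩, ?_⟩
  · rw [h2.1.2 j hj, h1.2 j hj, hm.bits j hj]
  rw [ev_bind]
  have s2 : ∀ m₁ : Memory C, solvedFrame.Agree m m₁ → (∀ j < e, m₁.bit j = m.bit j) →
      ev (countBits.memExec g ε δ m₁)
        (fun m' => ENNReal.ofReal (Real.exp (l * (m'.num 19 - m'.num 20) + x))) ≤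
      ENNReal.ofReal (Real.exp (l * (m₁.num 19 - m.num 20) + x
        + -l * bernoulliTail g δ' e (k - e) m₀.bit + l ^ 2)) := by
    intro m₁ h1 hb
    refine (k2 m₁ (hr.of_agree h1) _ (fun b => ENNReal.ofReal (Real.exp
      (l * (m₁.num 19 - m.num 20) + x + -l * if onBits g b = true then 1 else 0)))
      fun b m₂ h2 => ?_).trans ((ev_exp_le _ _ (by rwa [abs_neg]) _).trans ?_)
    · rw [h2.2.num 19 rfl, h2.1.1, h1.num 20 rfl]
      refine ENNReal.ofReal_le_ofReal (Real.exp_le_exp.2 (le_of_eq ?_))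
      split <;> push_cast <;> ring
    · have : roundedBit (m₁.num 7) (m₁.num 8) = roundedBit (m₀.num 7) (m₀.num 8) := by
        rw [h1.num 7 rfl, h1.num 8 rfl, hm.agree.num 7 rfl, hm.agree.num 8 rfl]
      rw [this, pr_drawBits hD, bernoulliTail_congr (by omega) (b' := m₀.bit) fun j hj => by
        rw [hb j hj, hm.bits j hj]]
      refine ENNReal.ofReal_le_ofReal (Real.exp_le_exp.2 (le_of_eq ?_))
      ring
  refine (k1 _ (fun π => ENNReal.ofReal (Real.exp ((l * (m.num 19 - m.num 20) + x
      + -l * bernoulliTail g δ' e (k - e) m₀.bit + l ^ 2) +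
        l * if onBits g (C.bitsFrom ρ e h m.bit π) = true then 1 else 0))) fun π m₁ h1 => ?_).trans
    ((ev_exp_le _ _ hl _).trans ?_)
  · refine (s2 m₁ h1.2 h1.1.2).trans (ENNReal.ofReal_le_ofReal (Real.exp_le_exp.2 (le_of_eq ?_)))
    rw [h1.1.1]
    split <;> push_cast <;> ring
  · refine ENNReal.ofReal_le_ofReal (Real.exp_le_exp.2 (le_of_eq ?_))
    have : (pr (drawFrom e (k - e) fun _ _ => false) fun π =>
        onBits g (C.bitsFrom ρ e h m.bit π) = true) = C.value g ρ e h m₀.bit := value_congr hm.bits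
    rw [this, SolverCircuit.surplus]
    ring

/-- The exponential moment of the difference of the counters after an estimate. -/
theorem ev_estimate_le {e : ℕ} {ρ : Word C.coins} {h : List (Word P.msgLen)} {m : Memory C}
    (hm : Ready e m) (hc : m.solvers 2 = ⟨ρ, h⟩) (hh : h.length = e * P.rounds) {δ' : ℝ}
    (hD : pr (roundedBit (m.num 7) (m.num 8)) (fun β => β = true) = δ') {l : ℝ} (hl : |l| ≤ 1)
    {A : Memory C → Prop} (hA' : ∀ m' (a b : ℕ), A m' →
        (m'.num 18 = if a < b + m.num 15 then 1 else 0) → 0 ≤ l * ((a : ℝ) - b - m.num 15)) :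
    ev (estimate.memExec g ε δ m) (fun m' => ind (A m')) ≤
      ENNReal.ofReal (Real.exp (m.num 6 * (l * C.surplus g δ' ρ e h m.bit + 2 * l ^ 2) -
        l * m.num 15)) := by
  simp only [estimate, memExec_block_cons, memExec_op, Op.exec, PMF.pure_bind]
  set m₁ : Memory C := { m with
    num := Function.update (Function.update m.num 19 0) 20 0 } with hm₁
  have a1 : estimateFrame.Agree m m₁ := by
    refine ⟨fun j hj => ?_, fun _ _ => rfl, fun _ _ => rfl, fun _ => rfl, fun _ => rfl, fun _ => rfl⟩
    have : j ≠ 19 ∧ j ≠ 20 := by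
      simp only [estimateFrame, decide_eq_true_eq] at hj
      omega
    simp [hm₁, this]
  have r1 := hm.of_agree a1
  rw [memExec_loop, a1.num 6 rfl, ev_bind]
  -- With `t` samples to come, the potential is the present exponential moment with `t` times the
  -- exponent of one sample added, and the threshold subtracted.
  refine le_trans ?_ ((ev_repeat_le (f := (seq countSolved countBits).memExec (C := C) g ε δ)
    (I := Estimating e m₁) (Φ := fun t m' => ENNReal.ofReal (Real.exp
      (l * (m'.num 19 - m'.num 20) + (t * (l * C.surplus g δ' ρ e h m.bit + 2 * l ^ 2) -
        l * m.num 15))))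
    (fun m' hm' => (ev_count_le (g := g) r1 hc hh (by exact hD) hl hm' 0).1)
    (fun t m' hm' => (ev_count_le (g := g) r1 hc hh (by exact hD) hl hm' _).2.trans (le_of_eq ?_))
    (m.num 6) m₁ ⟨.refl _ _, fun _ _ => rfl⟩).trans (le_of_eq ?_))
  · refine ev_mono_support fun m' hm' => ?_
    have ag := (Always.repeat_inv (f := (seq countSolved countBits).memExec (C := C) g ε δ)
      (I := Estimating e m₁) (fun m' hm' => (ev_count_le (g := g) r1 hc hh (by exact hD) hl hm' 0).1)
      (m.num 6) m₁ ⟨.refl _ _, fun _ _ => rfl⟩) m' hm'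
    simp only [memExec_block_cons, memExec_op, Op.exec, PMF.pure_bind, memExec_block_nil, ev_pure]
    -- Markov's inequality for the exponential: on the event `A` the exponent is nonnegative, so the
    -- indicator is at most the exponential.
    refine ind_le fun hAm => ?_
    have := hA' _ (m'.num 19) (m'.num 20) hAm (by simp [ag.agree.num 15 rfl, a1.num 15 rfl])
    rw [ENNReal.one_le_ofReal, Real.one_le_exp_iff]
    push_cast
    linarith
  · congr 2
    push_cast
    rw [show m₁.bit = m.bit from rfl]
    ring
  · congr 2
    simp [hm₁]

/-- Chernoff's bound with l = -a/4: for N samples and margin a the linear term contributes at most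
-Na²/4, the quadratic one 2N(a/4)² = Na²/8. `ev_estimate_accept` is the mirror image with l = a/4.
-/
theorem ev_estimate_reject {e : ℕ} {ρ : Word C.coins} {h : List (Word P.msgLen)} {m : Memory C}
    (hm : Ready e m) (hc : m.solvers 2 = ⟨ρ, h⟩) (hh : h.length = e * P.rounds) {δ' : ℝ}
    (hD : pr (roundedBit (m.num 7) (m.num 8)) (fun β => β = true) = δ') {a : ℝ} (h0 : 0 ≤ a)
    (h1 : a ≤ 1) (ha : m.num 15 + m.num 6 * a ≤ m.num 6 * C.surplus g δ' ρ e h m.bit) :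
    ev (estimate.memExec g ε δ m) (fun m' => ind (m'.num 18 ≠ 0)) ≤
      ENNReal.ofReal (Real.exp (-(m.num 6 * a ^ 2 / 8))) := by
  refine (ev_estimate_le hm hc hh hD (l := -(a / 4)) ?_ ?_).trans
    (ENNReal.ofReal_le_ofReal (Real.exp_le_exp.2 ?_))
  · rw [abs_neg, abs_of_nonneg (by positivity)]
    linarith
  · intro m' x y hx hxy
    have : x < y + m.num 15 := by
      by_contra hn
      rw [if_neg hn] at hxy
      exact hx hxy
    have : (x : ℝ) < y + m.num 15 := by exact_mod_cast this
    nlinarith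
  · nlinarith

theorem ev_estimate_accept {e : ℕ} {ρ : Word C.coins} {h : List (Word P.msgLen)} {m : Memory C}
    (hm : Ready e m) (hc : m.solvers 2 = ⟨ρ, h⟩) (hh : h.length = e * P.rounds) {δ' : ℝ}
    (hD : pr (roundedBit (m.num 7) (m.num 8)) (fun β => β = true) = δ') {a : ℝ} (h0 : 0 ≤ a)
    (h1 : a ≤ 1) (ha : m.num 6 * C.surplus g δ' ρ e h m.bit + m.num 6 * a ≤ m.num 15) :
    ev (estimate.memExec g ε δ m) (fun m' => ind (m'.num 18 = 0)) ≤
      ENNReal.ofReal (Real.exp (-(m.num 6 * a ^ 2 / 8))) := by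
  refine (ev_estimate_le hm hc hh hD (l := a / 4) ?_ ?_).trans
    (ENNReal.ofReal_le_ofReal (Real.exp_le_exp.2 ?_))
  · rw [abs_of_nonneg (by positivity)]
    linarith
  · intro m' x y hx hxy
    have : ¬(x < y + m.num 15) := by
      intro hn
      rw [if_pos hn, hx] at hxy
      omega
    have : (y : ℝ) + m.num 15 ≤ x := by exact_mod_cast not_lt.1 this
    nlinarith
  · nlinarith

end Estimate

end WVP

/-! ### The search for a candidate with large surplus. -/

namespace WVP
open scoped ENNReal

theorem uniform_prod (X Y : Type) [Fintype X] [Nonempty X] [Fintype Y] [Nonempty Y] :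
    ((PMF.uniformOfFintype X).bind fun x => (PMF.uniformOfFintype Y).map fun y => (x, y)) =
      PMF.uniformOfFintype (X × Y) := by
  classical
  refine PMF.ext fun ⟨x, y⟩ => ?_
  rw [PMF.bind_apply, tsum_eq_single x, PMF.map_apply, tsum_eq_single y]
  · simp only [if_true, PMF.uniformOfFintype_apply, Fintype.card_prod, Nat.cast_mul]
    rw [ENNReal.mul_inv (by simp) (by simp)]
  · intro y' hy'
    rw [if_neg]
    exact fun h => hy' (Prod.ext_iff.1 h).2.symm
  · intro x' hx'
    rw [PMF.map_apply, ENNReal.tsum_eq_zero.2 fun y' => ?_, mul_zero]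
    exact if_neg fun h => hx' (Prod.ext_iff.1 h).1.symm

section Search

open Program

variable {P : Puzzle} {k : ℕ} {C : SolverCircuit P k} {g : Word k → Bool} {ε δ : ℝ}

theorem always_estimate_bits {e : ℕ} {ρ : Word C.coins} {h : List (Word P.msgLen)} {m : Memory C}
    (hm : Ready e m) (hc : m.solvers 2 = ⟨ρ, h⟩) (hh : h.length = e * P.rounds) :
    Always (estimate.memExec g ε δ m) fun m' => ∀ j < e, m'.bit j = m.bit j := by
  simp only [estimate, memExec_block_cons, memExec_op, Op.exec, PMF.pure_bind]
  set m₁ : Memory C := { m with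
    num := Function.update (Function.update m.num 19 0) 20 0 } with hm₁
  have r1 : Ready e m₁ := ⟨by simp [hm₁, hm.rounds], by simp [hm₁, hm.one], by simp [hm₁, hm.first],
    by simp [hm₁, hm.remaining], hm.le⟩
  refine (Always.repeat_inv (f := (seq countSolved countBits).memExec (C := C) g ε δ)
    (I := Estimating e m₁) (fun m' hm' => (ev_count_le (l := 0) (g := g) r1 hc hh rfl (by simp)
      hm' 0).1) _ m₁ ⟨.refl _ _, fun _ _ => rfl⟩).bind fun m' hm' => ?_
  simp only [memExec_block_cons, memExec_op, Op.exec, PMF.pure_bind, memExec_block_nil]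
  exact always_pure hm'.bits

/-- The cells that are left unchanged by `search`. -/
def searchFrame : Frame where
  num j := decide (j < 16 ∨ 22 < j)
  solver _ := false
  ans c := decide (c ≠ 1)
  bit := false
  posers := false
  outs := false

/-- The cells that are left unchanged by the generation of a candidate. -/
def candidateFrame : Frame where
  num j := decide (j ≠ 18)
  solver c := decide (c ≠ 2)
  ans _ := true
  bit := false
  posers := false
  outs := true

variable {Y : Type} [Fintype Y] [Nonempty Y]

/-- The state of an unsuccessful search that started in `m₀`. -/
structure Searching (e lo : ℕ) (m₀ m : Memory C) : Prop where
  agree : searchFrame.Agree m₀ m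
  found : m.num 16 = 0
  solver : m.solvers 0 = m₀.solvers 0
  bits : ∀ j < lo, m.bit j = m₀.bit j

/-- The state of a successful search that started in `m₀`. -/
structure Found (e : ℕ) (m₀ m : Memory C) : Prop where
  agree : searchFrame.Agree m₀ m
  found : m.num 16 = 1
  length : (m.solvers 0).hist.length = e * P.rounds

/-- The candidate `y` has been generated. -/
structure Candidate (e lo : ℕ) (ρ : Y → Word C.coins) (h : Y → List (Word P.msgLen))
    (b : Y → ℕ → Bool) (m : Memory C) (y : Y) (m' : Memory C) : Prop where
  agree : candidateFrame.Agree m m'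
  solver : m'.solvers 2 = ⟨ρ y, h y⟩
  bits : ∀ j < e, m'.bit j = b y j
  keep : ∀ j < lo, m'.bit j = m.bit j

/-- The program `sample` generates a random candidate. -/
structure Sampler (g : Word k → Bool) (ε δ : ℝ) (sample : Program) (e lo : ℕ)
    (ρ : Y → Word C.coins) (h : Y → List (Word P.msgLen)) (b : Y → ℕ → Bool) (m₀ : Memory C) :
    Prop where
  ready : Ready e m₀
  le : lo ≤ e
  length : ∀ y, (h y).length = e * P.rounds
  coupled : ∀ m, Searching e lo m₀ m →
    Coupled (sample.memExec g ε δ m) (PMF.uniformOfFintype Y) (Candidate e lo ρ h b m)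

/-- A search has kept a candidate with surplus at least `s`. -/
def Kept (g : Word k → Bool) (δ : ℝ) (e : ℕ) (ρ : Y → Word C.coins)
    (h : Y → List (Word P.msgLen)) (b : Y → ℕ → Bool) (s : ℝ) (m : Memory C) : Prop :=
  ∃ y, m.solvers 0 = ⟨ρ y, h y⟩ ∧ (∀ j < e, m.bit j = b y j) ∧
    s ≤ C.surplus g δ (ρ y) e (h y) (b y)

variable {sample : Program} {e lo : ℕ} {ρ : Y → Word C.coins} {h : Y → List (Word P.msgLen)}
  {b : Y → ℕ → Bool} {m₀ : Memory C}

theorem Searching.candidate {m m' : Memory C} {y : Y} (hm : Searching e lo m₀ m)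
    (hS : Sampler g ε δ sample e lo ρ h b m₀) (hy : Candidate e lo ρ h b m y m') :
    Searching e lo m₀ m' ∧ Ready e m' := by
  have h1 : searchFrame.Agree m m' := ⟨fun j hj => hy.agree.num j (by
      simp only [searchFrame, candidateFrame, decide_eq_true_eq] at hj ⊢; omega), nofun,
    fun j hj => hy.agree.ans j rfl, nofun, nofun, nofun⟩
  have h2 := hm.agree.trans h1
  exact ⟨⟨h2, by rw [hy.agree.num 16 rfl, hm.found], by rw [hy.agree.solver 0 rfl, hm.solver],
    fun j hj => by rw [hy.keep j hj, hm.bits j hj]⟩, hS.ready.of_agree h2⟩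

theorem Searching.after_estimate {m m' : Memory C} (hm : Searching e lo m₀ m)
    (h : estimateFrame.Agree m m') (hb : ∀ j < e, m'.bit j = m.bit j) (hlo : lo ≤ e) :
    Searching e lo m₀ m' := by
  have h1 : searchFrame.Agree m m' := ⟨fun j hj => h.num j (by
      simp only [searchFrame, estimateFrame, decide_eq_true_eq] at hj ⊢; omega), nofun,
    fun j hj => h.ans j hj, nofun, nofun, nofun⟩
  exact ⟨hm.agree.trans h1, by rw [h.num 16 rfl, hm.found], by rw [h.solver 0 rfl, hm.solver],
    fun j hj => by rw [hb j (by omega), hm.bits j hj]⟩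

/-- The possible results of the test of a candidate. -/
theorem Searching.always_test {m m' : Memory C} {y : Y} (hm : Searching e lo m₀ m)
    (hS : Sampler g ε δ sample e lo ρ h b m₀) (hy : Candidate e lo ρ h b m y m') :
    Always (estimate.memExec g ε δ m') fun m₁ => Searching e lo m₀ m₁ ∧
      m₁.solvers 2 = ⟨ρ y, h y⟩ ∧ ∀ j < e, m₁.bit j = b y j := by
  obtain ⟨h1, h2⟩ := hm.candidate hS hy
  refine ((always_estimate m').and (always_estimate_bits h2 hy.solver (hS.length y))).mono
    fun m₁ ⟨k1, k2⟩ => ⟨h1.after_estimate k1 k2 hS.le, by rw [k1.solver 2 rfl, hy.solver], fun j hj => ?_⟩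
  rw [k2 j hj, hy.bits j hj]

/-- The memory after the candidate has been kept. -/
def Memory.keep (m : Memory C) : Memory C :=
  { m with
    solvers := Function.update m.solvers 0 (m.solvers 2)
    num := Function.update m.num 16 1 }

theorem Searching.keep {m : Memory C} {y : Y} (hm : Searching e lo m₀ m)
    (hc : m.solvers 2 = ⟨ρ y, h y⟩) (hh : (h y).length = e * P.rounds) : Found e m₀ m.keep := by
  refine ⟨hm.agree.trans ⟨fun j hj => ?_, nofun, fun _ _ => rfl, nofun, nofun, nofun⟩,
    by simp [Memory.keep], by simp [Memory.keep, hc, hh]⟩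
  have : j ≠ 16 := by
    simp only [searchFrame, decide_eq_true_eq] at hj
    omega
  simp [Memory.keep, this]

theorem memExec_keep (m : Memory C) :
    (block [ite 18 skip (seq (op (.copyC 0 2)) (op (.const 16 1)))]).memExec g ε δ m =
      PMF.pure (if m.num 18 ≠ 0 then m else m.keep) := by
  simp only [memExec_block_cons, memExec]
  split
  · rw [PMF.pure_bind]; rfl
  · simp only [Op.exec, PMF.pure_bind]; rfl

theorem always_tryCandidate (hS : Sampler g ε δ sample e lo ρ h b m₀) {m : Memory C}
    (hm : Searching e lo m₀ m) : Always ((tryCandidate sample).memExec g ε δ m) fun m' =>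
      Searching e lo m₀ m' ∨ Found e m₀ m' := by
  rw [tryCandidate, memExec_block_cons]
  have hc := hS.coupled m hm
  refine (always_of_coupled hc (A := fun m' => ∃ y, Candidate e lo ρ h b m y m')
    fun y m' hy => ⟨y, hy⟩).bind fun m' ⟨y, hy⟩ => ?_
  rw [memExec_block_cons]
  refine (hm.always_test hS hy).bind fun m₁ ⟨h1, h2, _⟩ => ?_
  rw [memExec_keep]
  refine always_pure ?_
  split
  · exact Or.inl h1
  · exact Or.inr (h1.keep h2 (hS.length y))

open Classical in
/-- The weight of a state in a search; `x` is the weight of the states of unsuccessful searches. -/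
noncomputable def searchWeight (g : Word k → Bool) (δ : ℝ) (e : ℕ) (ρ : Y → Word C.coins)
    (h : Y → List (Word P.msgLen)) (b : Y → ℕ → Bool) (s : ℝ) (x : ℝ≥0∞) (m : Memory C) : ℝ≥0∞ :=
  if m.num 16 = 0 then x else ind (¬Kept g δ e ρ h b s m)

theorem searchWeight_le_one {s : ℝ} {x : ℝ≥0∞} (hx : x ≤ 1) (m : Memory C) :
    searchWeight g δ e ρ h b s x m ≤ 1 := by
  unfold searchWeight
  split
  · exact hx
  · exact ind_le_one _

/-- The estimates in a search that starts in `m₀` are reliable: candidates with surplus above `s'`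
are usually accepted, and candidates with surplus below `s` are usually rejected. -/
structure Reliable (g : Word k → Bool) (ε δ : ℝ) (e : ℕ) (s s' : ℝ) (γ : ℝ≥0∞) (m₀ : Memory C) :
    Prop where
  le : s ≤ s'
  reject : ∀ (m : Memory C) (ρ : Word C.coins) (h : List (Word P.msgLen)),
    searchFrame.Agree m₀ m → m.solvers 2 = ⟨ρ, h⟩ → h.length = e * P.rounds →
    s' < C.surplus g δ ρ e h m.bit →
    ev (estimate.memExec g ε δ m) (fun m' => ind (m'.num 18 ≠ 0)) ≤ γ
  accept : ∀ (m : Memory C) (ρ : Word C.coins) (h : List (Word P.msgLen)),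
    searchFrame.Agree m₀ m → m.solvers 2 = ⟨ρ, h⟩ → h.length = e * P.rounds →
    C.surplus g δ ρ e h m.bit < s →
    ev (estimate.memExec g ε δ m) (fun m' => ind (m'.num 18 = 0)) ≤ γ

/-- If the surplus is above `s'`, only a wrong rejection hurts, which has probability at most `γ`.
Between `s` and `s'` acceptance is harmless and rejection leaves the weight `x`. Below `s` a wrong
acceptance costs `γ` and rejection again leaves `x`. Thus `x` is multiplied by the probability of a
surplus not above `s'`. -/
theorem ev_tryCandidate_le (hS : Sampler g ε δ sample e lo ρ h b m₀) {s s' : ℝ} {γ : ℝ≥0∞}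
    (hR : Reliable g ε δ e s s' γ m₀) {m : Memory C} (hm : Searching e lo m₀ m) {x : ℝ≥0∞}
    (hx : x ≤ 1) :
    ev ((tryCandidate sample).memExec g ε δ m) (searchWeight g δ e ρ h b s x) ≤
      γ + ev (PMF.uniformOfFintype Y)
        (fun y => ind (¬s' < C.surplus g δ (ρ y) e (h y) (b y))) * x := by
  rw [tryCandidate, memExec_block_cons, ev_bind]
  rw [← ev_mul_right, ← ev_const (PMF.uniformOfFintype Y) γ, ← ev_add]
  refine hS.coupled m hm _ _ fun y m' hy => ?_
  rw [memExec_block_cons, ev_bind]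
  have ht := hm.always_test hS hy
  obtain ⟨h1, h2⟩ := hm.candidate hS hy
  have hs : C.surplus g δ (ρ y) e (h y) m'.bit = C.surplus g δ (ρ y) e (h y) (b y) :=
    surplus_congr hy.bits
  simp only [memExec_keep, ev_pure]
  have hk : ∀ m₁ : Memory C, Searching e lo m₀ m₁ → m₁.num 18 ≠ 0 →
      searchWeight g δ e ρ h b s x (if m₁.num 18 ≠ 0 then m₁ else m₁.keep) = x := by
    intro m₁ k1 k2
    rw [if_pos k2, searchWeight, if_pos k1.found]
  have hk' : ∀ m₁ : Memory C, m₁.num 18 = 0 → m₁.solvers 2 = ⟨ρ y, h y⟩ →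
      (∀ j < e, m₁.bit j = b y j) → s ≤ C.surplus g δ (ρ y) e (h y) (b y) →
      searchWeight g δ e ρ h b s x (if m₁.num 18 ≠ 0 then m₁ else m₁.keep) = 0 := by
    intro m₁ k1 k2 k3 k4
    rw [if_neg (by simpa using k1), searchWeight, if_neg (by simp [Memory.keep])]
    refine ind_false (not_not.2 ⟨y, by simp [Memory.keep, k2], k3, k4⟩)
  by_cases c1 : s' < C.surplus g δ (ρ y) e (h y) (b y)
  · refine le_trans ?_ (le_add_right (hR.reject m' _ _ h1.agree hy.solver (hS.length y)
      (by rwa [hs])))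
    refine ev_mono_support fun m₁ hm₁ => ?_
    obtain ⟨k1, k2, k3⟩ := ht m₁ hm₁
    by_cases c2 : m₁.num 18 = 0
    · rw [hk' m₁ c2 k2 k3 (hR.le.trans c1.le)]
      exact zero_le
    · rw [hk m₁ k1 c2, ind_true c2]
      exact hx
  rw [ind_true c1, one_mul]
  by_cases c3 : s ≤ C.surplus g δ (ρ y) e (h y) (b y)
  · refine ev_le_of_le fun m₁ hm₁ => le_add_left ?_
    obtain ⟨k1, k2, k3⟩ := ht m₁ hm₁
    by_cases c2 : m₁.num 18 = 0
    · rw [hk' m₁ c2 k2 k3 c3]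
      exact zero_le
    · rw [hk m₁ k1 c2]
  · refine le_trans (ev_mono_support fun m₁ hm₁ => ?_) (le_trans (ev_add _ _ (fun _ => x)).le
      (add_le_add (hR.accept m' _ _ h1.agree hy.solver (hS.length y) (by rw [hs]; linarith))
        (ev_const _ _).le))
    obtain ⟨k1, k2, k3⟩ := ht m₁ hm₁
    by_cases c2 : m₁.num 18 = 0
    · rw [ind_true c2]
      refine le_add_right ?_
      exact searchWeight_le_one hx _
    · rw [hk m₁ k1 c2]
      exact le_add_left le_rfl

/-- The possible results of a search. -/
theorem always_search (hS : Sampler g ε δ sample e lo ρ h b m₀) {m : Memory C}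
    (hm : m₀ = { m with num := Function.update m.num 16 0 }) :
    Always ((search sample).memExec g ε δ m) fun m' =>
      Searching e lo m₀ m' ∨ Found e m₀ m' := by
  simp only [search, memExec_seq, memExec_op, Op.exec, PMF.pure_bind]
  rw [← hm, memExec_loop]
  refine Always.repeat_inv (I := fun m' => Searching e lo m₀ m' ∨ Found e m₀ m')
    (fun m' hm' => ?_) _ _ (Or.inl ⟨.refl _ _, by simp [hm], rfl, fun _ _ => rfl⟩)
  rcases hm' with hm' | hm'
  · rw [memExec, if_neg (by simp [hm'.found])]
    exact always_tryCandidate hS hm'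
  · rw [memExec, if_pos (by simp [hm'.found])]
    exact always_pure (Or.inr hm')

/-- `κ` is the price of ending without success. One attempt turns a price x into at most γ + qx, so
tγ + κq^t is the price with `t` attempts left; a successful search no longer changes its state. The
minimum with 1 keeps the price in the range that `ev_tryCandidate_le` requires. -/
theorem ev_search_le (hS : Sampler g ε δ sample e lo ρ h b m₀) {s s' : ℝ} {γ κ : ℝ≥0∞}
    (hR : Reliable g ε δ e s s' γ m₀) {m : Memory C}
    (hm : m₀ = { m with num := Function.update m.num 16 0 }) (hκ : κ ≤ 1) :
    ev ((search sample).memExec g ε δ m) (searchWeight g δ e ρ h b s κ) ≤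
      m.num 5 * γ + κ * ev (PMF.uniformOfFintype Y)
        (fun y => ind (¬s' < C.surplus g δ (ρ y) e (h y) (b y))) ^ m.num 5 := by
  simp only [search, memExec_seq, memExec_op, Op.exec, PMF.pure_bind]
  rw [← hm, memExec_loop]
  set q := ev (PMF.uniformOfFintype Y) (fun y => ind (¬s' < C.surplus g δ (ρ y) e (h y) (b y)))
  have hq : q ≤ 1 := ev_ind_le_one _ _
  have h0 : Searching e lo m₀ m₀ := ⟨.refl _ _, by simp [hm], rfl, fun _ _ => rfl⟩
  have key := ev_repeat_le (f := (ite 16 skip (tryCandidate sample)).memExec g ε δ)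
    (I := fun m' => Searching e lo m₀ m' ∨ Found e m₀ m')
    (Φ := fun t => searchWeight g δ e ρ h b s (min 1 (t * γ + κ * q ^ t))) (fun m' hm' => by
      rcases hm' with hm' | hm'
      · rw [memExec, if_neg (by simp [hm'.found])]
        exact always_tryCandidate hS hm'
      · rw [memExec, if_pos (by simp [hm'.found])]
        exact always_pure (Or.inr hm')) (fun t m' hm' => by
      rcases hm' with hm' | hm'
      · rw [memExec, if_neg (by simp [hm'.found])]
        rw [show searchWeight g δ e ρ h b s (min 1 ((t + 1 : ℕ) * γ + κ * q ^ (t + 1))) m' =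
          min 1 ((t + 1 : ℕ) * γ + κ * q ^ (t + 1)) by rw [searchWeight, if_pos hm'.found]]
        refine le_min (ev_le_of_le fun _ _ => searchWeight_le_one (min_le_left _ _) _)
          ((ev_tryCandidate_le hS hR hm' (min_le_left _ _)).trans ?_)
        calc γ + q * min 1 (t * γ + κ * q ^ t) ≤ γ + q * (t * γ + κ * q ^ t) := by
              gcongr
              exact min_le_right _ _
          _ = γ + q * (t * γ) + κ * q ^ (t + 1) := by rw [mul_add, ← add_assoc, pow_succ]; ring
          _ ≤ γ + 1 * (t * γ) + κ * q ^ (t + 1) := by gcongr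
          _ = _ := by push_cast; ring
      · rw [memExec, if_pos (by simp [hm'.found]), memExec, ev_pure]
        simp [searchWeight, hm'.found]) (m₀.num 5) m₀ (Or.inl h0)
  have e1 : min 1 (((0 : ℕ) : ℝ≥0∞) * γ + κ * q ^ 0) = κ := by simp [hκ]
  rw [e1] at key
  refine key.trans ?_
  rw [searchWeight, if_pos h0.found, show m₀.num 5 = m.num 5 by simp [hm]]
  exact min_le_right _ _

/-- The desired result of a search. -/
def SearchResult (g : Word k → Bool) (δ : ℝ) (e lo : ℕ) (ρ : Y → Word C.coins)
    (h : Y → List (Word P.msgLen)) (b : Y → ℕ → Bool) (s s' β : ℝ) (m₀ m : Memory C) : Prop :=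
  (Searching e lo m₀ m ∧ pr (PMF.uniformOfFintype Y)
    (fun y => s' < C.surplus g δ (ρ y) e (h y) (b y)) < β) ∨
  (Found e m₀ m ∧ Kept g δ e ρ h b s m)

/-- If candidates with surplus above `s'` have probability below `β`, ending without success is a
desired result and κ = 0 applies. Otherwise a missed success has to be paid for: κ = 1, and an
attempt misses with probability at most 1 - β apart from errors of the estimates. -/
theorem ev_searchResult_le (hS : Sampler g ε δ sample e lo ρ h b m₀) {s s' β : ℝ} {γ : ℝ≥0∞}
    (hR : Reliable g ε δ e s s' γ m₀) {m : Memory C}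
    (hm : m₀ = { m with num := Function.update m.num 16 0 }) :
    ev ((search sample).memExec g ε δ m)
      (fun m' => ind (¬SearchResult g δ e lo ρ h b s s' β m₀ m')) ≤
      m.num 5 * γ + ENNReal.ofReal (1 - β) ^ m.num 5 := by
  have h1 := always_search hS hm
  by_cases c : pr (PMF.uniformOfFintype Y) (fun y => s' < C.surplus g δ (ρ y) e (h y) (b y)) < β
  · refine (ev_mono_support fun m' hm' => ?_).trans ((ev_search_le hS hR hm (zero_le_one)).trans ?_)
    · rcases h1 m' hm' with h2 | h2
      · rw [ind_false fun hn => hn (Or.inl ⟨h2, c⟩)]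
        exact zero_le
      · rw [searchWeight, if_neg (by simp [h2.found])]
        exact ind_mono fun hn hk => hn (Or.inr ⟨h2, hk⟩)
    · rw [zero_mul, add_zero]
      exact le_self_add
  · refine (ev_mono_support fun m' hm' => ?_).trans ((ev_search_le hS hR hm le_rfl).trans ?_)
    · rcases h1 m' hm' with h2 | h2
      · rw [searchWeight, if_pos h2.found]
        exact ind_le_one _
      · rw [searchWeight, if_neg (by simp [h2.found])]
        exact ind_mono fun hn hk => hn (Or.inr ⟨h2, hk⟩)
    · rw [one_mul, ← ofReal_pr, pr_not]
      gcongr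
      exact not_lt.1 c

end Search

end WVP

/-! ### Samplers, choice of the parameters, and the averaging over the random bits of the solver. -/

namespace WVP
open scoped ENNReal

section Stages

open Program

variable {P : Puzzle} {k : ℕ} {C : SolverCircuit P k} {g : Word k → Bool} {ε δ : ℝ} {n K : ℕ}

/-! ## The samplers of the two kinds of searches -/

theorem sampler_start {m₀ : Memory C} (hm : Ready 0 m₀) : Sampler g ε δ sampleStart 0 0
    (fun ρ : Word C.coins => ρ) (fun _ => []) (fun _ _ => false) m₀ where
  ready := hm
  le := le_rfl
  length _ := by simp
  coupled m _ := by
    have fr : Always (sampleStart.memExec g ε δ m) (candidateFrame.Agree m) :=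
      Frame.always _ (by rfl) m
    refine Coupled.mono (Coupled.and_always (coupled_uniform_map (Word C.coins) _) fr)
      fun ρ m' ⟨h1, h2⟩ => ⟨h2, by simp [h1], fun _ hj => absurd hj (Nat.not_lt_zero _),
        fun _ hj => absurd hj (Nat.not_lt_zero _)⟩

/-- The cells that are left unchanged by `playInstance`. -/
def instanceFrame : Frame where
  num _ := true
  solver _ := false
  ans _ := true
  bit := true
  posers := false
  outs := true

/-- The guessed bit is an independent fair coin, not the result of a check: surpluses are defined
for arbitrary assumed bits. Rejected candidates overwrite the bits from `st` on, so only those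
before `st` are preserved during the search. -/
theorem sampler_instance {m₀ : Memory C} {st : ℕ} {ρ : Word C.coins} {h : List (Word P.msgLen)}
    (hm : Ready (st + 1) m₀) (h13 : m₀.num 13 = st) (hs : m₀.solvers 0 = ⟨ρ, h⟩)
    (hh : h.length = st * P.rounds) : Sampler g ε δ sampleInstance (st + 1) st
    (fun _ : Word P.coins × Bool => ρ) (fun y => (C.play ρ y.1 h P.rounds).1)
    (fun y => Function.update m₀.bit st y.2) m₀ where
  ready := hm
  le := Nat.le_succ _
  length y := by rw [SolverCircuit.play_length, hh]; ring
  coupled m hS := by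
    have fr : Always (sampleInstance.memExec g ε δ m) (candidateFrame.Agree m) :=
      Frame.always _ (by rfl) m
    suffices H : Coupled (sampleInstance.memExec g ε δ m)
        (PMF.uniformOfFintype (Word P.coins × Bool)) fun y m' =>
        m'.solvers 2 = ⟨ρ, (C.play ρ y.1 h P.rounds).1⟩ ∧
        m'.bit = Function.update m.bit st y.2 by
      refine (H.and_always fr).mono fun y m' ⟨⟨h1, h2⟩, h3⟩ => ⟨h3, h1, fun j hj => ?_, fun j hj => ?_⟩
      · rw [h2]
        by_cases e : j = st
        · simp [e]
        · rw [Function.update_of_ne e, Function.update_of_ne e, hS.bits j (by omega)]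
      · rw [h2, Function.update_of_ne (by omega)]
    have e13 : m.num 13 = st := by rw [hS.agree.num 13 rfl, h13]
    simp only [sampleInstance, memExec_block_cons, memExec_op, Op.exec, PMF.pure_bind]
    rw [← uniform_prod]
    refine (coupled_uniform_map (Word P.coins) _).bind fun x m₁ hm₁ => ?_
    rw [memExec_block_cons]
    have hc : m₁.solvers 2 = ⟨ρ, h⟩ := by
      rw [hm₁]
      simp [hS.solver, hs]
    refine (always_playInstance (ρ := ρ) (h := h) (x := x) ?_ hc ?_ ?_).and
      (Frame.always instanceFrame (by rfl) m₁) |>.bind_coupled fun m₂ hm₂ => ?_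
    · rw [hm₁]
      simp [hS.agree.num 2 rfl, hm.rounds]
    · rw [hm₁]
      simp
    · rw [hh, ← add_one_mul]
      exact Nat.mul_le_mul_right _ hm.le
    · simp only [memExec_block_cons, memExec_op, Op.exec]
      refine coupled_map_right ((coupled_uniform_map Bool _).bind_left fun β m₃ hm₃ => ?_)
      simp only [memExec_block_cons, memExec_op, Op.exec, PMF.pure_bind, memExec_block_nil]
      refine always_pure ⟨?_, ?_⟩
      · rw [hm₃]
        exact hm₂.1.2.1
      · rw [hm₃]
        simp only [ne_eq, Nat.reduceEqDiff, not_false_eq_true, Function.update_of_ne,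
          Function.update_self, hm₂.1.1, hm₂.2.bit rfl]
        rw [hm₁]
        simp [e13]

/-! ## The parameters -/

/-- The number of samples per unit of the threshold. -/
def sampleScale (k n K : ℕ) : ℕ := 1024 * (k * K) * (n + 4 * (k * K))

/-- The registers that hold the parameters have their proper values. -/
structure Params (δ : ℝ) (n K : ℕ) (m : Memory C) : Prop where
  r0 : m.num 0 = k
  r2 : m.num 2 = P.rounds
  r4 : m.num 4 = 1
  r5 : m.num 5 = 16 * (k * K) * (n + k)
  r6 : m.num 6 = 8 * sampleScale k n K * (k * K)
  r7 : m.num 7 = 64 * (k * K) * k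
  r8 : m.num 8 = ⌊(2 : ℝ) ^ (64 * (k * K) * k) * δ⌋₊
  r9 : m.num 9 = k - 1
  r10 : m.num 10 = 5 * (k * K)
  r11 : m.num 11 = 8 * sampleScale k n K
  r25 : m.num 25 = 0

theorem Params.of_eq {m m' : Memory C} (hm : Params δ n K m)
    (h : ∀ j, j ≤ 11 ∨ j = 25 → m'.num j = m.num j) : Params δ n K m' := by
  obtain ⟨h0, h2, h4, h5, h6, h7, h8, h9, h10, h11, h25⟩ := hm
  constructor <;> (rw [h _ (by norm_num)]; assumption)

/-- With t = 64k²K binary digits the rounding error is at most 2^(-t) ≤ 1/t, which is crude but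
enough even after multiplication by the number k of bits. -/
theorem abs_sub_rounded_le (h0 : 0 ≤ δ) (h1 : δ ≤ 1) (hk : 1 ≤ k) (hK : 1 ≤ K) :
    0 ≤ (⌊(2 : ℝ) ^ (64 * (k * K) * k) * δ⌋₊ : ℝ) / 2 ^ (64 * (k * K) * k) ∧
    (⌊(2 : ℝ) ^ (64 * (k * K) * k) * δ⌋₊ : ℝ) / 2 ^ (64 * (k * K) * k) ≤ 1 ∧
    ⌊(2 : ℝ) ^ (64 * (k * K) * k) * δ⌋₊ ≤ 2 ^ (64 * (k * K) * k) ∧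
    k * |δ - (⌊(2 : ℝ) ^ (64 * (k * K) * k) * δ⌋₊ : ℝ) / 2 ^ (64 * (k * K) * k)| ≤
      1 / (64 * (k * K)) := by
  set t := 64 * (k * K) * k with ht
  have hp : (0 : ℝ) < 2 ^ t := by positivity
  have f1 := Nat.floor_le (a := (2 : ℝ) ^ t * δ) (by positivity)
  have f2 := Nat.lt_floor_add_one ((2 : ℝ) ^ t * δ)
  set D := ⌊(2 : ℝ) ^ t * δ⌋₊
  have f3 : (D : ℝ) ≤ 2 ^ t := f1.trans (mul_le_of_le_one_right hp.le h1)
  have e1 : (D : ℝ) / 2 ^ t ≤ δ := by rw [div_le_iff₀ hp]; linarith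
  have e2 : δ - D / 2 ^ t ≤ 1 / 2 ^ t := by
    rw [sub_le_iff_le_add, ← add_div, le_div_iff₀ hp]; linarith
  refine ⟨by positivity, by rw [div_le_one hp]; exact f3, by exact_mod_cast f3, ?_⟩
  rw [abs_of_nonneg (by linarith)]
  have hk' : (1 : ℝ) ≤ k := by exact_mod_cast hk
  have hK' : (1 : ℝ) ≤ K := by exact_mod_cast hK
  have ht2 : (t : ℝ) ≤ 2 ^ t := by exact_mod_cast Nat.lt_two_pow_self.le
  have ht3 : (t : ℝ) = 64 * (k * K) * k := by rw [ht]; push_cast; ring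
  have e3 : (1 : ℝ) / 2 ^ t ≤ 1 / (64 * (k * K) * k) := by
    rw [← ht3]
    exact one_div_le_one_div_of_le (by rw [ht3]; positivity) ht2
  calc (k : ℝ) * (δ - D / 2 ^ t) ≤ k * (1 / (64 * (k * K) * k)) := by gcongr; linarith
    _ = _ := by field_simp

/-- The failure probability of an estimate. -/
noncomputable def failure (k n K : ℕ) : ℝ≥0∞ :=
  ENNReal.ofReal (Real.exp (-((n : ℝ) + 4 * (k * K))))

/-- Let z = kK. The threshold corresponds to the surplus (k - e - 1/8)/z, at distance 1/(16z) from
both limits. Of this distance 1/(64z) is reserved for the rounding of δ (`hsur`), and a = 1/(32z) is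
used as the margin of the Chernoff bound. With 8·1024z²(n + 4z) samples its exponent is exactly -(n
+ 4z). -/
theorem reliable_of_params (hk : 1 ≤ k) (hK : 1 ≤ K) (h0 : 0 ≤ δ) (h1 : δ ≤ 1) {m₀ : Memory C}
    (hm : Params δ n K m₀) {e : ℕ} (hr : Ready e m₀) (he : e < k)
    (h15 : m₀.num 15 = 8 * sampleScale k n K * (k - e) - sampleScale k n K) :
    Reliable g ε δ e ((((k - e : ℕ) : ℝ) - 3 / 16) / (k * K)) ((((k - e : ℕ) : ℝ) - 1 / 16) / (k * K))
      (failure k n K) m₀ := by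
  obtain ⟨d0, d1, d2, d3⟩ := abs_sub_rounded_le h0 h1 hk hK
  have hk' : (1 : ℝ) ≤ k := by exact_mod_cast hk
  have hK' : (1 : ℝ) ≤ K := by exact_mod_cast hK
  have hz : (1 : ℝ) ≤ (k : ℝ) * K := one_le_mul_of_one_le_of_one_le hk' hK'
  set z : ℝ := (k : ℝ) * K with hz'
  set δ' := (⌊(2 : ℝ) ^ (64 * (k * K) * k) * δ⌋₊ : ℝ) / 2 ^ (64 * (k * K) * k) with hδ'
  have hsur : ∀ (ρ : Word C.coins) (h : List (Word P.msgLen)) (b : ℕ → Bool),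
      |C.surplus g δ ρ e h b - C.surplus g δ' ρ e h b| ≤ 1 / (64 * z) := by
    intro ρ h b
    have := bernoulliTail_lipschitz (g := g) h0 h1 d0 d1 e (k - e) b
    unfold SolverCircuit.surplus
    rw [sub_sub_sub_cancel_left, abs_sub_comm]
    refine (this.trans ?_).trans d3
    gcongr
    exact Nat.sub_le _ _
  have hprm : ∀ {m : Memory C}, searchFrame.Agree m₀ m → Ready e m ∧
      pr (roundedBit (m.num 7) (m.num 8)) (fun β => β = true) = δ' ∧
      (m.num 6 : ℝ) = 8 * sampleScale k n K * z ∧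
      (m.num 15 : ℝ) = sampleScale k n K * (8 * (k - e : ℕ) - 1) := by
    intro m ha
    refine ⟨hr.of_agree ha, ?_, ?_, ?_⟩
    · rw [ha.num 7 rfl, ha.num 8 rfl, hm.r7, hm.r8, pr_roundedBit d2]
    · rw [ha.num 6 rfl, hm.r6]; push_cast; rw [hz']
    · rw [ha.num 15 rfl, h15, Nat.cast_sub]
      · push_cast; ring
      · have : 1 ≤ k - e := by omega
        nlinarith [Nat.zero_le (sampleScale k n K)]
  have hsc : (sampleScale k n K : ℝ) = 1024 * z * (n + 4 * z) := by
    rw [sampleScale, hz']; push_cast; ring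
  have hsc0 : (0 : ℝ) ≤ sampleScale k n K := Nat.cast_nonneg _
  have hγ : ENNReal.ofReal (Real.exp (-(8 * sampleScale k n K * z * (1 / (32 * z)) ^ 2 / 8))) =
      failure k n K := by
    rw [failure, hsc, ← hz']
    congr 3
    field_simp
    norm_num
  have a0 : (0 : ℝ) ≤ 1 / (32 * z) := by positivity
  have a1 : 1 / (32 * z) ≤ 1 := by
    rw [div_le_one (by positivity)]; linarith
  have hTa : 8 * (sampleScale k n K : ℝ) * z * (1 / (32 * z)) = sampleScale k n K / 4 := by
    field_simp; ring
  have hTe : 8 * (sampleScale k n K : ℝ) * z * (1 / (64 * z)) = sampleScale k n K / 8 := by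
    field_simp; ring
  have hT0 : 0 ≤ 8 * (sampleScale k n K : ℝ) * z := by positivity
  refine ⟨?_, fun m ρ h ha hc hh hS => ?_, fun m ρ h ha hc hh hS => ?_⟩
  · gcongr; norm_num
  · obtain ⟨p1, p2, p3, p4⟩ := hprm ha
    have hs := abs_le.1 (hsur ρ h m.bit)
    refine (ev_estimate_reject p1 hc hh p2 a0 a1 ?_).trans (le_of_eq ?_)
    · rw [p3, p4, hTa]
      have e1 : 8 * (sampleScale k n K : ℝ) * z * ((((k - e : ℕ) : ℝ) - 1 / 16) / z - 1 / (64 * z)) ≤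
          8 * (sampleScale k n K : ℝ) * z * C.surplus g δ' ρ e h m.bit :=
        mul_le_mul_of_nonneg_left (by linarith) hT0
      have e2 : 8 * (sampleScale k n K : ℝ) * z * ((((k - e : ℕ) : ℝ) - 1 / 16) / z) =
          8 * sampleScale k n K * (((k - e : ℕ) : ℝ) - 1 / 16) := by field_simp
      rw [mul_sub, hTe, e2] at e1
      nlinarith
    · rw [p3, hγ]
  · obtain ⟨p1, p2, p3, p4⟩ := hprm ha
    have hs := abs_le.1 (hsur ρ h m.bit)
    refine (ev_estimate_accept p1 hc hh p2 a0 a1 ?_).trans (le_of_eq ?_)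
    · rw [p3, p4, hTa]
      have e1 : 8 * (sampleScale k n K : ℝ) * z * C.surplus g δ' ρ e h m.bit ≤
          8 * (sampleScale k n K : ℝ) * z * ((((k - e : ℕ) : ℝ) - 3 / 16) / z + 1 / (64 * z)) :=
        mul_le_mul_of_nonneg_left (by linarith) hT0
      have e2 : 8 * (sampleScale k n K : ℝ) * z * ((((k - e : ℕ) : ℝ) - 3 / 16) / z) =
          8 * sampleScale k n K * (((k - e : ℕ) : ℝ) - 3 / 16) := by field_simp
      rw [mul_add, hTe, e2] at e1
      nlinarith
    · rw [p3, hγ]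

/-! ## The first search -/

theorem successProb_eq (b : ℕ → Bool) : C.successProb g =
    (∑ ρ : Word C.coins, C.value g ρ 0 [] b) / Fintype.card (Word C.coins) := by
  have e1 : C.successProb g = pr (PMF.uniformOfFintype (Word C.coins × (Fin k → Word P.coins)))
      fun ω => g (C.solved ω.1 ω.2) = true := by
    rw [SolverCircuit.successProb, prob_eq]; rfl
  rw [e1, ← uniform_prod, pr_bind_uniform]
  congr 1
  refine Finset.sum_congr rfl fun ρ _ => ?_
  rw [pr_map, ← drawFrom_map_uniform k fun _ _ => false, pr_map, SolverCircuit.value, Nat.sub_zero]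
  refine pr_congr fun π _ => ?_
  have : C.solved ρ (fun j => π j) = fun j : Fin k => C.bitsFrom ρ 0 [] b π j :=
    funext fun j => SolverCircuit.solved_eq π b j
  simp only [this]
  rfl

theorem surplus_le_one (h0 : 0 ≤ δ) (h1 : δ ≤ 1) (ρ : Word C.coins) (e : ℕ)
    (h : List (Word P.msgLen)) (b : ℕ → Bool) : C.surplus g δ ρ e h b ≤ 1 := by
  have := (bernoulliTail_mem (g := g) h0 h1 e (k - e) b).1
  have := pr_le_one (drawFrom e (k - e) fun _ _ => false)
    fun π => onBits g (C.bitsFrom ρ e h b π) = true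
  unfold SolverCircuit.surplus SolverCircuit.value
  linarith

/-- The mean surplus is at least 1/K = (k - 1/16)/(kK) + 1/(16kK). Since surpluses are at most 1,
the first summand must be exceeded with probability at least the second. -/
theorem le_pr_start (hk : 1 ≤ k) (hK : 1 ≤ K) (h0 : 0 ≤ δ) (h1 : δ ≤ 1)
    (hC : bernoulliProb k δ g + 1 / K ≤ C.successProb g) (b : ℕ → Bool) :
    1 / (16 * (k * K)) ≤ pr (PMF.uniformOfFintype (Word C.coins))
      fun ρ => ((k : ℝ) - 1 / 16) / (k * K) < C.surplus g δ ρ 0 [] b := by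
  classical
  have hk' : (1 : ℝ) ≤ k := by exact_mod_cast hk
  have hK' : (1 : ℝ) ≤ K := by exact_mod_cast hK
  have hc : (0 : ℝ) < Fintype.card (Word C.coins) := by exact_mod_cast Fintype.card_pos
  rw [pr_uniform, le_div_iff₀ hc]
  rw [successProb_eq b, bernoulliProb_eq b, le_div_iff₀ hc] at hC
  have e1 : ∀ ρ : Word C.coins, C.value g ρ 0 [] b ≤ bernoulliTail g δ 0 k b +
      ((k : ℝ) - 1 / 16) / (k * K) +
      if ((k : ℝ) - 1 / 16) / (k * K) < C.surplus g δ ρ 0 [] b then 1 else 0 := by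
    intro ρ
    have hp : 0 ≤ ((k : ℝ) - 1 / 16) / (k * K) := div_nonneg (by linarith) (by positivity)
    have hs : C.surplus g δ ρ 0 [] b = C.value g ρ 0 [] b - bernoulliTail g δ 0 k b := rfl
    have := surplus_le_one (g := g) h0 h1 ρ 0 [] b
    split
    · linarith
    · linarith
  have e2 := Finset.sum_le_sum fun ρ (_ : ρ ∈ Finset.univ) => e1 ρ
  rw [Finset.sum_add_distrib, Finset.sum_const, Finset.card_univ, nsmul_eq_mul] at e2
  have e3 : (1 : ℝ) / K = ((k : ℝ) - 1 / 16) / (k * K) + 1 / (16 * (k * K)) := by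
    field_simp; ring
  rw [e3] at hC
  nlinarith

end Stages

end WVP

/-! ### Fixing the random bits and the instances, down to a stage where the surplus must drop. -/

namespace WVP
open scoped ENNReal

/-- The union bound for two consecutive phases. -/
theorem ev_ind_bind_le {α β : Type} {p : PMF α} {q : α → PMF β} {A : α → Prop} {B : β → Prop}
    {x y : ℝ≥0∞} (h : ev p (fun a => ind (¬A a)) ≤ x)
    (h' : ∀ a, A a → ev (q a) (fun b => ind (¬B b)) ≤ y) :
    ev (p.bind q) (fun b => ind (¬B b)) ≤ x + y := by
  rw [ev_bind]
  refine (ev_mono (f' := fun a => ind (¬A a) + y) fun a => ?_).trans ?_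
  · by_cases ha : A a
    · exact (h' a ha).trans le_add_self
    · rw [ind_true ha]
      exact (ev_ind_le_one _ _).trans le_self_add
  · rw [ev_add, ev_const]
    gcongr

theorem ev_ind_repeat_le {α : Type} {f : α → PMF α} {I : ℕ → α → Prop} {x : ℝ≥0∞}
    (h : ∀ j a, I j a → ev (f a) (fun a' => ind (¬I (j + 1) a')) ≤ x) (t j : ℕ) (a : α)
    (ha : I j a) : ev (repeatPMF f t a) (fun a' => ind (¬I (j + t) a')) ≤ t * x := by
  induction t generalizing j a with
  | zero => rw [repeatPMF, ev_pure, ind_false (fun h => h ha)]; exact zero_le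
  | succ t ih =>
    rw [repeatPMF_succ]
    refine (ev_ind_bind_le (y := t * x) (h j a ha) fun a' ha' => ?_).trans (le_of_eq ?_)
    · have := ih (j + 1) a' ha'
      rwa [show j + 1 + t = j + (t + 1) by omega] at this
    · push_cast; ring

section Stages

open Program

variable {P : Puzzle} {k : ℕ} {C : SolverCircuit P k} {g : Word k → Bool} {ε δ : ℝ} {n K : ℕ}

/-! ## Fixing the instances -/

/-- The random bits of `C` and the first `st` instances have been fixed. -/
structure AtStage (δ : ℝ) (n K st : ℕ) (m : Memory C) : Prop where
  params : Params δ n K m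
  stage : m.num 13 = st
  lt : st < k
  length : (m.solvers 0).hist.length = st * P.rounds
  threshold : m.num 15 = 8 * sampleScale k n K * (k - (st + 1)) - sampleScale k n K

/-- The surplus after fixing `st` instances is large enough. -/
def Advantage (g : Word k → Bool) (δ : ℝ) (K st : ℕ) (m : Memory C) : Prop :=
  (((k - st : ℕ) : ℝ) - 3 / 16) / (k * K) ≤
    C.surplus g δ (m.solvers 0).coins st (m.solvers 0).hist m.bit

/-- The surplus is rarely large after fixing one more instance. -/
def Terminal (g : Word k → Bool) (δ : ℝ) (K st : ℕ) (m : Memory C) : Prop :=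
  pr (PMF.uniformOfFintype (Word P.coins × Bool)) (fun y => ((k - (st + 1) : ℕ) : ℝ) / (k * K) <
    C.surplus g δ (m.solvers 0).coins (st + 1)
      (C.play (m.solvers 0).coins y.1 (m.solvers 0).hist P.rounds).1
      (Function.update m.bit st y.2)) < 1 / (16 * (k * K))

theorem AtStage.of_eq {st : ℕ} {m m' : Memory C} (hm : AtStage δ n K st m)
    (h : ∀ j, j ≤ 11 ∨ j = 25 ∨ j = 13 ∨ j = 15 → m'.num j = m.num j)
    (hs : m'.solvers 0 = m.solvers 0) : AtStage δ n K st m' :=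
  ⟨hm.params.of_eq fun j hj => h j (by omega), by rw [h 13 (by omega), hm.stage], hm.lt,
    by rw [hs, hm.length], by rw [h 15 (by omega), hm.threshold]⟩

theorem Advantage.of_eq {st : ℕ} {m m' : Memory C} (hm : Advantage g δ K st m)
    (hs : m'.solvers 0 = m.solvers 0) (hb : ∀ j < st, m'.bit j = m.bit j) :
    Advantage g δ K st m' := by
  unfold Advantage
  rw [hs, surplus_congr hb]
  exact hm

theorem Terminal.of_eq {st : ℕ} {m m' : Memory C} (hm : Terminal g δ K st m)
    (hs : m'.solvers 0 = m.solvers 0) (hb : ∀ j < st, m'.bit j = m.bit j) :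
    Terminal g δ K st m' := by
  unfold Terminal at hm ⊢
  rw [hs]
  refine (pr_congr fun y _ => ?_).trans_lt hm
  rw [surplus_congr (b' := Function.update m.bit st y.2)]
  intro j hj
  by_cases e : j = st
  · simp [e]
  · rw [Function.update_of_ne e, Function.update_of_ne e, hb j (by omega)]

/-- The memory at the beginning of the search for the next instance. -/
def Memory.next (m : Memory C) : Memory C :=
  { m with
    num := Function.update (Function.update m.num 14 (m.num 13 + m.num 4)) 12
      (m.num 0 - (m.num 13 + m.num 4)) }

/-- The start of a search. -/
def Memory.clear (m : Memory C) : Memory C := { m with num := Function.update m.num 16 0 }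

/-- The memory after the search for the next instance. -/
def Memory.advanced (m : Memory C) : Memory C :=
  if m.num 16 ≠ 0 then
    { m with
      num := Function.update (Function.update m.num 13 (m.num 13 + m.num 4)) 15
        (m.num 15 - m.num 11) }
  else m

theorem memExec_advance (m : Memory C) : advance.memExec g ε δ m =
    ((search sampleInstance).memExec g ε δ m.next).map Memory.advanced := by
  simp only [advance, memExec_block_cons, memExec_op, Op.exec, PMF.pure_bind]
  rw [← PMF.bind_pure_comp]
  congr 1
  funext m'
  simp only [memExec_block_cons, memExec, Op.exec, PMF.pure_bind, Function.comp, Memory.advanced]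
  split
  · rw [PMF.pure_bind]; rfl
  · rw [PMF.pure_bind]; rfl

variable {st : ℕ} {m : Memory C}

theorem AtStage.ready_next (hm : AtStage δ n K st m) : Ready (st + 1) m.next :=
  ⟨by simp [Memory.next, hm.params.r2], by simp [Memory.next, hm.params.r4],
    by simp [Memory.next, hm.params.r4, hm.stage],
    by simp [Memory.next, hm.params.r4, hm.params.r0, hm.stage], hm.lt⟩

theorem Ready.clear {e : ℕ} (hm : Ready e m) : Ready e m.clear :=
  ⟨by simp [Memory.clear, hm.rounds], by simp [Memory.clear, hm.one],
    by simp [Memory.clear, hm.first], by simp [Memory.clear, hm.remaining], hm.le⟩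

theorem AtStage.next_clear (hm : AtStage δ n K st m) : AtStage δ n K st m.next.clear :=
  hm.of_eq (fun j hj => by
    have : j ≠ 14 ∧ j ≠ 12 ∧ j ≠ 16 := by omega
    simp [Memory.next, Memory.clear, this]) rfl

theorem AtStage.sampler (hm : AtStage δ n K st m) : Sampler g ε δ sampleInstance (st + 1) st
    (fun _ : Word P.coins × Bool => (m.solvers 0).coins)
    (fun y => (C.play (m.solvers 0).coins y.1 (m.solvers 0).hist P.rounds).1)
    (fun y => Function.update m.bit st y.2) m.next.clear :=
  sampler_instance (m₀ := m.next.clear) hm.ready_next.clear hm.next_clear.stage rfl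
    hm.length

theorem AtStage.of_searching (hm : AtStage δ n K st m) {m' : Memory C}
    (h : Searching (st + 1) st m.next.clear m') : AtStage δ n K st m'.advanced ∧
      m'.advanced.num 16 = 0 ∧ m'.advanced.solvers 0 = m.solvers 0 ∧
      ∀ j < st, m'.advanced.bit j = m.bit j := by
  rw [Memory.advanced, if_neg (by simp [h.found])]
  exact ⟨hm.next_clear.of_eq (fun j hj => h.agree.num j (by
    simp only [searchFrame, decide_eq_true_eq]; omega)) h.solver, h.found, h.solver, h.bits⟩

theorem AtStage.of_found (hm : AtStage δ n K st m) (hst : st + 1 < k) {m' : Memory C}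
    (h : Found (st + 1) m.next.clear m') : AtStage δ n K (st + 1) m'.advanced ∧
      m'.advanced.num 16 = 1 ∧ m'.advanced.solvers 0 = m'.solvers 0 ∧
      m'.advanced.bit = m'.bit := by
  have hn : ∀ j, j ≤ 11 ∨ j = 25 ∨ j = 13 ∨ j = 15 → m'.num j = m.next.clear.num j :=
    fun j hj => h.agree.num j (by simp only [searchFrame, decide_eq_true_eq]; omega)
  have hc := hm.next_clear
  rw [Memory.advanced, if_pos (by simp [h.found])]
  refine ⟨⟨hc.params.of_eq fun j hj => ?_, ?_, hst, h.length, ?_⟩, ?_, rfl, rfl⟩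
  · have : j ≠ 13 ∧ j ≠ 15 := by omega
    simp [this, hn j (by omega)]
  · simp [hn, hc.stage, hc.params.r4]
  · simp only [Function.update_self, hn 15 (by omega), hn 11 (by omega), hc.threshold,
      hc.params.r11]
    -- Truncated subtraction is harmless: lowering the threshold by 8 times the sample scale gives
    -- the right value also at the last stage, where both sides become 0.
    rw [show k - (st + 1) = (k - (st + 1 + 1)) + 1 by omega, mul_add, mul_one]
    omega
  · simp [h.found]

theorem always_advance (hm : AtStage δ n K st m) (hst : st + 1 < k) :
    Always (advance.memExec g ε δ m) fun m' => (m'.num 16 = 0 ∧ AtStage δ n K st m') ∨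
      (m'.num 16 = 1 ∧ AtStage δ n K (st + 1) m') := by
  rw [memExec_advance]
  refine (always_search hm.sampler (m := m.next) rfl).map fun m' hm' => ?_
  rcases hm' with h | h
  · obtain ⟨h1, h2, _⟩ := hm.of_searching h
    exact Or.inl ⟨h2, h1⟩
  · obtain ⟨h1, h2, _⟩ := hm.of_found hst h
    exact Or.inr ⟨h2, h1⟩

/-- A bound for the failure probability of a search. -/
noncomputable def searchFailure (k n K : ℕ) : ℝ≥0∞ :=
  (16 * (k * K) * (n + k) : ℕ) * failure k n K +
    ENNReal.ofReal (1 - 1 / (16 * (k * K))) ^ (16 * (k * K) * (n + k))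

/-- A successful search gives `Advantage` at the next stage. An unsuccessful one gives `Terminal` at
the present stage, since the surpluses it certifies to be rare begin 1/(16kK) below the bound in
`Terminal`; the old advantage survives because copy 0 and the earlier bits are untouched. -/
theorem ev_advance_le (hk : 1 ≤ k) (hK : 1 ≤ K) (h0 : 0 ≤ δ) (h1 : δ ≤ 1)
    (hm : AtStage δ n K st m) (hst : st + 1 < k) (ha : Advantage g δ K st m) :
    ev (advance.memExec g ε δ m) (fun m' => ind (¬(
      (m'.num 16 = 0 ∧ AtStage δ n K st m' ∧ Advantage g δ K st m' ∧ Terminal g δ K st m') ∨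
      (m'.num 16 = 1 ∧ AtStage δ n K (st + 1) m' ∧ Advantage g δ K (st + 1) m')))) ≤
      searchFailure k n K := by
  have hR := reliable_of_params (g := g) (ε := ε) hk hK h0 h1 hm.next_clear.params
    hm.ready_next.clear hst hm.next_clear.threshold
  have key := ev_searchResult_le hm.sampler hR (m := m.next) rfl (β := 1 / (16 * (k * K)))
  have e5 : m.next.num 5 = 16 * (k * K) * (n + k) := by simp [Memory.next, hm.params.r5]
  rw [e5] at key
  rw [memExec_advance, ev_map]
  refine le_trans (ev_mono fun m' => ind_mono (mt fun hs => ?_)) key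
  rcases hs with ⟨h, hp⟩ | ⟨h, y, hy1, hy2, hy3⟩
  · obtain ⟨a1, a2, a3, a4⟩ := hm.of_searching h
    refine Or.inl ⟨a2, a1, ha.of_eq a3 a4, Terminal.of_eq (lt_of_le_of_lt ?_ hp) a3 a4⟩
    refine pr_mono fun y _ hy => lt_of_le_of_lt ?_ hy
    gcongr
    linarith
  · obtain ⟨a1, a2, a3, a4⟩ := hm.of_found hst h
    refine Or.inr ⟨a2, a1, ?_⟩
    unfold Advantage
    rw [a3, a4, hy1]
    simp only
    rw [surplus_congr hy2]
    exact hy3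

/-- The memory before the first search. -/
structure Initial (δ : ℝ) (n K : ℕ) (m : Memory C) : Prop where
  params : Params δ n K m
  stage : m.num 13 = 0
  first : m.num 14 = 0
  threshold : m.num 15 = 8 * sampleScale k n K * k - sampleScale k n K
  hist : (m.solvers 0).hist = []

/-- The memory in which the first search starts. -/
def Memory.start (m : Memory C) : Memory C :=
  { m with num := Function.update m.num 12 (m.num 0 - m.num 14) }

/-- The memory after the first search. -/
def Memory.started (m : Memory C) : Memory C :=
  { m with num := Function.update (Function.update m.num 15 (m.num 15 - m.num 11)) 16 1 }

/-- The search for random bits of `C`, followed by the searches for instances. -/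
theorem memExec_fixInstances (m : Memory C) : fixInstances.memExec g ε δ m =
    ((search sampleStart).memExec g ε δ m.start).bind fun m' =>
      (repeatPMF ((ite 16 advance skip).memExec g ε δ) (m'.started.num 9) m'.started).map
        Memory.next := by
  simp only [fixInstances, memExec_block_cons, memExec_op, Op.exec, PMF.pure_bind]
  congr 1
  funext m'
  simp only [memExec_block_cons, memExec_op, Op.exec, PMF.pure_bind, memExec_loop]
  rw [← PMF.bind_pure_comp]
  congr 1
  funext m''
  simp only [memExec_block_cons, memExec_op, Op.exec, PMF.pure_bind, memExec_block_nil]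
  simp [Memory.next]

theorem Initial.ready (hm : Initial δ n K m) : Ready 0 m.start.clear :=
  ⟨by simp [Memory.start, Memory.clear, hm.params.r2],
    by simp [Memory.start, Memory.clear, hm.params.r4],
    by simp [Memory.start, Memory.clear, hm.first],
    by simp [Memory.start, Memory.clear, hm.params.r0, hm.first], Nat.zero_le _⟩

theorem Initial.num_eq {m' : Memory C} (h : searchFrame.Agree m.start.clear m') {j : ℕ}
    (hj : j ≤ 11 ∨ j = 25 ∨ j = 13 ∨ j = 15) : m'.num j = m.num j := by
  rw [h.num j (by simp only [searchFrame, decide_eq_true_eq]; omega)]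
  have : j ≠ 12 ∧ j ≠ 16 := by omega
  simp [Memory.start, Memory.clear, this]

theorem Initial.started (hm : Initial δ n K m) (hk : 1 ≤ k) {m' : Memory C}
    (h : searchFrame.Agree m.start.clear m') (hl : (m'.solvers 0).hist.length = 0 * P.rounds) :
    AtStage δ n K 0 m'.started ∧ m'.started.num 16 = 1 := by
  refine ⟨⟨hm.params.of_eq fun j hj => ?_, ?_, hk, hl, ?_⟩, by simp [Memory.started]⟩
  · have : j ≠ 15 ∧ j ≠ 16 := by omega
    simp only [Memory.started, ne_eq, this, not_false_eq_true, Function.update_of_ne]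
    exact Initial.num_eq h (by omega)
  · simp [Memory.started, Initial.num_eq h, hm.stage]
  · simp only [Memory.started, ne_eq, Nat.reduceEqDiff, not_false_eq_true, Function.update_of_ne,
      Function.update_self, Initial.num_eq h (j := 15) (by omega),
      Initial.num_eq h (j := 11) (by omega), hm.threshold, hm.params.r11]
    have : 8 * sampleScale k n K * k = 8 * sampleScale k n K * (k - 1) + 8 * sampleScale k n K := by
      rw [← mul_add_one, Nat.sub_add_cancel hk]
    simp only [zero_add]
    omega

/-- The result of the program `fixInstances`. -/
theorem always_fixInstances (hk : 1 ≤ k) (hm : Initial δ n K m) :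
    Always (fixInstances.memExec g ε δ m) fun m' =>
      ∃ st, AtStage δ n K st m' ∧ Ready (st + 1) m' := by
  rw [memExec_fixInstances]
  refine (always_search (sampler_start hm.ready) (m := m.start) rfl).bind fun m' hm' => ?_
  have hs : AtStage δ n K 0 m'.started ∧ m'.started.num 16 = 1 := by
    rcases hm' with h | h
    · refine hm.started hk h.agree ?_
      rw [h.solver]
      simp [Memory.start, Memory.clear, hm.hist]
    · exact hm.started hk h.agree h.length
  -- Once register 16 is zero `advance` is skipped, so the stage is frozen. The loop makes k - 1
  -- iterations, and nothing is claimed beyond them.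
  have key := Always.repeat (f := (ite 16 advance skip).memExec (C := C) g ε δ)
    (I := fun t m' => t ≤ k - 1 → (m'.num 16 = 1 ∧ AtStage δ n K t m') ∨
      (m'.num 16 = 0 ∧ ∃ st, AtStage δ n K st m'))
    (fun t m' hm' => by
      by_cases ht : t + 1 ≤ k - 1
      · rcases hm' (by omega) with ⟨h1, h2⟩ | ⟨h1, h2⟩
        · rw [memExec, if_pos (by simp [h1])]
          refine (always_advance h2 (by omega)).mono fun m'' h3 _ => ?_
          rcases h3 with ⟨h3, h4⟩ | h3
          · exact Or.inr ⟨h3, _, h4⟩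
          · exact Or.inl h3
        · rw [memExec, if_neg (by simp [h1])]
          exact always_pure fun _ => Or.inr ⟨h1, h2⟩
      · exact (always_true _).mono fun _ _ h => absurd h ht)
    (m'.started.num 9) 0 m'.started (fun _ => Or.inl ⟨hs.2, hs.1⟩)
  refine key.map fun m'' hm'' => ?_
  have : ∃ st, AtStage δ n K st m'' := by
    rcases hm'' (by simp [hs.1.params.r9]) with h | h
    · exact ⟨_, h.2⟩
    · exact h.2
  obtain ⟨st, h⟩ := this
  refine ⟨st, h.of_eq (fun j hj => ?_) rfl, h.ready_next⟩
  have : j ≠ 12 ∧ j ≠ 14 := by omega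
  simp [Memory.next, this]

/-- When all k bits are fixed, both terms of the surplus equal the indicator that g accepts them, so
no continuation has positive surplus. Hence it does no harm if every search succeeds. -/
theorem terminal_last (hk : 1 ≤ k) (hK : 1 ≤ K) : Terminal g δ K (k - 1) m := by
  have h1 : ∀ (ρ : Word C.coins) (h : List (Word P.msgLen)) (b : ℕ → Bool),
      C.surplus g δ ρ k h b = 0 := by
    intro ρ h b
    rw [SolverCircuit.surplus, SolverCircuit.value, Nat.sub_self, drawFrom, pr_pure,
      bernoulliTail]
    have : onBits g (C.bitsFrom ρ k h b fun _ _ => false) = onBits g b := by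
      unfold onBits
      congr 1
      funext j
      rw [SolverCircuit.bitsFrom, if_pos j.2]
    rw [this, sub_self]
  unfold Terminal
  rw [Nat.sub_add_cancel hk, Nat.sub_self]
  simp only [h1]
  have : (0 : ℝ) < 1 / (16 * (k * K)) := by
    have : (0 : ℝ) < k := by exact_mod_cast hk
    have : (0 : ℝ) < K := by exact_mod_cast hK
    positivity
  refine lt_of_le_of_lt (le_of_eq ?_) this
  simp [pr, ind, ev_const]

/-- There are at most k searches, one for the random bits and k - 1 for instances, and the union
bound is taken over them. -/
theorem ev_fixInstances_le (hk : 1 ≤ k) (hK : 1 ≤ K) (h0 : 0 ≤ δ) (h1 : δ ≤ 1)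
    (hm : Initial δ n K m) (hC : bernoulliProb k δ g + 1 / K ≤ C.successProb g) :
    ev (fixInstances.memExec g ε δ m) (fun m' => ind (¬∃ st, AtStage δ n K st m' ∧
      Ready (st + 1) m' ∧ Advantage g δ K st m' ∧ Terminal g δ K st m')) ≤
      k * searchFailure k n K := by
  rw [memExec_fixInstances]
  have hpar : Params δ n K m.start.clear := hm.params.of_eq fun j hj => by
    have : j ≠ 12 ∧ j ≠ 16 := by omega
    simp [Memory.start, Memory.clear, this]
  have hR := reliable_of_params (g := g) (ε := ε) hk hK h0 h1 hpar hm.ready (by omega)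
    (by simp [Memory.start, Memory.clear, hm.threshold])
  have key := ev_searchResult_le (sampler_start hm.ready) hR (m := m.start) rfl
    (β := 1 / (16 * (k * K)))
  have e5 : m.start.num 5 = 16 * (k * K) * (n + k) := by simp [Memory.start, hm.params.r5]
  rw [e5] at key
  rw [show (k : ℝ≥0∞) * searchFailure k n K = searchFailure k n K +
    ((k - 1 : ℕ) : ℝ≥0∞) * searchFailure k n K by
      nth_rw 1 [show k = (k - 1) + 1 by omega]; push_cast; ring]
  refine ev_ind_bind_le key fun m' hm' => ?_
  have hs : AtStage δ n K 0 m'.started ∧ m'.started.num 16 = 1 ∧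
      Advantage g δ K 0 m'.started := by
    rcases hm' with ⟨h, hp⟩ | ⟨h, y, hy1, hy2, hy3⟩
    -- The first search cannot end with the verdict that large surpluses are rare, because
    -- `le_pr_start` contradicts it.
    · exact absurd hp (not_lt.2 (by simpa using le_pr_start hk hK h0 h1 hC fun _ => false))
    · obtain ⟨a1, a2⟩ := hm.started hk h.agree h.length
      refine ⟨a1, a2, ?_⟩
      unfold Advantage
      rw [show m'.started.solvers 0 = m'.solvers 0 from rfl, hy1,
        surplus_congr (b' := fun _ => false) (by simp)]
      exact hy3
  rw [ev_map]
  have := ev_ind_repeat_le (f := (ite 16 advance skip).memExec (C := C) g ε δ)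
    (x := searchFailure k n K)
    (I := fun t m' => t ≤ k - 1 →
      (m'.num 16 = 1 ∧ AtStage δ n K t m' ∧ Advantage g δ K t m') ∨
      (m'.num 16 = 0 ∧ ∃ st, AtStage δ n K st m' ∧ Advantage g δ K st m' ∧ Terminal g δ K st m'))
    (fun t m' hm' => by
      by_cases ht : t + 1 ≤ k - 1
      · rcases hm' (by omega) with ⟨b1, b2, b3⟩ | ⟨b1, b2⟩
        · rw [memExec, if_pos (by simp [b1])]
          refine (ev_mono fun m'' => ind_mono (mt fun hs _ => ?_)).trans
            (ev_advance_le hk hK h0 h1 b2 (by omega) b3)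
          rcases hs with ⟨c1, c2, c3⟩ | c1
          · exact Or.inr ⟨c1, _, c2, c3⟩
          · exact Or.inl c1
        · rw [memExec, if_neg (by simp [b1]), memExec, ev_pure,
            ind_false (not_not.2 fun _ => Or.inr ⟨b1, b2⟩)]
          exact zero_le
      · refine (ev_le_of_le fun m'' _ => ?_)
        rw [ind_false (not_not.2 fun h => absurd h ht)]
        exact zero_le)
    (m'.started.num 9) 0 m'.started (fun _ => Or.inl ⟨hs.2.1, hs.1, hs.2.2⟩)
  rw [hs.1.params.r9] at this ⊢
  refine le_trans (ev_mono fun m'' => ind_mono (mt fun hI => ?_)) this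
  have : ∃ st, AtStage δ n K st m'' ∧ Advantage g δ K st m'' ∧ Terminal g δ K st m'' := by
    rcases hI (by simp) with ⟨_, b2, b3⟩ | b
    · rw [zero_add] at b2 b3
      exact ⟨_, b2, b3, terminal_last hk hK⟩
    · exact b.2
  obtain ⟨st, b1, b2, b3⟩ := this
  refine ⟨st, b1.of_eq (fun j hj => ?_) rfl, b1.ready_next, b2, b3⟩
  have : j ≠ 12 ∧ j ≠ 14 := by omega
  simp [Memory.next, this]

end Stages

end WVP

/-! ### One trial of the solver, and the effect of repeating it. -/

namespace WVP
open scoped ENNReal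

section Trial

open Program

variable {P : Puzzle} {k : ℕ} {C : SolverCircuit P k} {g : Word k → Bool} {ε δ : ℝ} {n K : ℕ}

/-! ## A trial of the solver for a single instance -/

/-- The bit for instance `e` decides about the value of `g`. -/
def SolverCircuit.Pivotal (C : SolverCircuit P k) (g : Word k → Bool) (ρ : Word C.coins) (e : ℕ)
    (h : List (Word P.msgLen)) (b : ℕ → Bool) (π : ℕ → Word P.coins) : Prop :=
  onBits g (C.bitsFrom ρ (e + 1) h (Function.update b e true) π) = true ∧
    onBits g (C.bitsFrom ρ (e + 1) h (Function.update b e false) π) = false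

/-- The cells that are left unchanged by `trial`. -/
def trialFrame : Frame where
  num j := decide (j ≠ 17 ∧ j ≠ 18 ∧ j ≠ 23 ∧ j ≠ 24)
  solver c := decide (c ≠ 1)
  ans _ := false
  bit := false
  posers := false
  outs := false

/-- The memory in which a trial starts. -/
structure Trying (e : ℕ) (ρ : Word C.coins) (h : List (Word P.msgLen)) (b : ℕ → Bool)
    (m : Memory C) : Prop where
  ready : Ready (e + 1) m
  stage : m.num 13 = e
  zero : m.num 25 = 0
  solver : m.solvers 0 = ⟨ρ, h⟩
  bits : ∀ j < e, m.bit j = b j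

variable {e : ℕ} {ρ : Word C.coins} {h : List (Word P.msgLen)} {b : ℕ → Bool} {m : Memory C}

/-- Only the bits before `e` need to be intact: bit `e` is overwritten before g is evaluated, so
whatever an earlier trial left there is irrelevant. -/
theorem onBits_update_bitsFrom {π : ℕ → Word P.coins} {b' : ℕ → Bool}
    (hb : ∀ j < k, b' j = C.bitsFrom ρ (e + 1) h m.bit π j) (hm : ∀ j < e, m.bit j = b j)
    (β : Bool) : onBits g (Function.update b' e β) =
      onBits g (C.bitsFrom ρ (e + 1) h (Function.update b e β) π) := by
  unfold onBits
  congr 1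
  funext j
  by_cases h1 : (j : ℕ) = e
  · rw [h1, Function.update_self, SolverCircuit.bitsFrom, if_pos (by omega), Function.update_self]
  · rw [Function.update_of_ne h1, hb j j.2]
    unfold SolverCircuit.bitsFrom
    split
    · rw [Function.update_of_ne h1, hm j (by omega)]
    · rfl

/-- A trial draws only the later instances, whose posers are simulated. Whether it is pivotal
depends on the other bits alone, so it is decided without the hidden circuit of the actual poser. -/
theorem coupled_trial (hm : Trying e ρ h b m) (hh : h.length = (e + 1) * P.rounds)
    (π₀ : ℕ → Word P.coins) :
    Coupled (trial.memExec g ε δ m) (drawFrom (e + 1) (k - (e + 1)) π₀) fun π m' =>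
      Trying e ρ h b m' ∧
      (C.Pivotal g ρ e h b π → m'.ans 0 = C.answer ρ (C.histFrom ρ (e + 1) h π k) e) ∧
      (¬C.Pivotal g ρ e h b π → m'.ans 0 = m.ans 0) := by
  have he : e < k := hm.ready.le
  suffices H : Coupled (trial.memExec g ε δ m) (drawFrom (e + 1) (k - (e + 1)) π₀) fun π m' =>
      (∀ j < e, m'.bit j = b j) ∧
      (C.Pivotal g ρ e h b π → m'.ans 0 = C.answer ρ (C.histFrom ρ (e + 1) h π k) e) ∧
      (¬C.Pivotal g ρ e h b π → m'.ans 0 = m.ans 0) by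
    refine (H.and_always (Frame.always trialFrame (by rfl) m)).mono fun π m' ⟨⟨h1, h2⟩, h3⟩ =>
      ⟨⟨?_, by rw [h3.num 13 rfl, hm.stage], by rw [h3.num 25 rfl, hm.zero],
        by rw [h3.solver 0 rfl, hm.solver], h1⟩, h2⟩
    exact ⟨by rw [h3.num 2 rfl, hm.ready.rounds], by rw [h3.num 4 rfl, hm.ready.one],
      by rw [h3.num 14 rfl, hm.ready.first], by rw [h3.num 12 rfl, hm.ready.remaining], he⟩
  rw [trial, memExec_block_cons]
  refine ((coupled_simulate hm.ready hm.solver hh π₀).and_always (always_simulate 0 m)).bind_left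
    fun π m' ⟨⟨h1, h2, h3⟩, h4⟩ => ?_
  simp only [memExec_block_cons, memExec_op, Op.exec, PMF.pure_bind, memExec_block_nil]
  have e13 : m'.num 13 = e := by rw [h4.num 13 rfl, hm.stage]
  have e4 : m'.num 4 = 1 := by rw [h4.num 4 rfl, hm.ready.one]
  have e25 : m'.num 25 = 0 := by rw [h4.num 25 rfl, hm.zero]
  have g1 := onBits_update_bitsFrom (g := g) h1 hm.bits true
  have g0 := onBits_update_bitsFrom (g := g) h1 hm.bits false
  unfold onBits at g1 g0
  refine always_pure ⟨fun j hj => ?_, fun hp => ?_, fun hp => ?_⟩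
  · have : j ≠ e := by omega
    simp [e13, this, h2 j (by omega), hm.bits j hj]
  · unfold SolverCircuit.Pivotal onBits at hp
    rw [← g1, ← g0] at hp
    simp [e13, e4, e25, hp, h3, SolverCircuit.answer]
  · unfold SolverCircuit.Pivotal onBits at hp
    rw [← g1, ← g0] at hp
    simp [e13, e4, e25, h4.ans 0 rfl]
    intro h5
    refine absurd ?_ hp
    revert h5
    split <;> split <;> simp_all

/-- The probability that the bit for instance `e` decides. -/
noncomputable def SolverCircuit.influence (C : SolverCircuit P k) (g : Word k → Bool)
    (ρ : Word C.coins) (e : ℕ) (h : List (Word P.msgLen)) (b : ℕ → Bool) : ℝ :=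
  pr (drawFrom (e + 1) (k - (e + 1)) fun _ _ => false) (C.Pivotal g ρ e h b)

/-- The probability that the bit for instance `e` decides, and the answer for instance `e` passes
the test `T`. -/
noncomputable def SolverCircuit.gain (C : SolverCircuit P k) (g : Word k → Bool)
    (ρ : Word C.coins) (e : ℕ) (h : List (Word P.msgLen)) (b : ℕ → Bool)
    (T : Word P.ansLen → Bool) : ℝ :=
  pr (drawFrom (e + 1) (k - (e + 1)) fun _ _ => false) fun π =>
    C.Pivotal g ρ e h b π ∧ T (C.answer ρ (C.histFrom ρ (e + 1) h π k) e) = true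

variable {T : Word P.ansLen → Bool}

theorem pr_pivotal_not :
    pr (drawFrom (e + 1) (k - (e + 1)) fun _ _ => false) (fun π => C.Pivotal g ρ e h b π ∧
      ¬T (C.answer ρ (C.histFrom ρ (e + 1) h π k) e) = true) =
      C.influence g ρ e h b - C.gain g ρ e h b T := by
  rw [eq_sub_iff_add_eq, SolverCircuit.gain, ← pr_or fun π => by tauto]
  exact pr_congr fun π _ => by tauto

/-- The probability that the answer does not pass the test after several trials. -/
theorem ev_trials_le (hm : Trying e ρ h b m) (hh : h.length = (e + 1) * P.rounds) (t : ℕ) :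
    ev (repeatPMF (trial.memExec g ε δ) t m) (fun m' => ind (¬T (m'.ans 0) = true)) ≤
      ENNReal.ofReal ((1 - C.influence g ρ e h b) ^ t +
        (∑ l ∈ Finset.range t, (1 - C.influence g ρ e h b) ^ l) *
          (C.influence g ρ e h b - C.gain g ρ e h b T)) := by
  set q := C.influence g ρ e h b with hq
  set s := C.gain g ρ e h b T with hs
  have q1 : 0 ≤ 1 - q := sub_nonneg.2 (pr_le_one _ _)
  have qs : 0 ≤ q - s := by rw [hq, hs, ← pr_pivotal_not]; exact pr_nonneg _ _
  have hW : ∀ t : ℕ, 0 ≤ ∑ l ∈ Finset.range t, (1 - q) ^ l := fun t =>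
    Finset.sum_nonneg fun l _ => pow_nonneg q1 l
  -- With `t` trials to come, a wrong present answer survives with probability (1 - q)^t. Otherwise
  -- a wrong answer comes from the last pivotal trial; if `l` trials follow that one, this
  -- contributes (q - s)(1 - q)^l.
  set Φ : ℕ → Memory C → ℝ≥0∞ := fun t m' => ENNReal.ofReal ((1 - q) ^ t) *
    ind (¬T (m'.ans 0) = true) +
      ENNReal.ofReal ((∑ l ∈ Finset.range t, (1 - q) ^ l) * (q - s)) with hΦ
  have key := ev_repeat_le (f := trial.memExec (C := C) g ε δ) (I := Trying e ρ h b) (Φ := Φ)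
    (fun m' hm' => always_of_coupled (coupled_trial hm' hh fun _ _ => false) fun π m'' H => H.1)
    (fun t m' hm' => by
      refine (coupled_trial hm' hh fun _ _ => false) _ (fun π => ind (¬C.Pivotal g ρ e h b π) *
        (ENNReal.ofReal ((1 - q) ^ t) * ind (¬T (m'.ans 0) = true)) +
        (ind (C.Pivotal g ρ e h b π ∧ ¬T (C.answer ρ (C.histFrom ρ (e + 1) h π k) e) = true) *
          ENNReal.ofReal ((1 - q) ^ t) +
          ENNReal.ofReal ((∑ l ∈ Finset.range t, (1 - q) ^ l) * (q - s)))) ?_ |>.trans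
            (le_of_eq ?_)
      · rintro π m'' ⟨_, h1, h2⟩
        simp only [hΦ]
        rw [← add_assoc]
        gcongr
        by_cases hp : C.Pivotal g ρ e h b π
        · rw [h1 hp, mul_comm]
          refine le_trans ?_ le_add_self
          gcongr
          exact ind_mono fun H => ⟨hp, H⟩
        · rw [h2 hp, ind_true hp, one_mul]
          exact le_self_add
      · rw [ev_add, ev_add, ev_const, ev_mul_right, ev_mul_right, ← ofReal_pr, ← ofReal_pr,
          pr_pivotal_not, pr_not, ← SolverCircuit.influence, ← hq, ← hs,
          ← ENNReal.ofReal_mul qs, ← ENNReal.ofReal_add (mul_nonneg qs (pow_nonneg q1 t))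
            (mul_nonneg (hW t) qs), ← mul_assoc, ← ENNReal.ofReal_mul q1]
        simp only [hΦ]
        rw [Finset.sum_range_succ, pow_succ']
        congr 2
        ring) t m hm
  refine le_trans (le_of_eq ?_) (key.trans ?_)
  · simp [hΦ]
  · simp only [hΦ]
    rw [ENNReal.ofReal_add (pow_nonneg q1 t) (mul_nonneg (hW t) qs)]
    gcongr
    exact mul_le_of_le_one_right' (ind_le_one _)

end Trial

end WVP

/-! ### From surpluses to the success probability of the trials. -/

namespace WVP
open scoped ENNReal

section Average

/-! ## The average over the actual instance -/

/-- In 1 ≥ 1 - (1-q)^(m+1) = q ∑ (1-q)^l each of the m + 1 powers is at least (1-q)^m. The bound is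
uniform in q, so order 1/η trials suffice without a logarithmic factor. -/
theorem pow_mul_le {q : ℝ} (h0 : 0 ≤ q) (h1 : q ≤ 1) (m : ℕ) : (1 - q) ^ m * q ≤ 1 / (m + 1) := by
  have e1 := geom_sum_mul_neg (1 - q) (m + 1)
  rw [sub_sub_cancel] at e1
  have e2 : ((m : ℝ) + 1) * (1 - q) ^ m ≤ ∑ l ∈ Finset.range (m + 1), (1 - q) ^ l := by
    have := Finset.card_nsmul_le_sum (Finset.range (m + 1)) (fun l => (1 - q) ^ l) ((1 - q) ^ m)
      fun l hl => pow_le_pow_of_le_one (by linarith) (by linarith)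
        (by have := Finset.mem_range.1 hl; omega)
    simpa using this
  have e3 : 0 ≤ (1 - q) ^ (m + 1) := pow_nonneg (by linarith) _
  rw [le_div_iff₀ (by positivity)]
  nlinarith

/-- The trials with all possible actual instances together succeed with the desired probability. -/
theorem le_average {X : Type} [Fintype X] [Nonempty X] {q s S₀ S₁ : X → ℝ} {p δ η T : ℝ} {m : ℕ}
    (hs : ∀ x, 0 ≤ s x) (hsq : ∀ x, s x ≤ q x) (hq : ∀ x, q x ≤ 1)
    (hp : ∀ x, q x = p + S₁ x - S₀ x) (hp0 : 0 ≤ p) (hp1 : p ≤ 1) (hS₀ : ∀ x, S₀ x ≤ 1)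
    (hS₁ : ∀ x, S₁ x ≤ 1) (hT : 0 ≤ T) (hη : 0 < η) (hm : 5 ≤ η * (m + 1))
    (hA : (δ * p + T + 13 / 16 * η) * Fintype.card X ≤ ∑ x, (S₀ x + s x))
    (hB : ∑ x, ((if T < S₀ x then (1 : ℝ) else 0) + if T < S₁ x then 1 else 0) ≤
      η / 8 * Fintype.card X) :
    (δ + η / 3) * Fintype.card X ≤ ∑ x, (∑ l ∈ Finset.range m, (1 - q x) ^ l) * s x := by
  set N : ℝ := (Fintype.card X : ℝ) with hN
  have hN0 : 0 < N := by rw [hN]; exact_mod_cast Fintype.card_pos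
  set D : X → ℝ := fun x => (∑ l ∈ Finset.range m, (1 - q x) ^ l) * s x with hD
  have key : ∀ x, S₀ x + s x ≤ p * D x + (T + η / 5) +
      ((if T < S₀ x then (1 : ℝ) else 0) + if T < S₁ x then 1 else 0) := by
    intro x
    have q0 : 0 ≤ q x := (hs x).trans (hsq x)
    have q1 := hq x
    have e1 := geom_sum_mul_neg (1 - q x) m
    rw [sub_sub_cancel] at e1
    have e2 := pow_mul_le q0 q1 m
    have e3 : (1 : ℝ) / (m + 1) ≤ η / 5 := by
      rw [div_le_iff₀ (by positivity)]; linarith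
    have e4 : 0 ≤ (1 - q x) ^ m := pow_nonneg (by linarith) _
    have e5 : (1 - q x) ^ m * s x ≤ (1 - q x) ^ m * q x := mul_le_mul_of_nonneg_left (hsq x) e4
    set W := ∑ l ∈ Finset.range m, (1 - q x) ^ l with hW
    have W0 : 0 ≤ W := Finset.sum_nonneg fun l _ => pow_nonneg (by linarith) l
    have D0 : 0 ≤ D x := mul_nonneg W0 (hs x)
    have D1 : D x ≤ 1 := by
      have : D x ≤ W * q x := mul_le_mul_of_nonneg_left (hsq x) W0
      linarith
    -- Here q = p + S₁ - S₀ is inserted into s = qD + (1 - q)^m s, an identity that avoids dividing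
    -- by q. The middle term is a convex combination of S₁ and S₀, and each of them is at most T
    -- outside its exceptional event.
    have e6 : S₀ x + s x = p * D x + (S₁ x * D x + S₀ x * (1 - D x)) + (1 - q x) ^ m * s x := by
      have e7 : q x * D x = s x - (1 - q x) ^ m * s x := by
        have : q x * D x = (W * q x) * s x := by simp only [hD, ← hW]; ring
        rw [this, e1]; ring
      rw [hp x] at e7 ⊢
      linarith
    have e8 : ∀ {S : ℝ}, S ≤ 1 → S ≤ T + if T < S then 1 else 0 := by
      intro S hS
      split <;> linarith
    have e9 := mul_le_mul_of_nonneg_right (e8 (hS₁ x)) D0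
    have e10 := mul_le_mul_of_nonneg_right (e8 (hS₀ x)) (sub_nonneg.2 D1)
    have b1 : (0 : ℝ) ≤ if T < S₁ x then 1 else 0 := by split <;> norm_num
    have b0 : (0 : ℝ) ≤ if T < S₀ x then 1 else 0 := by split <;> norm_num
    nlinarith
  have h1 := Finset.sum_le_sum fun x (_ : x ∈ Finset.univ) => key x
  rw [Finset.sum_add_distrib (f := fun x => p * D x + (T + η / 5)),
    Finset.sum_add_distrib (f := fun x => p * D x), ← Finset.mul_sum, Finset.sum_const,
    Finset.card_univ, nsmul_eq_mul, ← hN] at h1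
  -- The constants fit because 13/16 - 1/5 - 1/8 ≥ 1/3: surplus left over, truncation after `m`
  -- trials, and exceptional events.
  have h2 : (η / 3) * N ≤ p * (∑ x, D x - δ * N) := by nlinarith
  -- A nonnegative p times this difference is positive, so the difference is positive, and p ≤ 1 may
  -- then be dropped.
  have h3 : 0 < ∑ x, D x - δ * N := by
    by_contra hneg
    have := mul_nonneg hp0 (neg_nonneg.2 (not_lt.1 hneg))
    have : 0 < η / 3 * N := by positivity
    linarith
  nlinarith

end Average

/-! ### Splitting the acceptance of g at the bit of the actual instance. -/

section Value

open Program

variable {P : Puzzle} {k : ℕ} {C : SolverCircuit P k} {g : Word k → Bool} {δ : ℝ}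

theorem onBits_mono (hg : Monotone g) {b b' : ℕ → Bool} (h : ∀ j, b j ≤ b' j)
    (hb : onBits g b = true) : onBits g b' = true := by
  have : onBits g b ≤ onBits g b' := hg fun j => h j
  rw [hb] at this
  exact top_le_iff.1 this

theorem bernoulliTail_mono (hg : Monotone g) (h0 : 0 ≤ δ) (h1 : δ ≤ 1) (j t : ℕ)
    {b b' : ℕ → Bool} (h : ∀ j, b j ≤ b' j) : bernoulliTail g δ j t b ≤ bernoulliTail g δ j t b' := by
  induction t generalizing j b b' with
  | zero =>
    unfold bernoulliTail
    split
    · rw [if_pos (onBits_mono hg h (by assumption))]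
    · split <;> norm_num
  | succ t ih =>
    have : ∀ β l, Function.update b j β l ≤ Function.update b' j β l := fun β l => by
      by_cases hl : l = j
      · subst hl; simp
      · simpa [Function.update_of_ne hl] using h l
    unfold bernoulliTail
    have h1' : 0 ≤ 1 - δ := sub_nonneg.2 h1
    gcongr <;> exact ih _ (this _)

variable {ρ : Word C.coins} {e : ℕ} {h : List (Word P.msgLen)} {b : ℕ → Bool}

theorem onBits_true_of_false (hg : Monotone g) {π : ℕ → Word P.coins}
    (h0 : onBits g (C.bitsFrom ρ (e + 1) h (Function.update b e false) π) = true) :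
    onBits g (C.bitsFrom ρ (e + 1) h (Function.update b e true) π) = true := by
  refine onBits_mono hg (fun j => ?_) h0
  unfold SolverCircuit.bitsFrom
  split
  · by_cases hj : j = e
    · subst hj; simp
    · simp [Function.update_of_ne hj]
  · exact le_rfl

/-- Since g is monotone, acceptance with bit `e` equal to 1 is the disjoint union of acceptance with
bit 0 and the pivotal event. -/
theorem value_true_eq (hg : Monotone g) : C.value g ρ (e + 1) h (Function.update b e true) =
    C.value g ρ (e + 1) h (Function.update b e false) + C.influence g ρ e h b := by
  rw [SolverCircuit.value, SolverCircuit.value, SolverCircuit.influence, ← pr_or]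
  · refine pr_congr fun π _ => ?_
    have := onBits_true_of_false (C := C) (ρ := ρ) (e := e) (h := h) (b := b) (π := π) hg
    unfold SolverCircuit.Pivotal
    cases h0 : onBits g (C.bitsFrom ρ (e + 1) h (Function.update b e false) π) <;> simp_all
  · rintro π ⟨h1, h2⟩
    rw [SolverCircuit.Pivotal, h1] at h2
    exact absurd h2.2 (by simp)

/-- The test of an answer in the instance that is played after the messages `h`. -/
def SolverCircuit.test (C : SolverCircuit P k) (ρ : Word C.coins) (h : List (Word P.msgLen))
    (x : Word P.coins) (y : Word P.ansLen) : Bool := P.check x (C.play ρ x h P.rounds).2 y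

/-- For given coins x of instance `e`, g accepts the actual bits exactly if it accepts with bit `e`
replaced by 0, or bit `e` is pivotal and the answer is correct. The two cases are disjoint. -/
theorem value_eq_average (hg : Monotone g) (he : e < k) : C.value g ρ e h b =
    (∑ x, (C.value g ρ (e + 1) (C.play ρ x h P.rounds).1 (Function.update b e false) +
      C.gain g ρ e (C.play ρ x h P.rounds).1 b (C.test ρ h x))) / Fintype.card (Word P.coins) := by
  rw [SolverCircuit.value, show k - e = (k - (e + 1)) + 1 by omega, drawFrom, pr_bind_uniform]
  congr 1
  refine Finset.sum_congr rfl fun x _ => ?_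
  rw [SolverCircuit.value, SolverCircuit.gain, ← pr_or]
  · refine Coupled.pr_eq ((drawFrom_coupled (e + 1) (k - (e + 1)) (fun _ _ => false)
      (Function.update (fun _ _ => false) e x) (S := fun _ => False) (by simp)).and_always
        (drawFrom_always _ _ _)) fun π π' ⟨h1, h2⟩ => ?_
    have hx : π' e = x := by rw [h2 e (by omega), Function.update_self]
    have hπ : ∀ l, e + 1 ≤ l → l < k → π' l = π l := fun l hl hl' => h1 l (Or.inr (by omega))
    have e1 : onBits g (C.bitsFrom ρ e h b π') = onBits g (C.bitsFrom ρ (e + 1)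
        (C.play ρ x h P.rounds).1 (Function.update b e (C.test ρ h x (C.answer ρ
          (C.histFrom ρ (e + 1) (C.play ρ x h P.rounds).1 π k) e))) π) := by
      rw [funext fun j => SolverCircuit.bitsFrom_step (C := C) (ρ := ρ) (h := h) (π := π') (b := b)
        he j, hx, SolverCircuit.histFrom_congr hπ, ← SolverCircuit.test]
      exact SolverCircuit.onBits_bitsFrom_congr (fun _ _ => rfl) hπ
    rw [e1]
    have := onBits_true_of_false (C := C) (ρ := ρ) (e := e) (h := (C.play ρ x h P.rounds).1)
      (b := b) (π := π) hg
    unfold SolverCircuit.Pivotal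
    cases C.test ρ h x (C.answer ρ (C.histFrom ρ (e + 1) (C.play ρ x h P.rounds).1 π k) e) <;>
      cases h0 : onBits g (C.bitsFrom ρ (e + 1) (C.play ρ x h P.rounds).1
        (Function.update b e false) π) <;> simp_all
  · rintro π ⟨h1, h2, _⟩
    rw [SolverCircuit.Pivotal, h1] at h2
    exact absurd h2.2 (by simp)

theorem gain_le_influence {T : Word P.ansLen → Bool} :
    C.gain g ρ e h b T ≤ C.influence g ρ e h b := pr_mono fun _ _ h => h.1

variable {n K st : ℕ} {m : Memory C}

/-- The average success of the trials. -/
theorem le_sum_trials (hg : Monotone g) (hk : 1 ≤ k) (hK : 1 ≤ K) (h0 : 0 ≤ δ) (h1 : δ ≤ 1)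
    (hm : AtStage δ n K st m) (ha : Advantage g δ K st m) (ht : Terminal g δ K st m) :
    (δ + 1 / (k * K) / 3) * Fintype.card (Word P.coins) ≤ ∑ x,
      (∑ l ∈ Finset.range (5 * (k * K)), (1 - C.influence g (m.solvers 0).coins st
        (C.play (m.solvers 0).coins x (m.solvers 0).hist P.rounds).1 m.bit) ^ l) *
      C.gain g (m.solvers 0).coins st
        (C.play (m.solvers 0).coins x (m.solvers 0).hist P.rounds).1 m.bit
        (C.test (m.solvers 0).coins (m.solvers 0).hist x) := by
  have hk' : (1 : ℝ) ≤ k := by exact_mod_cast hk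
  have hK' : (1 : ℝ) ≤ K := by exact_mod_cast hK
  have hz : (0 : ℝ) < (k : ℝ) * K := by positivity
  have hst := hm.lt
  have hN : (0 : ℝ) < Fintype.card (Word P.coins) := by exact_mod_cast Fintype.card_pos
  set U : Bool → ℝ := fun β => bernoulliTail g δ (st + 1) (k - (st + 1)) (Function.update m.bit st β)
    with hU
  have hU0 := bernoulliTail_mem (g := g) h0 h1 (st + 1) (k - (st + 1))
    (Function.update m.bit st false)
  have hU1 := bernoulliTail_mem (g := g) h0 h1 (st + 1) (k - (st + 1))
    (Function.update m.bit st true)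
  have hUm : U false ≤ U true := bernoulliTail_mono hg h0 h1 _ _ fun j => by
    by_cases hj : j = st
    · subst hj; simp
    · simp [Function.update_of_ne hj]
  -- Here p is the difference made by bit `st` when the later bits are independent with bias δ, and
  -- `T` is the surplus that a continuation rarely exceeds.
  refine le_average (p := U true - U false) (T := ((k - (st + 1) : ℕ) : ℝ) / (k * K))
    (S₀ := fun x => C.surplus g δ (m.solvers 0).coins (st + 1)
      (C.play (m.solvers 0).coins x (m.solvers 0).hist P.rounds).1 (Function.update m.bit st false))
    (S₁ := fun x => C.surplus g δ (m.solvers 0).coins (st + 1)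
      (C.play (m.solvers 0).coins x (m.solvers 0).hist P.rounds).1 (Function.update m.bit st true))
    (fun x => pr_nonneg _ _) (fun x => gain_le_influence) (fun x => pr_le_one _ _) (fun x => ?_)
    (by linarith) (by simp only [hU]; linarith) (fun x => surplus_le_one h0 h1 _ _ _ _)
    (fun x => surplus_le_one h0 h1 _ _ _ _) (by positivity) (by positivity) ?_ ?_ ?_
  · simp only [SolverCircuit.surplus, hU, value_true_eq hg]
    ring
  · rw [div_mul_eq_mul_div, le_div_iff₀ hz]
    push_cast
    linarith
  -- Since k - st = (k - (st + 1)) + 1, the advantage equals T + (13/16)η. Writing the probability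
  -- for independent bits as δ·U(1) + (1 - δ)·U(0) and subtracting U(0) produces the term δp.
  · unfold Advantage at ha
    rw [SolverCircuit.surplus, value_eq_average hg hst, show k - st = (k - (st + 1)) + 1 by omega,
      bernoulliTail, le_sub_iff_add_le, le_div_iff₀ hN] at ha
    simp only [SolverCircuit.surplus, Finset.sum_add_distrib, Finset.sum_sub_distrib,
      Finset.sum_const, Finset.card_univ, nsmul_eq_mul] at ha ⊢
    refine le_trans (le_of_eq ?_) (sub_le_sub_right ha
      (Fintype.card (Word P.coins) * U false) |>.trans (le_of_eq ?_))
    · simp only [hU]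
      push_cast
      field_simp
      ring
    · simp only [hU]
      ring
  -- `Terminal` bounds by η/16 a probability over x and a fair bit. Adding the two values of the
  -- bit, instead of averaging them, doubles this to η/8.
  · unfold Terminal at ht
    classical
    rw [pr_uniform, div_lt_div_iff₀ (by positivity) (by positivity), Fintype.sum_prod_type,
      Fintype.card_prod] at ht
    simp only [Fintype.sum_bool, Fintype.card_bool] at ht
    push_cast at ht
    rw [Finset.sum_add_distrib] at ht ⊢
    rw [div_div, div_mul_eq_mul_div, le_div_iff₀ (by positivity)]
    linarith

end Value

end WVP

/-! ### The solver that is built: success probability, no rewinding, size. -/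

namespace WVP
open scoped ENNReal

section Built

open Program

variable {P : Puzzle} {k : ℕ} {C : SolverCircuit P k} {g : Word k → Bool} {ε δ : ℝ}

/-! ## The solver for a single instance -/

/-- The present copy of `C` plays `r` rounds with the actual poser. -/
def liveCode (r : ℕ) : List Instr :=
  (List.replicate r [Instr.recv 0, .op (.stepC 0 0 0), .send 0]).flatten

/-- The code of the solver that is built if the memory is `m` in the end. -/
def builtCode (m : Memory C) : List Instr :=
  liveCode (m.num 2) ++ ((loop 10 trial).unroll m.num).map Instr.op

/-- The solver that is built if the memory is `m` in the end. -/
def built (m : Memory C) : Solver C := ⟨m, builtCode m⟩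

/-- The emitted code is the code of the solver. -/
theorem always_emission (s : ProgramState C) (hs : s.code = []) :
    Always (emission.exec g ε δ s) fun s' => s'.memory = s.memory ∧ s'.code = builtCode s.memory := by
  refine Always.bind (A := fun s' : ProgramState C => s'.memory = s.memory ∧
    s'.code = liveCode (s.memory.num 2)) ?_ fun s' hs' => ?_
  · have := Always.repeat (f := fun s' : ProgramState C =>
        (seq (emit (.recv 0)) (seq (emit (.op (.stepC 0 0 0))) (emit (.send 0)))).exec g ε δ
          { s' with time := s'.time + 1 })
      (I := fun t s' => s'.memory = s.memory ∧ s'.code = liveCode t)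
      (fun t s' hs' => by
        simp only [exec, PMF.pure_bind]
        refine always_pure ⟨hs'.1, ?_⟩
        simp only [hs'.2, liveCode, List.replicate_succ', List.flatten_append]
        simp) (s.memory.num 2) 0 { s with time := s.time + 1 } ⟨rfl, by simp [hs, liveCode]⟩
    simpa [exec] using this
  · have := always_emitAll (g := g) (ε := ε) (δ := δ) (loop 10 trial) s'
    refine this.mono fun s'' hs'' => ?_
    rw [hs'.1, hs'.2] at hs''
    exact hs''

theorem play_eq_messages {ρ : Word C.coins} {x : Word P.coins} {h : List (Word P.msgLen)} (t : ℕ) :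
    (C.play ρ x h t).1 = P.messages x (C.play ρ x h t).2 ++ h := by
  induction t with
  | zero => rfl
  | succ t ih => simp only [SolverCircuit.play, Puzzle.messages, List.cons_append, ← ih]

/-- The state after the interaction with the actual poser. -/
structure Played (m : Memory C) (ρ : Word C.coins) (h : List (Word P.msgLen)) (x : Word P.coins)
    (t : ℕ) (s : SolverState C) : Prop where
  live : s.live = ⟨x, (C.play ρ x h t).2⟩
  solver : s.memory.solvers 0 = ⟨ρ, (C.play ρ x h t).1⟩
  num : s.memory.num = m.num
  bit : s.memory.bit = m.bit
  calls : ∀ q ∈ s.calls, q.coins = ρ ∧ q.hist <:+ (C.play ρ x h t).1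

theorem always_liveCode {m : Memory C} {ρ : Word C.coins} {h : List (Word P.msgLen)}
    {x : Word P.coins} (hs : m.solvers 0 = ⟨ρ, h⟩) (hh : h.length + P.rounds ≤ k * P.rounds)
    (t : ℕ) (ht : t ≤ P.rounds) :
    Always (runCode g (liveCode t) ⟨m, ⟨x, []⟩, []⟩) (Played m ρ h x t) := by
  induction t with
  | zero => exact always_pure ⟨rfl, hs, rfl, rfl, by simp⟩
  | succ t ih =>
    rw [liveCode, List.replicate_succ', List.flatten_append, runCode_append]
    refine (ih (by omega)).bind fun s hs => ?_
    have h1 : s.live.replies.length < P.rounds := by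
      rw [hs.live, SolverCircuit.play_replies_length]; omega
    have h2 : (C.play ρ x h t).1.length < k * P.rounds := by
      rw [SolverCircuit.play_length]; omega
    simp only [List.flatten_cons, List.flatten_nil, List.append_nil, runCode, Instr.exec, Op.exec,
      PMF.pure_bind, PMF.pure_map, if_pos h1]
    refine always_pure ⟨?_, ?_, hs.num, hs.bit, fun q hq => ?_⟩
    · simp [hs.live, hs.solver, SolverCopy.push, h2, SolverCircuit.play]
    · simp [hs.live, hs.solver, SolverCopy.push, h2, SolverCircuit.play]
    · simp only [Op.calls, List.mem_append, List.mem_singleton, Function.update_self, hs.live,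
        hs.solver, SolverCopy.push, if_pos h2] at hq
      rcases hq with hq | rfl
      · exact ⟨(hs.calls q hq).1, (hs.calls q hq).2.trans (List.suffix_cons _ _)⟩
      · exact ⟨rfl, List.suffix_rfl⟩

variable {n K st : ℕ} {m : Memory C}

theorem AtStage.length_add_le (hm : AtStage δ n K st m) :
    (m.solvers 0).hist.length + P.rounds ≤ k * P.rounds := by
  rw [hm.length, ← add_one_mul]
  exact Nat.mul_le_mul_right _ hm.lt

/-! ## Its success probability -/

/-- By `ev_trials_le` failure has probability at most (1-q)^m + W(q - s), where W is the geometric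
sum. Since Wq = 1 - (1-q)^m, the complement is at least Ws. -/
theorem le_pr_run (ε : ℝ) (hm : AtStage δ n K st m) (hr : Ready (st + 1) m) (x : Word P.coins) :
    (∑ l ∈ Finset.range (5 * (k * K)), (1 - C.influence g (m.solvers 0).coins st
        (C.play (m.solvers 0).coins x (m.solvers 0).hist P.rounds).1 m.bit) ^ l) *
      C.gain g (m.solvers 0).coins st
        (C.play (m.solvers 0).coins x (m.solvers 0).hist P.rounds).1 m.bit
        (C.test (m.solvers 0).coins (m.solvers 0).hist x) ≤
      pr ((built m).run g x) fun s => s.live.replies.length = P.rounds ∧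
        P.check s.live.coins s.live.replies (s.memory.ans 0) = true := by
  set ρ := (m.solvers 0).coins
  set h := (m.solvers 0).hist
  set T := C.test ρ h x with hT
  set q := C.influence g ρ st (C.play ρ x h P.rounds).1 m.bit with hq
  set s := C.gain g ρ st (C.play ρ x h P.rounds).1 m.bit T with hs
  set W := ∑ l ∈ Finset.range (5 * (k * K)), (1 - q) ^ l with hW
  have e1 : W * q = 1 - (1 - q) ^ (5 * (k * K)) := by
    have := geom_sum_mul_neg (1 - q) (5 * (k * K))
    rwa [sub_sub_cancel] at this
  have q1 : 0 ≤ 1 - q := sub_nonneg.2 (pr_le_one _ _)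
  have qs : 0 ≤ q - s := by rw [hq, hs, ← pr_pivotal_not]; exact pr_nonneg _ _
  have W0 : 0 ≤ W := Finset.sum_nonneg fun l _ => pow_nonneg q1 l
  have key : pr ((built m).run g x) (fun s => ¬(s.live.replies.length = P.rounds ∧
      P.check s.live.coins s.live.replies (s.memory.ans 0) = true)) ≤
      (1 - q) ^ (5 * (k * K)) + W * (q - s) := by
    refine pr_le_of_ev_le (add_nonneg (pow_nonneg q1 _) (mul_nonneg W0 qs)) ?_
    rw [Solver.run, built, builtCode, runCode_append, hm.params.r2, ev_bind]
    refine ev_le_of_le fun s' hs' => ?_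
    have hpl := always_liveCode (m := m) (ρ := ρ) (h := h) rfl hm.length_add_le P.rounds le_rfl s' hs'
    -- The loops in the trials are governed by registers 2, 10 and 12, which the trials never write;
    -- so the emitted code acts like the program. The values of ε and δ play no role, because the
    -- trials do not read them.
    have hu := runOps_unroll (g := g) (ε := ε) (δ := δ) (v := m.num) (c := loop 10 trial)
      (S := fun j => decide (j = 2 ∨ j = 10 ∨ j = 12)) (by rfl) s'.memory fun j _ => by rw [hpl.num]
    rw [ev_runCode_ops g _ s' fun m' live => ind (¬(live.replies.length = P.rounds ∧
      P.check live.coins live.replies (m'.ans 0) = true)), hu.1, memExec_loop, hpl.num,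
      hm.params.r10]
    have htr : Trying st ρ (C.play ρ x h P.rounds).1 m.bit s'.memory :=
      ⟨⟨by rw [hpl.num, hr.rounds], by rw [hpl.num, hr.one], by rw [hpl.num, hr.first],
        by rw [hpl.num, hr.remaining], hr.le⟩, by rw [hpl.num, hm.stage],
        by rw [hpl.num, hm.params.r25], hpl.solver, fun j _ => by rw [hpl.bit]⟩
    refine le_trans (ev_mono fun m' => ind_mono (mt fun h' => ?_)) (ev_trials_le (g := g) (ε := ε)
      (δ := δ) (T := T) htr (by rw [SolverCircuit.play_length, hm.length]; ring) (5 * (k * K)))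
    rw [hpl.live]
    exact ⟨SolverCircuit.play_replies_length _ _, h'⟩
  rw [pr_not] at key
  nlinarith

theorem le_successProb_built (hg : Monotone g) (hk : 1 ≤ k) (hK : 1 ≤ K) (h0 : 0 ≤ δ) (h1 : δ ≤ 1)
    (hm : AtStage δ n K st m) (hr : Ready (st + 1) m) (ha : Advantage g δ K st m)
    (ht : Terminal g δ K st m) : δ + 1 / (k * K) / 3 ≤ (built m).successProb g := by
  have hN : (0 : ℝ) < Fintype.card (Word P.coins) := by exact_mod_cast Fintype.card_pos
  have e1 : (built m).successProb g = pr ((PMF.uniformOfFintype (Word P.coins)).bind fun x =>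
      (built m).run g x) fun s => s.live.replies.length = P.rounds ∧
        P.check s.live.coins s.live.replies (s.memory.ans 0) = true := by
    rw [Solver.successProb, prob_eq]; rfl
  rw [e1, pr_bind_uniform, le_div_iff₀ hN]
  exact (le_sum_trials hg hk hK h0 h1 hm ha ht).trans
    (Finset.sum_le_sum fun x _ => le_pr_run 0 hm hr x)

/-! ## It does not rewind -/

/-- The operation calls only copy `c` of the solver, and does not start or duplicate copies. -/
def Op.usesOnly (c : ℕ) : Op → Bool
  | .stepC d _ _ => decide (d = c)
  | .outC d _ => decide (d = c)
  | .newC _ => false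
  | .copyC _ _ => false
  | _ => true

theorem mem_unroll {p : Op → Bool} {q : ℕ → Bool} {v : ℕ → ℕ} {c : Program}
    (hc : c.all p q = true) {o : Op} (ho : o ∈ c.unroll v) : p o = true := by
  induction c with
  | op o' =>
    rw [unroll, List.mem_singleton] at ho
    exact ho ▸ hc
  | seq c₁ c₂ ih₁ ih₂ =>
    simp only [all, Bool.and_eq_true] at hc
    rw [unroll, List.mem_append] at ho
    exact ho.elim (ih₁ hc.1) (ih₂ hc.2)
  | loop a c ih =>
    simp only [unroll, List.mem_flatten, List.mem_replicate] at ho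
    obtain ⟨l, ⟨_, rfl⟩, ho⟩ := ho
    exact ih hc ho
  | _ => simp [unroll] at ho

/-- The part of a trial after the duplication of the solver. -/
def trialTail : Program :=
  seq (block [op (.copy 17 14), loop 12 playFresh, op (.outC 1 0), op (.copy 17 14),
    loop 12 checkInstance]) (block [op (.setBit 13 4), op (.evalG 23), op (.setBit 13 25),
      op (.evalG 24), op (.lt 18 24 23), op (.select 1 0 13), op (.condAns 18 0 1)])

/-- The duplication of copy 0 is the only operation of a trial that reads copy 0. Everything after
it uses copy 1 alone and only moves it forward, which settles both the rewinding and the size. -/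
theorem unroll_trial (v : ℕ → ℕ) : trial.unroll v = .copyC 1 0 :: trialTail.unroll v := rfl

theorem always_runCode_ops {I : SolverState C → Prop} {l : List Op}
    (h : ∀ o ∈ l, ∀ s, I s → Always ((Instr.op o).exec g s) I) {s : SolverState C} (hs : I s) :
    Always (runCode g (l.map Instr.op) s) I := by
  induction l generalizing s with
  | nil => exact always_pure hs
  | cons o l ih =>
    exact (h o List.mem_cons_self s hs).bind fun s' hs' =>
      ih (fun o' ho' => h o' (List.mem_cons_of_mem _ ho')) hs'

/-- The copy of the solver continues the execution with the random bits `ρ` and messages `h`. -/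
def Continues (ρ : Word C.coins) (h : List (Word P.msgLen)) (q : SolverCopy C) : Prop :=
  q.coins = ρ ∧ h <:+ q.hist

theorem Continues.push {ρ : Word C.coins} {h : List (Word P.msgLen)} {q : SolverCopy C}
    (hq : Continues ρ h q) (x : Word P.msgLen) : Continues ρ h (q.push x) := by
  unfold SolverCopy.push
  split
  · exact ⟨hq.1, hq.2.trans (List.suffix_cons _ _)⟩
  · exact hq

theorem always_continues {c : ℕ} {ρ : Word C.coins} {h : List (Word P.msgLen)} {o : Op}
    (ho : o.usesOnly c = true) {m : Memory C} (hm : Continues ρ h (m.solvers c)) :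
    Always (o.exec g m) fun m' => Continues ρ h (m'.solvers c) ∧
      (∀ d ≠ c, m'.solvers d = m.solvers d) ∧ ∀ q ∈ o.calls m', Continues ρ h q := by
  cases o with
  | stepC d x y =>
    simp only [Op.usesOnly, decide_eq_true_eq] at ho
    subst ho
    refine always_pure ⟨?_, fun c hc => ?_, ?_⟩
    · simpa using hm.push _
    · simp [hc]
    · simpa [Op.calls] using hm.push _
  | outC d o =>
    simp only [Op.usesOnly, decide_eq_true_eq] at ho
    subst ho
    exact always_pure ⟨hm, fun _ _ => rfl, by simpa [Op.calls] using hm⟩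
  | newC | copyC => simp [Op.usesOnly] at ho
  | coin | newP => exact always_map fun _ => ⟨hm, fun _ _ => rfl, by simp [Op.calls]⟩
  | _ => exact always_pure ⟨hm, fun _ _ => rfl, by simp [Op.calls]⟩

/-- All calls so far are part of an execution with the random bits `ρ` that begins with the
messages `h`. -/
structure Rooted (ρ : Word C.coins) (h : List (Word P.msgLen)) (live : PoserCopy P)
    (s : SolverState C) : Prop where
  live : s.live = live
  solver : s.memory.solvers 0 = ⟨ρ, h⟩
  calls : ∀ q ∈ s.calls, q.coins = ρ ∧ (h <:+ q.hist ∨ q.hist <:+ h)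

theorem always_rooted_trial {ρ : Word C.coins} {h : List (Word P.msgLen)} {live : PoserCopy P}
    {s : SolverState C} (hs : Rooted ρ h live s) (v : ℕ → ℕ) :
    Always (runCode g ((trial.unroll v).map Instr.op) s) (Rooted ρ h live) := by
  rw [unroll_trial, List.map_cons, runCode]
  refine Always.bind (A := fun s' => Rooted ρ h live s' ∧ Continues ρ h (s'.memory.solvers 1)) ?_
    fun s' hs' => (always_runCode_ops (I := fun s' => Rooted ρ h live s' ∧
      Continues ρ h (s'.memory.solvers 1)) (fun o ho s' hs' => ?_) hs').mono fun _ h => h.1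
  · simp only [Instr.exec, Op.exec, PMF.pure_map]
    exact always_pure ⟨⟨hs.live, by simpa using hs.solver, by simpa [Op.calls] using hs.calls⟩,
      by simp [hs.solver, Continues]⟩
  · have hu : o.usesOnly 1 = true := mem_unroll (q := fun _ => false) (c := trialTail) (by rfl) ho
    refine (always_continues hu hs'.2).map fun m' ⟨h1, h2, h3⟩ =>
      ⟨⟨hs'.1.live, (h2 0 (by norm_num)).trans hs'.1.solver, fun q hq => ?_⟩, h1⟩
    rcases List.mem_append.1 hq with hq | hq
    · exact hs'.1.calls q hq
    · exact ⟨(h3 q hq).1, Or.inl (h3 q hq).2⟩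

theorem always_rooted_trials {ρ : Word C.coins} {h : List (Word P.msgLen)} {live : PoserCopy P}
    (v : ℕ → ℕ) (t : ℕ) {s : SolverState C} (hs : Rooted ρ h live s) :
    Always (runCode g (((List.replicate t (trial.unroll v)).flatten).map Instr.op) s)
      (Rooted ρ h live) := by
  induction t generalizing s with
  | zero => exact always_pure hs
  | succ t ih =>
    rw [List.replicate_succ, List.flatten_cons, List.map_append, runCode_append]
    exact (always_rooted_trial hs v).bind fun s' hs' => ih hs'

/-- The fixed messages are the hardwired history of copy 0. Calls during the live phase see an
initial part of the transcript with the actual poser, and calls in trials continue that transcript.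
Lists have the latest message first, so initial parts appear as suffixes. -/
theorem nonRewinding_built (hm : AtStage δ n K st m) : (built m).NonRewinding g := by
  set ρ := (m.solvers 0).coins
  set h := (m.solvers 0).hist
  refine ⟨st, hm.lt, h.reverse, by rw [List.length_reverse, hm.length], fun x => ?_⟩
  have key : Always ((built m).run g x) (Rooted ρ (C.play ρ x h P.rounds).1
      ⟨x, (C.play ρ x h P.rounds).2⟩) := by
    rw [Solver.run, built, builtCode, runCode_append, hm.params.r2]
    refine (always_liveCode (ρ := ρ) (h := h) rfl hm.length_add_le P.rounds le_rfl).bind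
      fun s hs => always_rooted_trials m.num _ ⟨hs.live, hs.solver, fun q hq => ?_⟩
    exact ⟨(hs.calls q hq).1, Or.inr (hs.calls q hq).2⟩
  intro s hs
  have hR := key s hs
  refine ⟨⟨ρ, fun q hq => (hR.calls q hq).1⟩, fun q hq => ?_⟩
  rw [hR.live, ← List.reverse_append, ← play_eq_messages]
  rcases (hR.calls q hq).2 with hq | hq
  · have hl : (st + 1) * P.rounds = (C.play ρ x h P.rounds).1.reverse.length := by
      rw [List.length_reverse, SolverCircuit.play_length, hm.length]; ring
    rw [hl, ← List.prefix_iff_eq_take.1 (List.reverse_prefix.2 hq)]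
  · exact (List.take_prefix _ _).trans (List.reverse_prefix.2 hq)

/-! ## Its size -/

/-- The numbers of messages that the copies of `C` have received after a sequence of
instructions. -/
def stagesAfter (P : Puzzle) (k : ℕ) : (ℕ → ℕ) → List Instr → ℕ → ℕ
  | stage, [] => stage
  | stage, i :: l => stagesAfter P k (i.nextStage P k stage) l

theorem codeSize_append (stage : ℕ → ℕ) (l l' : List Instr) :
    codeSize C stage (l ++ l') = codeSize C stage l +
      codeSize C (stagesAfter P k stage l) l' := by
  induction l generalizing stage with
  | nil => simp [codeSize, stagesAfter]
  | cons i l ih => simp only [List.cons_append, codeSize, ih, stagesAfter, add_assoc]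

/-- The number of gates in the circuits for the messages from number `a` on. -/
def SolverCircuit.sizeFrom (C : SolverCircuit P k) (a : ℕ) : ℕ :=
  ∑ s ∈ Finset.Ico a (k * P.rounds), C.stepSize s

theorem sizeFrom_eq {a : ℕ} (ha : a < k * P.rounds) :
    C.sizeFrom a = C.stepSize a + C.sizeFrom (a + 1) := Finset.sum_eq_sum_Ico_succ_bot ha _

theorem sizeFrom_le (a : ℕ) : C.sizeFrom a + C.out.size ≤ C.size := by
  have h1 : C.sizeFrom a ≤ ∑ s ∈ Finset.range (k * P.rounds), C.stepSize s := by
    refine Finset.sum_le_sum_of_subset fun s hs => ?_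
    rw [Finset.mem_range]
    exact (Finset.mem_Ico.1 hs).2
  have h2 : ∑ s ∈ Finset.range (k * P.rounds), C.stepSize s =
      ∑ s : Fin (k * P.rounds), (C.step s).size := by
    rw [Finset.sum_range]
    refine Finset.sum_congr rfl fun s _ => ?_
    rw [SolverCircuit.stepSize, dif_pos s.2]
  unfold SolverCircuit.size
  omega

/-- The bound is an identity with the remaining circuits added on the left, which avoids a
subtraction of natural numbers. -/
theorem codeSize_liveCode (t : ℕ) (stage : ℕ → ℕ) (ht : stage 0 + t ≤ k * P.rounds) :
    codeSize C stage (liveCode t) + C.sizeFrom (stage 0 + t) = C.sizeFrom (stage 0) ∧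
      stagesAfter P k stage (liveCode t) 0 = stage 0 + t := by
  induction t generalizing stage with
  | zero => simp [liveCode, codeSize, stagesAfter]
  | succ t ih =>
    have h1 : stage 0 < k * P.rounds := by omega
    have := ih (Function.update stage 0 (stage 0 + 1)) (by rw [Function.update_self]; omega)
    rw [Function.update_self] at this
    rw [liveCode, List.replicate_succ, List.flatten_cons, ← liveCode]
    have h2 : Instr.nextStage P k (Instr.nextStage P k stage (.recv 0)) (.op (.stepC 0 0 0)) =
        Function.update stage 0 (stage 0 + 1) := by
      change Function.update stage 0 (if stage 0 < k * P.rounds then stage 0 + 1 else stage 0) = _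
      rw [if_pos h1]
    simp only [List.cons_append, List.nil_append, codeSize, stagesAfter, h2, sizeFrom_eq h1]
    change 0 + (C.stepSize (stage 0) + (0 + codeSize C (Function.update stage 0 (stage 0 + 1))
      (liveCode t))) + _ = _ ∧ stagesAfter P k (Function.update stage 0 (stage 0 + 1))
        (liveCode t) 0 = _
    constructor
    · rw [show stage 0 + (t + 1) = stage 0 + 1 + t by omega]
      omega
    · rw [this.2]; omega

/-- The operation lets a copy of the solver compute its answers. -/
def Op.isOut : Op → Bool
  | .outC _ _ => true
  | _ => false

/-- Without `newC` and `copyC` a copy never goes back, so each of its message circuits is paid for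
at most once. -/
theorem codeSize_ops_le {c : ℕ} {l : List Op} (hl : ∀ o ∈ l, o.usesOnly c = true)
    (stage : ℕ → ℕ) : codeSize C stage (l.map Instr.op) ≤
      C.sizeFrom (stage c) + l.countP Op.isOut * C.out.size ∧ ∀ d ≠ c,
        stagesAfter P k stage (l.map Instr.op) d = stage d := by
  induction l generalizing stage with
  | nil => simp [codeSize, stagesAfter]
  | cons o l ih =>
    have ih' := ih fun o' ho' => hl o' (List.mem_cons_of_mem _ ho')
    have ho := hl o List.mem_cons_self
    rw [List.map_cons, codeSize, stagesAfter, List.countP_cons]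
    cases o with
    | stepC d x y =>
      simp only [Op.usesOnly, decide_eq_true_eq] at ho
      subst ho
      simp only [Instr.gates, Instr.nextStage, Op.isOut, Bool.false_eq_true, if_false, add_zero]
      by_cases hd : stage d < k * P.rounds
      · simp only [if_pos hd]
        have := ih' (Function.update stage d (stage d + 1))
        rw [Function.update_self] at this
        refine ⟨by rw [sizeFrom_eq hd]; omega, fun c hc => ?_⟩
        rw [this.2 c hc, Function.update_of_ne hc]
      · simp only [if_neg hd, Function.update_eq_self, SolverCircuit.stepSize, dif_neg hd, zero_add]
        exact ih' stage
    | outC d o =>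
      simp only [Instr.gates, Instr.nextStage, Op.isOut, if_true, add_mul, one_mul]
      exact ⟨by have := (ih' stage).1; omega, (ih' stage).2⟩
    | newC | copyC => simp [Op.usesOnly] at ho
    | _ =>
      simp only [Instr.gates, Instr.nextStage, Op.isOut, Bool.false_eq_true, if_false, add_zero,
        zero_add]
      exact ih' stage

theorem countP_trialTail (v : ℕ → ℕ) : (trialTail.unroll v).countP Op.isOut = 1 := by
  simp [trialTail, block, unroll, playFresh, playInstance, checkInstance, Op.isOut,
    List.countP_cons, List.countP_append, List.countP_flatten]

theorem codeSize_trial_le (v stage : ℕ → ℕ) :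
    codeSize C stage ((trial.unroll v).map Instr.op) ≤ C.sizeFrom (stage 0) + C.out.size ∧
      stagesAfter P k stage ((trial.unroll v).map Instr.op) 0 =
        stage 0 := by
  have := codeSize_ops_le (C := C) (c := 1) (l := trialTail.unroll v)
    (fun o ho => mem_unroll (q := fun _ => false) (c := trialTail) (by rfl) ho)
    (Function.update stage 1 (stage 0))
  rw [countP_trialTail, one_mul, Function.update_self] at this
  rw [unroll_trial, List.map_cons, codeSize, stagesAfter]
  refine ⟨by simpa [Instr.gates, Instr.nextStage] using this.1, ?_⟩
  simpa [Instr.nextStage] using this.2 0 (by norm_num)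

theorem codeSize_trials_le (v : ℕ → ℕ) (t : ℕ) (stage : ℕ → ℕ) :
    codeSize C stage (((List.replicate t (trial.unroll v)).flatten).map Instr.op) ≤
      t * (C.sizeFrom (stage 0) + C.out.size) := by
  induction t generalizing stage with
  | zero => simp [codeSize]
  | succ t ih =>
    rw [List.replicate_succ, List.flatten_cons, List.map_append, codeSize_append]
    have h1 := codeSize_trial_le (C := C) v stage
    have h2 := ih (stagesAfter P k stage ((trial.unroll v).map Instr.op))
    rw [h1.2] at h2
    rw [add_mul, one_mul]
    omega

/-- The circuit `start` is never evaluated, since the present state of copy 0 is hardwired. The live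
phase is paid for once; each trial pays only for the later messages and the answers. As there is at
least one trial, the live phase can be charged to the trials. -/
theorem size_built_le (hk : 1 ≤ k) (hK : 1 ≤ K) (hm : AtStage δ n K st m) :
    (built m).size ≤ 5 * (k * K) * C.size := by
  have h1 := codeSize_liveCode (C := C) P.rounds (fun c => (m.solvers c).hist.length)
    hm.length_add_le
  simp only [Solver.size, built, builtCode, codeSize_append, unroll, hm.params.r2, hm.params.r10]
  have h2 := codeSize_trials_le (C := C) m.num (5 * (k * K)) (stagesAfter P k
    (fun c => (m.solvers c).hist.length) (liveCode P.rounds))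
  rw [h1.2] at h2
  have h3 := sizeFrom_le (C := C) (m.solvers 0).hist.length
  have h4 : 1 ≤ 5 * (k * K) := by nlinarith
  nlinarith [h1.1]

end Built

end WVP

/-! ### The generating algorithm: running time, failure probability, final constants. -/

namespace WVP
open scoped ENNReal

section Generator

open Program

variable {P : Puzzle} {k : ℕ} {C : SolverCircuit P k} {g : Word k → Bool} {ε δ : ℝ} {n K : ℕ}

/-! ## The computation of the parameters -/

theorem always_setup {s : ProgramState C} (h0 : s.memory.num 0 = k) (h1 : s.memory.num 1 = n)
    (h2 : s.memory.num 2 = P.rounds) (h3 : s.memory.num 3 = K)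
    (h : ∀ j, 4 ≤ j → s.memory.num j = 0) (hs : (s.memory.solvers 0).hist = []) :
    Always (setup.exec g ε δ s) fun s' => Initial δ n K s'.memory := by
  simp only [setup, block, exec, Op.exec, PMF.pure_bind, PMF.pure_map]
  refine always_pure ⟨?_, ?_, ?_, ?_, hs⟩
  · have e : k * K * k * 64 = 64 * (k * K) * k := by ring
    constructor <;> simp [h0, h1, h2, h3, h, e, sampleScale, -mul_eq_mul_right_iff,
      -mul_eq_mul_left_iff] <;> ring
  · simp [h]
  · simp [h]
  · simp [h0, h1, h3, sampleScale]
    ring_nf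

theorem size_le_of_le {x y : ℕ} (h : x ≤ y) : x.size ≤ y :=
  (Nat.size_le.2 Nat.lt_two_pow_self).trans h

/-- The number of binary digits of an operand is bounded crudely by the operand itself. All
operands, and the precision requested for δ, are at most a constant times B^4. -/
theorem always_setup_time {s : ProgramState C} (h0 : s.memory.num 0 = k) (h1 : s.memory.num 1 = n)
    (h3 : s.memory.num 3 = K) (ht : s.time = 0) {B : ℕ} (hB : 1 ≤ B) (hk : k ≤ B) (hn : n ≤ B)
    (hK : K ≤ B) : Always (setup.exec g ε δ s) fun s' => s'.time ≤ 1000000 * B ^ 4 := by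
  simp only [setup, block, exec, Op.exec, PMF.pure_bind, PMF.pure_map]
  refine always_pure ?_
  simp only [ne_eq, Nat.reduceEqDiff, not_false_eq_true, Function.update_of_ne,
    Function.update_self, h0, h1, h3, ht, OfNat.zero_ne_ofNat, OfNat.one_ne_ofNat]
  have b1 : B ≤ B ^ 4 := by simpa using Nat.pow_le_pow_right hB (show 1 ≤ 4 by norm_num)
  have b2 : B ^ 2 ≤ B ^ 4 := Nat.pow_le_pow_right hB (by norm_num)
  have b3 : B ^ 3 ≤ B ^ 4 := Nat.pow_le_pow_right hB (by norm_num)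
  have b0 : 1 ≤ B ^ 4 := Nat.one_le_pow _ _ hB
  have z1 : k * K ≤ B ^ 2 := by rw [sq]; exact Nat.mul_le_mul hk hK
  have z2 : k * K * (k + n) ≤ 2 * B ^ 3 := by
    have := Nat.mul_le_mul z1 (show k + n ≤ 2 * B by omega)
    linarith [show B ^ 2 * (2 * B) = 2 * B ^ 3 by ring]
  have z3 : (4 * (k * K) + n) * (k * K) ≤ 5 * B ^ 4 := by
    have b4 : B ≤ B ^ 2 := by simpa using Nat.pow_le_pow_right hB (show 1 ≤ 2 by norm_num)
    have := Nat.mul_le_mul (show 4 * (k * K) + n ≤ 5 * B ^ 2 by omega) z1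
    linarith [show 5 * B ^ 2 * B ^ 2 = 5 * B ^ 4 by ring]
  have z4 : k * K * k ≤ B ^ 3 := by
    have := Nat.mul_le_mul z1 hk
    linarith [show B ^ 2 * B = B ^ 3 by ring]
  have s1 := size_le_of_le hk
  have s2 := size_le_of_le hK
  have s3 := size_le_of_le z1
  have s4 := size_le_of_le (show k + n ≤ 2 * B by omega)
  have s5 := size_le_of_le z2
  have s6 := size_le_of_le (show 4 * (k * K) + n ≤ 5 * B ^ 4 by omega)
  have s7 := size_le_of_le z3
  have s8 := size_le_of_le (Nat.mul_le_mul_right 1024 z3)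
  have s9 := size_le_of_le (Nat.mul_le_mul_right 8 (Nat.mul_le_mul_right 1024 z3))
  have s10 := size_le_of_le z4
  have s11 := size_le_of_le (le_refl 16)
  have s12 := size_le_of_le (le_refl 4)
  have s13 := size_le_of_le (le_refl 1024)
  have s14 := size_le_of_le (le_refl 8)
  have s15 := size_le_of_le (le_refl 64)
  have s16 := size_le_of_le (le_refl 5)
  omega

/-! ## The running time -/

namespace Program

/-- The loops of the program are governed by registers in `S`. -/
def loopsIn (S : ℕ → Bool) : Program → Bool
  | seq c₁ c₂ => c₁.loopsIn S && c₂.loopsIn S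
  | ite _ c₁ c₂ => c₁.loopsIn S && c₂.loopsIn S
  | loop a c => S a && c.loopsIn S
  | _ => true

/-- A bound for the degree of the running time, if the registers that govern the loops are bounded
by polynomials of degree `d`. -/
def degree (d : ℕ) : Program → ℕ
  | seq c₁ c₂ => max (c₁.degree d) (c₂.degree d) + 1
  | ite _ c₁ c₂ => max (c₁.degree d) (c₂.degree d) + 2
  | loop _ c => d + (c.degree d + 1) + 1
  | _ => 0

theorem add_le_pow {B x y i j : ℕ} (hB : 2 ≤ B) (hx : x ≤ B ^ i) (hy : y ≤ B ^ j) :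
    x + y ≤ B ^ (max i j + 1) := by
  have h1 : B ^ i ≤ B ^ max i j := Nat.pow_le_pow_right (by omega) (le_max_left _ _)
  have h2 : B ^ j ≤ B ^ max i j := Nat.pow_le_pow_right (by omega) (le_max_right _ _)
  calc x + y ≤ B ^ max i j * 2 := by omega
    _ ≤ _ := by rw [pow_succ]; exact Nat.mul_le_mul_left _ hB

theorem one_add_le_pow {B x i : ℕ} (hB : 2 ≤ B) (hx : x ≤ B ^ i) : 1 + x ≤ B ^ (i + 1) := by
  simpa using add_le_pow hB (x := 1) (i := 0) (by simp) hx

/-- Since B ≥ 2, a sum or an additional step is absorbed by one more factor B, and nested loops add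
exponents. -/
theorem cost_le {B d : ℕ} (hB : 2 ≤ B) {S : ℕ → Bool} {v : ℕ → ℕ}
    (hv : ∀ j, S j = true → v j ≤ B ^ d) {c : Program} (hc : c.loopsIn S = true) :
    c.cost v ≤ B ^ c.degree d := by
  induction c with
  | seq c₁ c₂ ih₁ ih₂ =>
    simp only [loopsIn, Bool.and_eq_true] at hc
    exact add_le_pow hB (ih₁ hc.1) (ih₂ hc.2)
  | ite a c₁ c₂ ih₁ ih₂ =>
    simp only [loopsIn, Bool.and_eq_true] at hc
    exact one_add_le_pow hB (add_le_pow hB (ih₁ hc.1) (ih₂ hc.2))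
  | loop a c ih =>
    simp only [loopsIn, Bool.and_eq_true] at hc
    refine one_add_le_pow hB ?_
    rw [pow_add]
    exact Nat.mul_le_mul (hv a hc.1) (one_add_le_pow hB (ih hc.2))
  | _ => simp [cost, degree]

end Program

/-- The registers that govern the loops. -/
def loopRegisters (j : ℕ) : Bool :=
  decide (j = 2 ∨ j = 5 ∨ j = 6 ∨ j = 7 ∨ j = 9 ∨ j = 10 ∨ j = 12)

/-- The exponent 22 = 3 + 10 + 2 + 5 + 2 comes from the number of samples in register 6; constants
are bounded by powers of 2 and hence of B. Register 12 is represented by its bound k. -/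
theorem Params.num_le {m : Memory C} (hm : Params δ n K m) {B : ℕ} (hB : 2 ≤ B) (hk : k ≤ B)
    (hn : n ≤ B) (hK : K ≤ B) (hr : P.rounds ≤ B) (j : ℕ) (hj : loopRegisters j = true) :
    Function.update m.num 12 k j ≤ B ^ 22 := by
  have b1 : ∀ i ≤ 22, B ^ i ≤ B ^ 22 := fun i hi => Nat.pow_le_pow_right (by omega) hi
  have b2 : B ≤ B ^ 22 := by simpa using b1 1 (by norm_num)
  have b3 : ∀ i, 2 ^ i ≤ B ^ i := fun i => Nat.pow_le_pow_left hB i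
  have z1 : k * K ≤ B ^ 2 := by rw [sq]; exact Nat.mul_le_mul hk hK
  have b4 : B ≤ B ^ 2 := by simpa using Nat.pow_le_pow_right (by omega) (show 1 ≤ 2 by norm_num)
  have mul : ∀ {x y i j : ℕ}, x ≤ B ^ i → y ≤ B ^ j → x * y ≤ B ^ (i + j) := by
    intro x y i j hx hy
    rw [pow_add]
    exact Nat.mul_le_mul hx hy
  have z2 : n + k ≤ B ^ 2 := by
    rw [sq]
    exact (show n + k ≤ 2 * B by omega).trans (Nat.mul_le_mul_right _ hB)
  have z3 : n + 4 * (k * K) ≤ B ^ 5 :=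
    (show n + 4 * (k * K) ≤ 2 ^ 3 * B ^ 2 by omega).trans (mul (b3 3) le_rfl)
  simp only [loopRegisters, decide_eq_true_eq] at hj
  rcases hj with rfl | rfl | rfl | rfl | rfl | rfl | rfl
  · simpa [hm.r2] using hr.trans b2
  · simp only [ne_eq, Nat.reduceEqDiff, not_false_eq_true, Function.update_of_ne, hm.r5]
    exact (mul (mul (i := 4) (b3 4) z1) z2).trans (b1 _ (by norm_num))
  · simp only [ne_eq, Nat.reduceEqDiff, not_false_eq_true, Function.update_of_ne, hm.r6, sampleScale]
    exact (mul (mul (i := 3) (b3 3) (mul (mul (i := 10) (b3 10) z1) z3)) z1).trans (b1 _ (by norm_num))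
  · simp only [ne_eq, Nat.reduceEqDiff, not_false_eq_true, Function.update_of_ne, hm.r7]
    exact (mul (mul (i := 6) (b3 6) z1) (j := 1) (by simpa using hk)).trans (b1 _ (by norm_num))
  · simp only [ne_eq, Nat.reduceEqDiff, not_false_eq_true, Function.update_of_ne, hm.r9]
    exact (Nat.sub_le _ _).trans (hk.trans b2)
  · simp only [ne_eq, Nat.reduceEqDiff, not_false_eq_true, Function.update_of_ne, hm.r10]
    exact (mul (i := 3) ((show 5 ≤ 2 ^ 3 by norm_num).trans (b3 3)) z1).trans (b1 _ (by norm_num))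
  · simpa using hk.trans b2

/-! ## The algorithm -/

/-- The degree of the running time of the algorithm. -/
def timeDegree : ℕ := max 24 ((seq fixInstances emission).degree 22) + 1

/-- The initial state of the algorithm. -/
noncomputable def initialState (C : SolverCircuit P k) (ε : ℝ) (n : ℕ) : ProgramState C :=
  ⟨Memory.initial C ε n, [], 0⟩

theorem run_generator : generator.run C g ε δ n = (setup.exec g ε δ (initialState C ε n)).bind
    fun s => (fixInstances.exec g ε δ s).bind (emission.exec g ε δ) := rfl

theorem always_setup_initial : Always (setup.exec g ε δ (initialState C ε n)) fun s =>
    Initial δ n ⌈1 / ε⌉₊ s.memory ∧ s.code = [] :=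
  (always_setup (s := initialState C ε n) rfl rfl rfl rfl (fun j hj => by
    have : j ≠ 0 ∧ j ≠ 1 ∧ j ≠ 2 ∧ j ≠ 3 := by omega
    simp [initialState, Memory.initial, this]) rfl).and
    (always_code_eq (p := fun _ => true) (q := fun _ => true) (by rfl) _)

theorem always_fixInstances_code (s : ProgramState C) :
    Always (fixInstances.exec g ε δ s) fun s' => s'.code = s.code :=
  always_code_eq (p := fun _ => true) (q := fun _ => true) (by rfl) s

theorem always_generator (hk : 1 ≤ k) : Always (generator.run C g ε δ n) fun s =>
    (∃ st, AtStage δ n ⌈1 / ε⌉₊ st s.memory) ∧ s.code = builtCode s.memory := by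
  rw [run_generator]
  refine always_setup_initial.bind fun s hs => ((Program.Always.exec_memory
    (always_fixInstances hk hs.1)).and (always_fixInstances_code s)).bind fun s' hs' =>
      (always_emission s' (hs'.2.trans hs.2)).mono fun s'' hs'' => ?_
  obtain ⟨⟨st, h, _⟩, _⟩ := hs'
  exact ⟨⟨st, hs''.1 ▸ h⟩, by rw [hs''.2, hs''.1]⟩

/-- The frame that consists of register 12. -/
def registerFrame : Frame where
  num j := decide (j = 12)
  solver _ := false
  ans _ := false
  bit := false
  posers := false
  outs := false

theorem always_generator_time {B : ℕ} (hB : 2 ≤ B) (hk : k ≤ B) (hn : n ≤ B)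
    (hK : ⌈1 / ε⌉₊ ≤ B) (hr : P.rounds ≤ B) : Always (generator.run C g ε δ n) fun s =>
    s.time ≤ B ^ timeDegree ∧ s.code.length ≤ s.time := by
  refine Always.and ?_ (always_code_length generator (s := initialState C ε n) le_rfl)
  refine ((always_setup_initial.and (always_setup_time (s := initialState C ε n) rfl rfl rfl rfl
    (by omega) hk hn hK)).and (Program.Always.exec_memory
      (Frame.always registerFrame (by rfl) _))).bind fun s hs => ?_
  obtain ⟨⟨⟨h1, _⟩, h2⟩, h3⟩ := hs
  -- Register 12 is still zero after the setup; later it never exceeds register 0, which holds k.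
  have hb : Bounded (Function.update s.memory.num 12 k) s.memory := by
    refine ⟨fun j hj => by rw [Function.update_of_ne (by omega)], ?_⟩
    rw [h3.num 12 rfl]
    exact Nat.zero_le _
  have := always_time (v := Function.update s.memory.num 12 k) (by simp [h1.params.r0]) (g := g)
    (ε := ε) (δ := δ) (c := seq fixInstances emission) (by rfl) hb
  refine this.mono fun s' hs' => hs'.2.trans ?_
  refine Program.add_le_pow hB (h2.trans ?_)
    (cost_le hB (h1.params.num_le hB hk hn hK hr) (by rfl))
  calc 1000000 * B ^ 4 ≤ 2 ^ 20 * B ^ 4 := Nat.mul_le_mul_right _ (by norm_num)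
    _ ≤ B ^ 20 * B ^ 4 := Nat.mul_le_mul_right _ (Nat.pow_le_pow_left hB 20)
    _ = B ^ 24 := by ring

/-! ## The failure probability -/

/-- The wrong estimates contribute 16kz(n + k)e^(-(n+4z)) with z = kK. From k ≤ z and n + k ≤ (n+1)z
this is at most 16(n+1)e^(-n), as ye^(-y) ≤ 1 is used for three factors z. The missed candidates
contribute at most ke^(-(n+k)) ≤ e^(-n). Finally e ≥ 2. -/
theorem searchFailure_le (hk : 1 ≤ k) (hK : 1 ≤ K) :
    (k : ℝ≥0∞) * searchFailure k n K ≤ ENNReal.ofReal (17 * (n + 1) / 2 ^ n) := by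
  have hk' : (1 : ℝ) ≤ k := by exact_mod_cast hk
  have hK' : (1 : ℝ) ≤ K := by exact_mod_cast hK
  set z : ℝ := (k : ℝ) * K with hz
  have hkz : (k : ℝ) ≤ z := by nlinarith
  have hz1 : 1 ≤ z := hk'.trans hkz
  have hβ : 0 ≤ 1 - 1 / (16 * z) := by
    rw [sub_nonneg, div_le_one (by positivity)]; linarith
  have e1 : (k : ℝ≥0∞) * searchFailure k n K = ENNReal.ofReal (k * (16 * z * (n + k) *
      Real.exp (-(n + 4 * z)) + (1 - 1 / (16 * z)) ^ (16 * (k * K) * (n + k)))) := by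
    rw [ENNReal.ofReal_mul (by positivity), ENNReal.ofReal_add (by positivity) (by positivity),
      ENNReal.ofReal_mul (by positivity), ENNReal.ofReal_pow hβ, ENNReal.ofReal_natCast,
      searchFailure, failure, ← hz]
    congr 3
    rw [← ENNReal.ofReal_natCast]
    push_cast
    rw [hz]
  rw [e1]
  refine ENNReal.ofReal_le_ofReal ?_
  have f1 : (1 - 1 / (16 * z)) ^ (16 * (k * K) * (n + k)) ≤ Real.exp (-(n + k)) := by
    have := pow_le_pow_left₀ hβ (Real.one_sub_le_exp_neg (1 / (16 * z))) (16 * (k * K) * (n + k))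
    refine this.trans (le_of_eq ?_)
    rw [← Real.exp_nat_mul]
    push_cast
    rw [← hz]
    congr 1
    field_simp
  have f2 : Real.exp (-(n : ℝ)) ≤ 1 / 2 ^ n := by
    rw [Real.exp_neg, ← one_div]
    refine one_div_le_one_div_of_le (by positivity) ?_
    rw [← Real.exp_one_pow]
    have := Real.add_one_le_exp (1 : ℝ)
    exact pow_le_pow_left₀ (by norm_num) (by linarith) n
  have f3 : ∀ y : ℝ, 0 ≤ y → y * Real.exp (-y) ≤ 1 := by
    intro y hy
    rw [Real.exp_neg, ← div_eq_mul_inv, div_le_one (Real.exp_pos _)]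
    linarith [Real.add_one_le_exp y]
  have hE := Real.exp_pos (-(n : ℝ))
  have hn : (0 : ℝ) ≤ n := Nat.cast_nonneg n
  have f4 : (k : ℝ) * Real.exp (-(n + k)) ≤ Real.exp (-(n : ℝ)) := by
    rw [neg_add, Real.exp_add]
    have := mul_le_mul_of_nonneg_left (f3 k (by linarith)) hE.le
    linarith
  have f5 : k * (16 * z * (n + k) * Real.exp (-(n + 4 * z))) ≤ 16 * (n + 1) * Real.exp (-(n : ℝ)) := by
    have hZ := Real.exp_pos (-z)
    have e2 : Real.exp (-(n + 4 * z)) = Real.exp (-(n : ℝ)) * Real.exp (-z) ^ 4 := by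
      rw [← Real.exp_nat_mul, ← Real.exp_add]
      congr 1
      push_cast
      ring
    have f6 := f3 z (by linarith)
    have f7 : z ^ 3 * Real.exp (-z) ^ 3 ≤ 1 := by
      rw [← mul_pow]
      exact pow_le_one₀ (by positivity) f6
    have f8 : Real.exp (-z) ≤ 1 := Real.exp_le_one_iff.2 (by linarith)
    have f9 : k * (z * (n + k)) ≤ (n + 1) * z ^ 3 := by
      have : (n : ℝ) + k ≤ (n + 1) * z := by nlinarith
      calc k * (z * (n + k)) ≤ z * (z * ((n + 1) * z)) := by gcongr
        _ = _ := by ring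
    rw [e2]
    calc k * (16 * z * (n + k) * (Real.exp (-(n : ℝ)) * Real.exp (-z) ^ 4))
        = 16 * (k * (z * (n + k))) * (Real.exp (-(n : ℝ)) * Real.exp (-z) ^ 4) := by ring
      _ ≤ 16 * ((n + 1) * z ^ 3) * (Real.exp (-(n : ℝ)) * Real.exp (-z) ^ 4) := by gcongr
      _ = 16 * (n + 1) * Real.exp (-(n : ℝ)) * ((z ^ 3 * Real.exp (-z) ^ 3) * Real.exp (-z)) := by
          ring
      _ ≤ 16 * (n + 1) * Real.exp (-(n : ℝ)) * 1 := by
          gcongr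
          exact mul_le_one₀ f7 hZ.le f8
      _ = _ := by ring
  have f10 : (k : ℝ) * (1 - 1 / (16 * z)) ^ (16 * (k * K) * (n + k)) ≤ Real.exp (-(n : ℝ)) :=
    (mul_le_mul_of_nonneg_left f1 (by linarith)).trans f4
  rw [mul_add, mul_div_assoc]
  have f11 : 17 * (n + 1) * Real.exp (-(n : ℝ)) ≤ 17 * (n + 1) * (1 / 2 ^ n) := by gcongr
  calc _ ≤ 16 * ((n : ℝ) + 1) * Real.exp (-(n : ℝ)) + Real.exp (-(n : ℝ)) := add_le_add f5 f10
    _ ≤ 17 * (n + 1) * Real.exp (-(n : ℝ)) := by nlinarith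
    _ ≤ _ := f11.trans (le_of_eq (by ring))

theorem ceil_bounds (h0 : 0 < ε) (h1 : ε ≤ 1) :
    1 ≤ ⌈1 / ε⌉₊ ∧ 1 / (⌈1 / ε⌉₊ : ℝ) ≤ ε ∧ (⌈1 / ε⌉₊ : ℝ) ≤ 2 / ε := by
  have h2 : 1 ≤ 1 / ε := by rw [le_div_iff₀ h0]; linarith
  have h3 := Nat.le_ceil (1 / ε)
  have h4 := Nat.ceil_lt_add_one (a := 1 / ε) (by positivity)
  refine ⟨by exact_mod_cast h2.trans h3, ?_, ?_⟩
  · rw [div_le_iff₀ (by linarith)]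
    rw [div_le_iff₀ h0] at h3
    linarith
  · have : 2 / ε = 1 / ε + 1 / ε := by ring
    linarith

/-- Both roundings of 1/ε enter here: 1/K ≤ ε gives the hypothesis with 1/K, and K ≤ 2/ε gives
1/(3kK) ≥ ε/(6k), the origin of the constant 6. -/
theorem ev_generator_le (hg : Monotone g) (hk : 1 ≤ k) (hε0 : 0 < ε) (hε1 : ε ≤ 1) (h0 : 0 ≤ δ)
    (h1 : δ ≤ 1) (hC : bernoulliProb k δ g + ε ≤ C.successProb g) :
    ev (generator.run C g ε δ n)
      (fun s => ind (¬δ + ε / (6 * k) ≤ s.solver.successProb g)) ≤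
      ENNReal.ofReal (17 * (n + 1) / 2 ^ n) := by
  obtain ⟨hK, hK1, hK2⟩ := ceil_bounds hε0 hε1
  rw [run_generator, ev_bind]
  refine ev_le_of_le fun s hs => ?_
  obtain ⟨hi, hc⟩ := always_setup_initial s hs
  rw [ev_bind]
  refine le_trans (ev_mono_support (f' := fun s' => ind (¬∃ st, AtStage δ n ⌈1 / ε⌉₊ st s'.memory ∧
    Ready (st + 1) s'.memory ∧ Advantage g δ ⌈1 / ε⌉₊ st s'.memory ∧
      Terminal g δ ⌈1 / ε⌉₊ st s'.memory)) fun s' hs' => ?_) ?_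
  · refine ev_le_of_le fun s'' hs'' => ind_mono (mt fun ⟨st, a1, a2, a3, a4⟩ => ?_)
    have he := always_emission s' ((always_fixInstances_code s s' hs').trans hc) s'' hs''
    have e1 : s''.solver = built s'.memory := by
      rw [ProgramState.solver, he.1, he.2, built]
    rw [e1]
    refine le_trans ?_ (le_successProb_built hg hk hK h0 h1 a1 a2 a3 a4)
    have hk' : (0 : ℝ) < k := by exact_mod_cast hk
    have hK' : (0 : ℝ) < (⌈1 / ε⌉₊ : ℝ) := by exact_mod_cast hK
    rw [le_div_iff₀ hε0] at hK2
    have : ε / (6 * k) ≤ 1 / (k * ⌈1 / ε⌉₊) / 3 := by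
      rw [div_div, div_le_div_iff₀ (by positivity) (by positivity)]
      nlinarith
    linarith
  · rw [Program.ev_exec (p := fun _ => true) (q := fun _ => true) (c := fixInstances) (by rfl) s
      fun m _ => ind (¬∃ st, AtStage δ n ⌈1 / ε⌉₊ st m ∧ Ready (st + 1) m ∧
        Advantage g δ ⌈1 / ε⌉₊ st m ∧ Terminal g δ ⌈1 / ε⌉₊ st m)]
    exact (ev_fixInstances_le hk hK h0 h1 hi (by linarith)).trans (searchFailure_le hk hK)

/-! ## The bounds of the theorem -/

/-- Equivalent to e^(5/3) ≤ 6, which is checked after cubing: e^5 < 216. -/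
theorem ten_le_mul_log : 10 ≤ 6 * Real.log 6 := by
  have h1 : Real.exp (5 / 3) ≤ 6 := by
    have h2 : Real.exp (5 / 3) ^ 3 = Real.exp 1 ^ 5 := by
      rw [← Real.exp_nat_mul, ← Real.exp_nat_mul]
      norm_num
    have h3 : Real.exp 1 ^ 5 ≤ 2.7182818286 ^ 5 :=
      pow_le_pow_left₀ (Real.exp_pos 1).le Real.exp_one_lt_d9.le 5
    refine le_of_pow_le_pow_left₀ (n := 3) (by norm_num) (by norm_num) ?_
    rw [h2]
    exact h3.trans (by norm_num)
  have := (Real.le_log_iff_exp_le (by norm_num)).2 h1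
  linarith

/-- K ≤ 2/ε bounds the number of trials by 10k/ε, and 10 ≤ 6 log 6 ≤ 6 log(6k/ε). -/
theorem trials_le (hk : 1 ≤ k) (h0 : 0 < ε) (h1 : ε ≤ 1) :
    5 * ((k : ℝ) * ⌈1 / ε⌉₊) ≤ 6 * k / ε * Real.log (6 * k / ε) := by
  have hk' : (1 : ℝ) ≤ k := by exact_mod_cast hk
  have h2 : 1 ≤ k / ε := by rw [le_div_iff₀ h0]; linarith
  have h3 : Real.log 6 ≤ Real.log (6 * k / ε) := by
    refine Real.log_le_log (by norm_num) ?_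
    rw [mul_div_assoc]; linarith
  calc 5 * ((k : ℝ) * ⌈1 / ε⌉₊) ≤ 5 * (k * (2 / ε)) := by gcongr; exact (ceil_bounds h0 h1).2.2
    _ = k / ε * 10 := by ring
    _ ≤ k / ε * (6 * Real.log 6) := by gcongr; exact ten_le_mul_log
    _ = 6 * k / ε * Real.log 6 := by ring
    _ ≤ _ := by gcongr

/-- One constant has to serve as factor and as exponent. Replacing ⌈1/ε⌉ by 2/ε costs the factor 2^d
for degree d, and d ≤ 2^d. -/
theorem pow_timeDegree_le (hk : 1 ≤ k) (h0 : 0 < ε) (h1 : ε ≤ 1) (r : ℕ) :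
    (((k + ⌈1 / ε⌉₊ + n + r : ℕ) ^ timeDegree : ℕ) : ℝ) ≤
      (2 ^ timeDegree : ℕ) * ((k : ℝ) + 1 / ε + n + r) ^ (2 ^ timeDegree) := by
  have hk' : (1 : ℝ) ≤ k := by exact_mod_cast hk
  have h2 := (ceil_bounds h0 h1).2.2
  have h3 : 2 / ε = 2 * (1 / ε) := by ring
  have h4 : 0 < 1 / ε := by positivity
  have hn : (0 : ℝ) ≤ n := Nat.cast_nonneg n
  have hr : (0 : ℝ) ≤ r := Nat.cast_nonneg r
  push_cast
  calc ((k : ℝ) + ⌈1 / ε⌉₊ + n + r) ^ timeDegree ≤ (2 * (k + 1 / ε + n + r)) ^ timeDegree := by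
        refine pow_le_pow_left₀ (by positivity) ?_ _
        linarith
    _ = 2 ^ timeDegree * ((k : ℝ) + 1 / ε + n + r) ^ timeDegree := mul_pow _ _ _
    _ ≤ _ := by
        refine mul_le_mul_of_nonneg_left (pow_le_pow_right₀ (by linarith) ?_) (by positivity)
        exact Nat.lt_two_pow_self.le

theorem le_two_pow_timeDegree : 17 ≤ 2 ^ timeDegree := by
  calc 17 ≤ 2 ^ 5 := by norm_num
    _ ≤ _ := Nat.pow_le_pow_right (by norm_num) (by unfold timeDegree; omega)

end Generator

end WVP

theorem mainTheorem3 :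
    ∃ (Gen : WVP.Program) (c : ℕ),
      ∀ (P : WVP.Puzzle) (k : ℕ) (C : WVP.SolverCircuit P k) (g : WVP.Word k → Bool)
        (ε δ : ℝ) (n : ℕ),
        1 ≤ k → Monotone g → 0 < ε → ε ≤ 1 → 0 ≤ δ → δ ≤ 1 →
        (WVP.bernoulliProb k δ g + ε ≤ C.successProb g →
          1 - (c : ℝ) * ((n : ℝ) + 1) ^ c / 2 ^ n ≤
            WVP.prob (Gen.run C g ε δ n) {s | δ + ε / (6 * k) ≤ s.solver.successProb g}) ∧
        ∀ s ∈ (Gen.run C g ε δ n).support,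
          s.solver.NonRewinding g ∧
          (s.solver.size : ℝ) ≤ C.size * (6 * k / ε * Real.log (6 * k / ε)) ∧
          (s.solver.code.length : ℝ) ≤ c * ((k : ℝ) + 1 / ε + n + P.rounds) ^ c ∧
          (s.time : ℝ) ≤ c * ((k : ℝ) + 1 / ε + n + P.rounds) ^ c := by
  -- This constant bounds the time and the code length, and it is at least 17, as the failure
  -- probability requires.
  refine ⟨WVP.Program.generator, 2 ^ WVP.timeDegree,
    fun P k C g ε δ n hk hg hε0 hε1 h0 h1 => ⟨fun hC => ?_, fun s hs => ?_⟩⟩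
  · have key := WVP.pr_le_of_ev_le (by positivity)
      (WVP.ev_generator_le (n := n) hg hk hε0 hε1 h0 h1 hC)
    rw [WVP.pr_not] at key
    have e1 : WVP.prob (WVP.Program.generator.run C g ε δ n)
        {s | δ + ε / (6 * k) ≤ s.solver.successProb g} =
        WVP.pr (WVP.Program.generator.run C g ε δ n)
          fun s => δ + ε / (6 * k) ≤ s.solver.successProb g := WVP.prob_eq _ _
    rw [e1]
    have e2 : 17 * ((n : ℝ) + 1) / 2 ^ n ≤ ((2 ^ WVP.timeDegree : ℕ) : ℝ) *
        ((n : ℝ) + 1) ^ (2 ^ WVP.timeDegree) / 2 ^ n := by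
      have h2 : (17 : ℝ) ≤ ((2 ^ WVP.timeDegree : ℕ) : ℝ) := by
        exact_mod_cast WVP.le_two_pow_timeDegree
      have h3 : (n : ℝ) + 1 ≤ ((n : ℝ) + 1) ^ (2 ^ WVP.timeDegree) :=
        le_self_pow₀ (by linarith [(Nat.cast_nonneg n : (0 : ℝ) ≤ n)])
          (by have := WVP.le_two_pow_timeDegree; omega)
      gcongr
    linarith
  · obtain ⟨⟨st, hst⟩, hcode⟩ := WVP.always_generator hk s hs
    obtain ⟨hK, -, -⟩ := WVP.ceil_bounds hε0 hε1
    have ht := WVP.always_generator_time (B := k + ⌈1 / ε⌉₊ + n + P.rounds) (by omega) (by omega)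
      (by omega) (by omega) (by omega) s hs
    have hsol : s.solver = WVP.built s.memory := by
      rw [WVP.ProgramState.solver, hcode, WVP.built]
    have htime : (s.time : ℝ) ≤ ((2 ^ WVP.timeDegree : ℕ) : ℝ) *
        ((k : ℝ) + 1 / ε + n + P.rounds) ^ (2 ^ WVP.timeDegree) :=
      le_trans (by exact_mod_cast ht.1) (WVP.pow_timeDegree_le hk hε0 hε1 P.rounds)
    refine ⟨hsol ▸ WVP.nonRewinding_built hst, ?_, le_trans (by exact_mod_cast ht.2) htime, htime⟩
    rw [hsol]
    have h2 : ((WVP.built s.memory).size : ℝ) ≤ 5 * (k * ⌈1 / ε⌉₊) * C.size := by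
      exact_mod_cast WVP.size_built_le hk hK hst
    refine h2.trans ?_
    rw [mul_comm]
    exact mul_le_mul_of_nonneg_left (WVP.trials_le hk hε0 hε1) (Nat.cast_nonneg _)
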